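/- All manifolds and maps are smooth; "closed" means compact without boundary. Let $(M,\omega)$ be a symplectic manifold of dimension $2n$. Two closed Lagrangian submanifolds $L,L'\subset M$ are called \emph{Lagrangian cobordant} if there are a compact $(n+1)$-manifold $V$ with boundary $\partial V=L\sqcup L'$ and a Lagrangian embedding $$i\colon V\hookrightarrow \big(([0,1]\times\mathbb{R})\times M,\ (dx\wedge dy)\oplus\omega\big)$$ which maps $\partial V$ onto $\{(0,0)\}\times L\,\cup\,\{(1,0)\}\times L'$ and such that, for some $\epsilon>0$, $$i(V)\cap\big([0,\epsilon)\times\mathbb{R}\times M\big)=[0,\epsilon)\times\{0\}\times L,\qquad i(V)\cap\big((1-\epsilon,1]\times\mathbb{R}\times M\big)=(1-\epsilon,1]\times\{0\}\times L'.$$ They are called \emph{smoothly cobordant} if there is a compact $(n+1)$-manifold $Y$ with $\partial Y\cong L\sqcup L'$, and \emph{$\mathbb{Z}_2$-homologous} if the images of their $\mathbb{Z}_2$-fundamental classes in $H_n(M;\mathbb{Z}_2)$ are equal. (1) If two closed Lagrangian submanifolds of a symplectic manifold are Lagrangian cobordant, then they are $\mathbb{Z}_2$-homologous. (2) Let $S^2\subset\mathbb{R}^3$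 be the unit sphere and let $\omega$ be a Euclidean area form on $S^2$, i.e. a nonzero constant multiple of the standard one. In the symplectic manifold $(S^2\times S^2,\omega\oplus\omega)$, the antidiagonal sphere $\overline{\Delta}=\{(x,-x)\mid x\in S^2\}$ and the Clifford torus $\mathbb{T}_{\mathrm{Cl}}=S^1\times S^1$ (the product of the equators of the two factors) are closed Lagrangian submanifolds. They are smoothly cobordant, but they represent different classes in $H_2(S^2\times S^2;\mathbb{Z}_2)$, and they are not Lagrangian cobordant. -/

import Mathlib

open Set Module CategoryTheory AlgebraicTopology
open scoped Manifold ContDiff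

noncomputable section

/-! ### Differential 2-forms -/

section Forms

variable {E : Type} [NormedAddCommGroup E] [NormedSpace ℝ E] {H : Type} [TopologicalSpace H]
  (I : ModelWithCorners ℝ E H) (M : Type) [TopologicalSpace M] [ChartedSpace H M]

/-- A field of bilinear forms on the tangent spaces of `M`. It is a differential 2-form when it is
alternating and smooth; see `IsSymplectic`. -/
abbrev TwoForm : Type :=
  (x : M) → TangentSpace I x →L[ℝ] TangentSpace I x →L[ℝ] ℝ

variable {I M}

variable {E' : Type} [NormedAddCommGroup E'] [NormedSpace ℝ E'] {H' : Type} [TopologicalSpace H']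
  {I' : ModelWithCorners ℝ E' H'} {M' : Type} [TopologicalSpace M'] [ChartedSpace H' M']

/-- The pullback `(f^*Ω)_x (u, v) = Ω_{f x} (df_x u, df_x v)`. -/
def TwoForm.pullback (I' : ModelWithCorners ℝ E' H') (f : M' → M) (Ω : TwoForm I M) :
    TwoForm I' M' :=
  fun x => ContinuousLinearMap.bilinearComp (E := E) (F := E) (E' := E') (F' := E') (G := ℝ)
    (Ω (f x)) (mfderiv I' I f x) (mfderiv I' I f x)

/-- The expression of `Ω` in the preferred chart `φ` of `M` at `x₀`, that is `(φ⁻¹)^* Ω`, as a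
field of bilinear forms on the model vector space `E` (meaningful on the image of `φ`). -/
def TwoForm.inChart (Ω : TwoForm I M) (x₀ : M) : E → E →L[ℝ] E →L[ℝ] ℝ :=
  Ω.pullback 𝓘(ℝ, E) (extChartAt I x₀).symm

variable (I) in
/-- `Ω` is a symplectic form on the (boundaryless) manifold `M`: a smooth, alternating, closed and
nondegenerate 2-form. Smoothness and closedness are read in charts; for a 2-form `η` on a vector
space, `dη (u, v, w) = (D_u η) (v, w) + (D_v η) (w, u) + (D_w η) (u, v)`. -/
structure IsSymplectic (Ω : TwoForm I M) : Prop where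
  alternating : ∀ (x : M) (v : TangentSpace I x), Ω x v v = 0
  nondegenerate : ∀ (x : M) (v : TangentSpace I x), (∀ w, Ω x v w = 0) → v = 0
  smooth : ∀ x₀ : M, ContDiffOn ℝ ∞ (Ω.inChart x₀) (extChartAt I x₀).target
  closed : ∀ x₀ : M, ∀ y ∈ (extChartAt I x₀).target, ∀ u v w : E,
    fderiv ℝ (Ω.inChart x₀) y u v w + fderiv ℝ (Ω.inChart x₀) y v w u
      + fderiv ℝ (Ω.inChart x₀) y w u v = 0

/-- The product form `Ω ⊕ Ω'` on `M × M'`: the sum of the pullbacks by the two projections. -/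
def TwoForm.prod (Ω : TwoForm I M) (Ω' : TwoForm I' M') : TwoForm (I.prod I') (M × M') :=
  fun p => Ω.pullback (I.prod I') Prod.fst p + Ω'.pullback (I.prod I') Prod.snd p

/-- The wedge product of two linear forms, `(α ∧ β) (u, v) = α u * β v - β u * α v`. -/
def wedge (α β : E →L[ℝ] ℝ) : E →L[ℝ] E →L[ℝ] ℝ :=
  α.smulRight β - β.smulRight α

end Forms

/-- The form `dx ∧ dy` on the plane `ℝ × ℝ`. -/
def planeForm : TwoForm 𝓘(ℝ, ℝ × ℝ) (ℝ × ℝ) :=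
  fun _ => wedge (ContinuousLinearMap.fst ℝ ℝ ℝ) (ContinuousLinearMap.snd ℝ ℝ ℝ)

/-! ### Closed submanifolds, smooth cobordism and Lagrangian cobordism -/

section Cobordism

variable {E : Type} [NormedAddCommGroup E] [NormedSpace ℝ E] {H : Type} [TopologicalSpace H]
  (I : ModelWithCorners ℝ E H) {M : Type} [TopologicalSpace M] [ChartedSpace H M]

/-- A presentation of the subset `L` of `M` as a closed (that is, compact and boundaryless)
`n`-dimensional embedded submanifold: a closed smooth `n`-manifold `N` and a smooth embedding of
`N` in `M` with image `L`. The smooth structure on `L` does not depend on the presentation. -/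
structure ClosedSubmanifold (n : ℕ) (L : Set M) where
  ModelSpace : Type
  [normedAddCommGroup : NormedAddCommGroup ModelSpace]
  [normedSpace : NormedSpace ℝ ModelSpace]
  [finiteDimensional : FiniteDimensional ℝ ModelSpace]
  ModelTop : Type
  [topModel : TopologicalSpace ModelTop]
  model : ModelWithCorners ℝ ModelSpace ModelTop
  [boundaryless : model.Boundaryless]
  N : Type
  [top : TopologicalSpace N]
  [charted : ChartedSpace ModelTop N]
  [isManifold : IsManifold model ∞ N]
  [compact : CompactSpace N]
  [hausdorff : T2Space N]
  finrank_eq : finrank ℝ ModelSpace = n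
  emb : N → M
  isSmoothEmbedding : Manifold.IsSmoothEmbedding model I ∞ emb
  range_eq : range emb = L

attribute [instance] ClosedSubmanifold.normedAddCommGroup ClosedSubmanifold.normedSpace
  ClosedSubmanifold.finiteDimensional ClosedSubmanifold.topModel ClosedSubmanifold.boundaryless
  ClosedSubmanifold.top ClosedSubmanifold.charted ClosedSubmanifold.isManifold
  ClosedSubmanifold.compact ClosedSubmanifold.hausdorff

variable {I}

/-- `L` is a closed `n`-dimensional embedded submanifold of `M` on which `Ω` vanishes. It is a
closed Lagrangian submanifold when `Ω` is symplectic and `dim M = 2 n`. -/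
def IsClosedLagrangian (Ω : TwoForm I M) (n : ℕ) (L : Set M) : Prop :=
  ∃ P : ClosedSubmanifold I n L, Ω.pullback P.model P.emb = 0

variable (I) in
/-- The closed `n`-dimensional submanifolds `L` and `L'` are smoothly cobordant: there is a compact
smooth `(n + 1)`-manifold `Y` with `∂Y = L ⊔ L'`. -/
def SmoothlyCobordant (n : ℕ) (L L' : Set M) : Prop :=
  ∃ (P : ClosedSubmanifold I n L) (P' : ClosedSubmanifold I n L')
    (Y : Type) (_ : TopologicalSpace Y) (_ : ChartedSpace (EuclideanHalfSpace (n + 1)) Y)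
    (_ : IsManifold (𝓡∂ (n + 1)) ∞ Y) (_ : CompactSpace Y) (_ : T2Space Y)
    (j : P.N → Y) (j' : P'.N → Y),
    Manifold.IsSmoothEmbedding P.model (𝓡∂ (n + 1)) ∞ j ∧
    Manifold.IsSmoothEmbedding P'.model (𝓡∂ (n + 1)) ∞ j' ∧
    Disjoint (range j) (range j') ∧
    range j ∪ range j' = (𝓡∂ (n + 1)).boundary Y

/-- The closed Lagrangians `L` and `L'` in `(M, Ω)`, of dimension `n`, are Lagrangian cobordant:
there are a compact smooth `(n + 1)`-manifold `V` with boundary and a Lagrangian embedding `i` of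
`V` in `([0,1] × ℝ) × M` with the form `(dx ∧ dy) ⊕ Ω`, such that `i` identifies `∂V` with
`L ⊔ L'`, placed over the points `(0, 0)` and `(1, 0)`, and such that the image of `i` is the
product `[0, ε) × {0} × L` over `[0, ε) × ℝ` and the product `(1 - ε, 1] × {0} × L'` over
`(1 - ε, 1] × ℝ`. Smooth maps to `([0,1] × ℝ) × M` are smooth maps to `(ℝ × ℝ) × M` whose first
coordinate takes its values in `[0,1]`. -/
def LagrangianCobordant (Ω : TwoForm I M) (n : ℕ) (L L' : Set M) : Prop :=
  ∃ (V : Type) (_ : TopologicalSpace V) (_ : ChartedSpace (EuclideanHalfSpace (n + 1)) V)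
    (_ : IsManifold (𝓡∂ (n + 1)) ∞ V) (_ : CompactSpace V) (_ : T2Space V)
    (i : V → (ℝ × ℝ) × M),
    Manifold.IsSmoothEmbedding (𝓡∂ (n + 1)) (𝓘(ℝ, ℝ × ℝ).prod I) ∞ i ∧
    (planeForm.prod Ω).pullback (𝓡∂ (n + 1)) i = 0 ∧
    (∀ v, (i v).1.1 ∈ Icc (0 : ℝ) 1) ∧
    i '' (𝓡∂ (n + 1)).boundary V = ({(0, 0)} ×ˢ L) ∪ ({(1, 0)} ×ˢ L') ∧
    ∃ ε : ℝ, 0 < ε ∧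
      range i ∩ {p | p.1.1 ∈ Ico 0 ε} = (Ico 0 ε ×ˢ {0}) ×ˢ L ∧
      range i ∩ {p | p.1.1 ∈ Ioc (1 - ε) 1} = (Ioc (1 - ε) 1 ×ˢ {0}) ×ˢ L'

end Cobordism

/-! ### Homology classes of closed submanifolds with coefficients in `ℤ/2` -/

section Homology

/-- The singular chain complex functor with coefficients in `ℤ/2`. -/
abbrev singularChains₂ : TopCat.{0} ⥤ ChainComplex (ModuleCat.{0} (ZMod 2)) ℕ :=
  (singularChainComplexFunctor (ModuleCat.{0} (ZMod 2))).obj (ModuleCat.of (ZMod 2) (ZMod 2))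

/-- The singular homology `H_n(X; ℤ/2)`. -/
abbrev singularHomology₂ (n : ℕ) (X : Type) [TopologicalSpace X] : ModuleCat.{0} (ZMod 2) :=
  (singularChains₂.obj (TopCat.of X)).homology n

/-- The map `f_* : H_n(X; ℤ/2) → H_n(Y; ℤ/2)` induced by a continuous map `f`. -/
def homologyPush₂ (n : ℕ) {X Y : Type} [TopologicalSpace X] [TopologicalSpace Y] (f : C(X, Y)) :
    singularHomology₂ n X → singularHomology₂ n Y :=
  (HomologicalComplex.homologyMap (singularChains₂.map (TopCat.ofHom f)) n).hom

/-- The inclusion in `X` of a subset, as a continuous map. -/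
def inclusionMap {X : Type} [TopologicalSpace X] (A : Set X) : C(A, X) :=
  ⟨Subtype.val, continuous_subtype_val⟩

/-- The relative singular chain complex `C(X, A; ℤ/2) = C(X; ℤ/2) / C(A; ℤ/2)`. -/
abbrev relativeChains₂ {X : Type} [TopologicalSpace X] (A : Set X) :
    ChainComplex (ModuleCat.{0} (ZMod 2)) ℕ :=
  Limits.cokernel (singularChains₂.map (TopCat.ofHom (inclusionMap A)))

/-- The natural map `H_n(X; ℤ/2) → H_n(X, A; ℤ/2)`. -/
def toRelativeHomology₂ (n : ℕ) {X : Type} [TopologicalSpace X] (A : Set X) :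
    singularHomology₂ n X → (relativeChains₂ A).homology n :=
  (HomologicalComplex.homologyMap
    (Limits.cokernel.π (singularChains₂.map (TopCat.ofHom (inclusionMap A)))) n).hom

/-- `μ` is the `ℤ/2`-fundamental class of the closed `n`-manifold `X`: for every point `x`, the
image of `μ` in `H_n(X, X ∖ {x}; ℤ/2) ≅ ℤ/2` is the generator, that is, the nonzero element. -/
def IsFundamentalClass₂ (n : ℕ) {X : Type} [TopologicalSpace X] (μ : singularHomology₂ n X) :
    Prop :=
  ∀ x : X, toRelativeHomology₂ n ({x}ᶜ : Set X) μ ≠ 0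

/-- The closed `n`-dimensional submanifold `L` of `M` represents the class `c` in
`H_n(M; ℤ/2)`: the class `c` is the image of the `ℤ/2`-fundamental class of `L`. -/
def RepresentsClass₂ (n : ℕ) {M : Type} [TopologicalSpace M] (L : Set M)
    (c : singularHomology₂ n M) : Prop :=
  ∃ μ : singularHomology₂ n L, IsFundamentalClass₂ n μ ∧ homologyPush₂ n (inclusionMap L) μ = c

/-- The closed `n`-dimensional submanifolds `L` and `L'` of `M` are `ℤ/2`-homologous: they
represent the same class in `H_n(M; ℤ/2)`. -/
def Homologous₂ (n : ℕ) {M : Type} [TopologicalSpace M] (L L' : Set M) : Prop :=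
  ∃ c : singularHomology₂ n M, RepresentsClass₂ n L c ∧ RepresentsClass₂ n L' c

end Homology

/-! ### The antidiagonal sphere and the Clifford torus in `S² × S²` -/

/-- The unit sphere in `ℝ³`. -/
abbrev S2 : Type := Metric.sphere (0 : EuclideanSpace ℝ (Fin 3)) 1

/-- The Euclidean area form on the unit sphere: the restriction to `S²` of the form
`x₀ dx₁ ∧ dx₂ + x₁ dx₂ ∧ dx₀ + x₂ dx₀ ∧ dx₁` on `ℝ³`, that is, `(u, v) ↦ det (x, u, v)` on the
tangent space at `x`. -/
def areaForm : TwoForm (𝓡 2) S2 :=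
  TwoForm.pullback (I := 𝓘(ℝ, EuclideanSpace ℝ (Fin 3))) (𝓡 2)
    (Subtype.val : S2 → EuclideanSpace ℝ (Fin 3))
    (fun x =>
      x 0 • wedge (EuclideanSpace.proj (1 : Fin 3)) (EuclideanSpace.proj (2 : Fin 3))
      + x 1 • wedge (EuclideanSpace.proj (2 : Fin 3)) (EuclideanSpace.proj (0 : Fin 3))
      + x 2 • wedge (EuclideanSpace.proj (0 : Fin 3)) (EuclideanSpace.proj (1 : Fin 3)))

/-- The split form `(c σ) ⊕ (c σ)` on `S² × S²`, for `σ` the Euclidean area form. -/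
def splitForm (c : ℝ) : TwoForm ((𝓡 2).prod (𝓡 2)) (S2 × S2) :=
  TwoForm.prod (fun x => c • areaForm x) (fun x => c • areaForm x)

/-- The antidiagonal `{(x, -x)}` in `S² × S²`. -/
def antidiagonalSphere : Set (S2 × S2) := {p | p.2 = -p.1}

/-- The Clifford torus: the product of the equators `{x₂ = 0}` of the two spheres. -/
def cliffordTorus : Set (S2 × S2) :=
  {x : S2 | x.1 2 = 0} ×ˢ {x : S2 | x.1 2 = 0}

end

/-! The first assertion is proved topologically. Over `0 < x < 1` a cobordism is a manifold `T` of
dimension `n + 1` without boundary. It has a mod 2 fundamental class along the compact slab `δ ≤ x ≤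
1 - δ`, represented by a chain `z` whose boundary misses the slab and therefore splits as `a + b`,
with `a` in the left end and `b` in the right one. After projection to `M` the sum `a + b` bounds
the image of `z`, so `a` and `b` have the same class in `M`.

It remains to see that `a` projects to a fundamental cycle of `L`; this is
`exists_fundamental_of_cylindrical_end`. If the projection of `a` were locally null at some `y` in
`L`, a chain below height `δ` could be added to `z` so that the boundary lies above height `δ` or
off the fibre of `y`. Pushing the result upwards along the cylinder would make `z` null at the point
over `y` at height `δ`, contrary to the choice of `z`. The right end is treated by reflecting the
strip (`homologous_of_cylindrical_ends`).

The fundamental class comes from `LocallyEuclidean.hasFundamental`. Barycentric subdivision gives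
excision in the form `exists_split`. The local homology of Euclidean space is found by induction on
the dimension (`IsEuclideanAt.line_prod`), extended to convex sets by radial pushing
(`mem_nulls_of_convex`), and to compact sets by Mayer–Vietoris over finite unions. Modulo two the
local generator is unique, so local classes agree on overlaps without any orientation.

All chains live in one augmented free module: a simplex with `n` vertices has degree `n - 1`, and
the empty simplex is allowed. Arguments ignore degrees and restore homogeneity with `comp`. The
comparison with the categorical singular complex is made once, through `IsClass`.

For the second assertion, the first projection maps the antidiagonal homeomorphically to the sphere,
while it maps the torus into an equator, which contracts to the pole; hence the classes differ, and
the first assertion excludes a Lagrangian cobordism. A smooth cobordism is the disjoint union of a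
ball and a solid torus in space, realised as the superlevel set of a function with regular value
zero. -/

noncomputable section

/-! ### Affine chains modulo two -/

section AffineChains

/-- The standard simplex with `n` vertices. -/
abbrev Spx (n : ℕ) : Type := stdSimplex ℝ (Fin n)

/-- A topological space in which convex combinations of finitely many points are defined. -/
class ConvexCombSpace (K : Type) [TopologicalSpace K] where
  /-- The convex combination of the points `v i` with weights `t i`. -/
  comb : ∀ {n : ℕ}, Spx n → (Fin n → K) → K
  continuous_comb : ∀ {n : ℕ} (v : Fin n → K), Continuous fun t : Spx n => comb t v

open ConvexCombSpace

instance instConvexCombSpaceSubtype {E : Type} [AddCommGroup E] [Module ℝ E] [TopologicalSpace E]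
    [ContinuousAdd E] [ContinuousSMul ℝ E] {K : Set E} [h : Fact (Convex ℝ K)] :
    ConvexCombSpace K where
  comb t v := ⟨∑ i, t i • (v i : E),
    h.out.sum_mem (fun i _ => t.2.1 i) t.2.2 (fun i _ => (v i).2)⟩
  continuous_comb v := by
    refine Continuous.subtype_mk (continuous_finsetSum _ fun i _ => ?_) _
    exact ((continuous_apply i).comp continuous_subtype_val).smul continuous_const

instance (n : ℕ) : Fact (Convex ℝ (stdSimplex ℝ (Fin n))) := ⟨convex_stdSimplex ℝ _⟩

instance : Fact (Convex ℝ unitInterval) := ⟨convex_Icc 0 1⟩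

instance {K K' : Type} [TopologicalSpace K] [TopologicalSpace K'] [ConvexCombSpace K]
    [ConvexCombSpace K'] : ConvexCombSpace (K × K') where
  comb t v := (comb t fun i => (v i).1, comb t fun i => (v i).2)
  continuous_comb v := (continuous_comb _).prodMk (continuous_comb _)

variable {K K' K'' : Type} [TopologicalSpace K] [TopologicalSpace K'] [TopologicalSpace K'']
  [ConvexCombSpace K] [ConvexCombSpace K'] [ConvexCombSpace K'']

/-- A map that preserves convex combinations. -/
def PreservesComb (g : K → K') : Prop :=
  ∀ (n : ℕ) (t : Spx n) (v : Fin n → K), g (comb t v) = comb t (g ∘ v)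

/-- The coordinate vertices of the standard simplex. -/
def spxVertex {n : ℕ} (i : Fin n) : Spx n := stdSimplex.vertex i

/-- The affine simplex with vertices `v`. -/
def affineSimplex {n : ℕ} (v : Fin n → K) : C(Spx n, K) := ⟨fun t => comb t v, continuous_comb v⟩

@[simp] lemma affineSimplex_apply {n : ℕ} (v : Fin n → K) (t : Spx n) :
    affineSimplex v t = comb t v := rfl

lemma coe_comb {E : Type} [AddCommGroup E] [Module ℝ E] [TopologicalSpace E]
    [ContinuousAdd E] [ContinuousSMul ℝ E] {K : Set E} [Fact (Convex ℝ K)] {n : ℕ} (t : Spx n)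
    (v : Fin n → K) : ((comb t v : K) : E) = ∑ i, t i • (v i : E) := rfl

lemma coe_comb_spx {n k : ℕ} (t : Spx n) (v : Fin n → Spx k) (j : Fin k) :
    (comb t v : Spx k) j = ∑ i, t i * v i j := by
  have h := congrFun (coe_comb t v) j
  simp only [Finset.sum_apply, Pi.smul_apply, smul_eq_mul] at h
  exact h

lemma comb_spxVertex_right {n : ℕ} (t : Spx n) : comb t (spxVertex (n := n)) = t := by
  refine stdSimplex.ext (funext fun j => ?_)
  rw [coe_comb_spx]
  simp [spxVertex, stdSimplex.vertex, Pi.single_apply]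

/-- The convex structure is associative and unital. -/
class LawfulConvexCombSpace (K : Type) [TopologicalSpace K] [ConvexCombSpace K] : Prop where
  comb_comb : ∀ {n k : ℕ} (t : Spx n) (s : Fin n → Spx k) (v : Fin k → K),
    comb (comb t s) v = comb t fun i => comb (s i) v
  comb_vertex : ∀ {n : ℕ} (i : Fin n) (v : Fin n → K), comb (spxVertex i) v = v i

instance {E : Type} [AddCommGroup E] [Module ℝ E] [TopologicalSpace E]
    [ContinuousAdd E] [ContinuousSMul ℝ E] {K : Set E} [Fact (Convex ℝ K)] :
    LawfulConvexCombSpace K where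
  comb_comb t s v := by
    apply Subtype.ext
    simp only [coe_comb, coe_comb_spx, Finset.sum_smul, Finset.smul_sum, mul_smul]
    exact Finset.sum_comm
  comb_vertex i v := by
    apply Subtype.ext
    rw [coe_comb]
    simp [spxVertex, stdSimplex.vertex, Pi.single_apply]

instance [LawfulConvexCombSpace K] [LawfulConvexCombSpace K'] :
    LawfulConvexCombSpace (K × K') where
  comb_comb t s v := Prod.ext (LawfulConvexCombSpace.comb_comb t s _)
    (LawfulConvexCombSpace.comb_comb t s _)
  comb_vertex i v := Prod.ext (LawfulConvexCombSpace.comb_vertex i _)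
    (LawfulConvexCombSpace.comb_vertex i _)

lemma preservesComb_affineSimplex [LawfulConvexCombSpace K] {n : ℕ} (v : Fin n → K) :
    PreservesComb (affineSimplex v) :=
  fun _ t s => LawfulConvexCombSpace.comb_comb t s v

lemma PreservesComb.prodMap_id {g : K → K'} (hg : PreservesComb g) :
    PreservesComb (Prod.map g (id : K'' → K'')) :=
  fun _ t v => Prod.ext (hg _ t _) rfl

/-- The affine chains modulo two: formal sums of tuples of points. -/
abbrev AffChain (K : Type) : Type := (Σ n, Fin n → K) →₀ ZMod 2

namespace AffChain

/-- The chain of a single tuple. -/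
def of {K : Type} {n : ℕ} (v : Fin n → K) : AffChain K := Finsupp.single ⟨n, v⟩ 1

/-- The linear map with prescribed values on tuples. -/
def lift {K : Type} {A : Type} [AddCommGroup A] [Module (ZMod 2) A]
    (f : ∀ n, (Fin n → K) → A) : AffChain K →ₗ[ZMod 2] A :=
  Finsupp.linearCombination (ZMod 2) fun p : Σ n, Fin n → K => f p.1 p.2

section
variable {K K' : Type} {A : Type} [AddCommGroup A] [Module (ZMod 2) A]

@[simp] lemma lift_of (f : ∀ n, (Fin n → K) → A) {n : ℕ} (v : Fin n → K) :
    lift f (of v) = f n v := by simp [lift, of]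

lemma hom_ext {f g : AffChain K →ₗ[ZMod 2] A}
    (h : ∀ (n : ℕ) (v : Fin n → K), f (of v) = g (of v)) : f = g :=
  Finsupp.lhom_ext' fun p => LinearMap.ext_ring (h p.1 p.2)

/-- The map induced on affine chains by a map of points. -/
def map (g : K → K') : AffChain K →ₗ[ZMod 2] AffChain K' := lift fun _ v => of (g ∘ v)

@[simp] lemma map_of (g : K → K') {n : ℕ} (v : Fin n → K) : map g (of v) = of (g ∘ v) := lift_of _ v

/-- The cone with vertex `b`. -/
def cone (b : K) : AffChain K →ₗ[ZMod 2] AffChain K := lift fun _ v => of (Fin.cons b v : Fin _ → K)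

@[simp] lemma cone_of (b : K) {n : ℕ} (v : Fin n → K) :
    cone b (of v) = of (Fin.cons b v : Fin (n + 1) → K) := lift_of _ v

lemma map_cone (g : K → K') (b : K) (c : AffChain K) : map g (cone b c) = cone (g b) (map g c) := by
  have : map g ∘ₗ cone b = cone (g b) ∘ₗ map g := hom_ext fun n v => by
    simp [Fin.comp_cons]
  exact LinearMap.congr_fun this c

/-- The faces of a tuple. -/
def bdBasis : ∀ n, (Fin n → K) → AffChain K
  | 0, _ => 0
  | _ + 1, v => ∑ i : Fin (_ + 1), of (v ∘ i.succAbove)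

/-- The (augmented) boundary operator. -/
def bd : AffChain K →ₗ[ZMod 2] AffChain K := lift bdBasis

/-- Deleting the apex returns the base, and deleting any other vertex gives the cone on a face.
Since the complex is augmented, there is no exceptional case for a single point. -/
lemma bd_cone (b : K) (c : AffChain K) : bd (cone b c) = c + cone b (bd c) := by
  have : bd ∘ₗ cone b = LinearMap.id + cone b ∘ₗ bd := hom_ext fun n v => by
    simp only [bd, LinearMap.comp_apply, cone_of, lift_of, LinearMap.add_apply, LinearMap.id_apply]
    rw [bdBasis, Fin.sum_univ_succ]
    congr 1
    cases n with
    | zero => simp [bdBasis]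
    | succ n =>
      simp only [bdBasis, map_sum, cone_of]
      refine Finset.sum_congr rfl fun i _ => ?_
      congr 1
      funext j
      refine Fin.cases ?_ (fun j => ?_) j <;> simp
  exact LinearMap.congr_fun this c

@[simp] lemma bd_of_zero (v : Fin 0 → K) : bd (of v) = 0 := by simp [bd, bdBasis]

/-- Affine chains are generated by the empty tuple under cones. -/
lemma induction_cone {p : ∀ n, (Fin n → K) → Prop} (h0 : ∀ v, p 0 v)
    (hs : ∀ n (b : K) (v : Fin n → K), p n v → p (n + 1) (Fin.cons b v)) : ∀ n v, p n v := by
  intro n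
  induction n with
  | zero => exact h0
  | succ n ih =>
    intro v
    rw [← Fin.cons_self_tail v]
    exact hs n _ _ (ih _)

/-- Every tuple is an iterated cone over the empty tuple, so the cone formula alone forces this,
with no double sum over faces. -/
lemma bd_bd (c : AffChain K) : bd (bd c) = 0 := by
  have : (bd ∘ₗ bd : AffChain K →ₗ[ZMod 2] AffChain K) = 0 := hom_ext fun n v => by
    revert n v
    refine induction_cone (by simp) fun n b v ih => ?_
    simp only [LinearMap.comp_apply, LinearMap.zero_apply] at ih ⊢
    rw [← cone_of, bd_cone, map_add, bd_cone, ih, map_zero, add_zero, ZModModule.add_self]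
  exact LinearMap.congr_fun this c

lemma map_bd (g : K → K') (c : AffChain K) : map g (bd c) = bd (map g c) := by
  have : map g ∘ₗ bd = bd ∘ₗ map g := hom_ext fun n v => by
    cases n with
    | zero => simp
    | succ n => simp [bd, bdBasis, Function.comp_assoc]
  exact LinearMap.congr_fun this c

lemma map_map {K'' : Type} (g : K → K') (g' : K' → K'') (c : AffChain K) :
    map g' (map g c) = map (g' ∘ g) c := by
  have : map g' ∘ₗ map g = map (g' ∘ g) := hom_ext fun n v => by simp [Function.comp_assoc]
  exact LinearMap.congr_fun this c

end

/-- The barycenter of a nonempty tuple. -/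
def bary {n : ℕ} (v : Fin (n + 1) → K) : K := comb (stdSimplex.barycenter : Spx (n + 1)) v

/-- The homotopy between the identity and the barycentric subdivision, on tuples. -/
def subdivHtpyBasis : ∀ n, (Fin n → K) → AffChain K
  | 0, _ => 0
  | n + 1, v => cone (bary v) (of v + ∑ i : Fin (n + 1), subdivHtpyBasis n (v ∘ i.succAbove))

/-- The homotopy between the identity and the barycentric subdivision. -/
def subdivHtpy : AffChain K →ₗ[ZMod 2] AffChain K := lift subdivHtpyBasis

/-- The barycentric subdivision. -/
def subdiv : AffChain K →ₗ[ZMod 2] AffChain K :=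
  LinearMap.id + bd ∘ₗ subdivHtpy + subdivHtpy ∘ₗ bd

lemma subdivHtpy_of_succ {n : ℕ} (v : Fin (n + 1) → K) :
    subdivHtpy (of v) = cone (bary v) (of v + subdivHtpy (bd (of v))) := by
  simp [subdivHtpy, bd, subdivHtpyBasis, bdBasis]

lemma subdiv_apply (c : AffChain K) :
    subdiv c = c + bd (subdivHtpy c) + subdivHtpy (bd c) := rfl

lemma bd_subdivHtpy (c : AffChain K) :
    bd (subdivHtpy c) = c + subdiv c + subdivHtpy (bd c) := by
  have h1 := ZModModule.add_self c
  have h2 := ZModModule.add_self (subdivHtpy (bd c))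
  rw [subdiv_apply]
  linear_combination (norm := module) -h1 - h2

lemma subdiv_of_zero (v : Fin 0 → K) : subdiv (of v) = of v := by
  simp [subdiv_apply, subdivHtpy, subdivHtpyBasis]

/-- The subdivision is defined from its homotopy, so that the homotopy formula holds by
construction. This recovers the geometric recursion: subdivide the boundary and cone it off from the
barycenter. -/
lemma subdiv_of_succ {n : ℕ} (v : Fin (n + 1) → K) :
    subdiv (of v) = cone (bary v) (subdiv (bd (of v))) := by
  have h1 := ZModModule.add_self (of v)
  have h2 := ZModModule.add_self (subdivHtpy (bd (of v)))
  rw [subdiv_apply, subdivHtpy_of_succ, bd_cone, map_add, subdiv_apply (bd (of v)), bd_bd, map_zero,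
    add_zero]
  linear_combination (norm := module) h1 + h2

lemma map_subdivHtpy {g : K → K'} (hg : PreservesComb g) (c : AffChain K) :
    map g (subdivHtpy c) = subdivHtpy (map g c) := by
  have : map g ∘ₗ subdivHtpy = subdivHtpy ∘ₗ map g := hom_ext fun n => by
    induction n with
    | zero => intro v; simp [subdivHtpy, subdivHtpyBasis]
    | succ n ih =>
      intro v
      have hb : g (bary v) = bary (g ∘ v) := hg _ _ _
      simp only [LinearMap.comp_apply, subdivHtpy, lift_of, map_of] at ih ⊢
      simp only [subdivHtpyBasis, map_cone, map_add, map_of, map_sum, ih, hb]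
      rfl
  exact LinearMap.congr_fun this c

lemma map_subdiv {g : K → K'} (hg : PreservesComb g) (c : AffChain K) :
    map g (subdiv c) = subdiv (map g c) := by
  simp only [subdiv_apply, map_add, map_bd, map_subdivHtpy hg]

/-- The prism operator, on tuples. -/
def prismBasis : ∀ n, (Fin n → K) → AffChain (K × unitInterval)
  | 0, _ => 0
  | n + 1, v => cone (v 0, 0) (of (fun i => (v i, 1)) + prismBasis n (Fin.tail v))

/-- The prism operator. -/
def prism : AffChain K →ₗ[ZMod 2] AffChain (K × unitInterval) := lift prismBasis

lemma prism_cone (b : K) (c : AffChain K) :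
    prism (cone b c) = cone (b, 0) (cone (b, 1) (map (fun x => (x, 1)) c) + prism c) := by
  have : prism ∘ₗ cone b
      = cone (b, 0) ∘ₗ (cone (b, 1) ∘ₗ map (fun x => (x, 1)) + prism) := hom_ext fun n v => by
    simp only [prism, LinearMap.comp_apply, cone_of, lift_of, prismBasis, LinearMap.add_apply,
      map_of, map_add, Fin.cons_zero, Fin.tail_cons]
    congr 3
    funext j
    refine Fin.cases ?_ (fun j => ?_) j <;> simp
  exact LinearMap.congr_fun this c

lemma bd_prism (c : AffChain K) :
    bd (prism c) = map (fun x => (x, 0)) c + map (fun x => (x, 1)) c + prism (bd c) := by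
  have : bd ∘ₗ prism = map (fun x : K => (x, (0 : unitInterval)))
      + map (fun x : K => (x, (1 : unitInterval))) + prism ∘ₗ bd := hom_ext fun n v => by
    revert n v
    refine induction_cone (fun v => ?_) fun n b v ih => ?_
    -- Both ends of the prism over the empty tuple are the same empty tuple, and they cancel modulo
    -- two.
    · have h : ∀ i : unitInterval, (fun x : K => (x, i)) ∘ v = Fin.elim0 :=
        fun i => funext fun j => j.elim0
      simp [prism, prismBasis, h, ZModModule.add_self]
    · simp only [LinearMap.comp_apply, LinearMap.add_apply] at ih ⊢
      rw [← cone_of, bd_cone, prism_cone, bd_cone, map_add bd, bd_cone, ih, map_add prism,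
        prism_cone, map_cone, map_cone, map_bd]
      simp only [map_add]
      have h1 := ZModModule.add_self
        (cone (b, (0 : unitInterval)) (map (fun x => (x, (1 : unitInterval))) (of v)))
      linear_combination (norm := module) h1
  exact LinearMap.congr_fun this c

lemma map_prism (g : K → K') (c : AffChain K) :
    map (Prod.map g id) (prism c) = prism (map g c) := by
  have : map (Prod.map g id) ∘ₗ prism = prism ∘ₗ map g := hom_ext fun n v => by
    revert n v
    refine induction_cone (fun v => ?_) fun n b v ih => ?_
    · simp [prism, prismBasis]
    · simp only [LinearMap.comp_apply] at ih ⊢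
      rw [← cone_of, prism_cone, map_cone, map_cone, prism_cone, map_add, map_cone, ih, map_map,
        map_map]
      rfl
  exact LinearMap.congr_fun this c

end AffChain

end AffineChains

/-! ### Singular chains modulo two -/

section SingularChains

/-- The (augmented) singular chains modulo two, in all degrees together. A simplex with `n + 1`
vertices has degree `n`. -/
abbrev SChain (X : Type) [TopologicalSpace X] : Type := (Σ n, C(Spx n, X)) →₀ ZMod 2

namespace SChain

variable {X Y Z : Type} [TopologicalSpace X] [TopologicalSpace Y] [TopologicalSpace Z]
  {K K' : Type} [TopologicalSpace K] [TopologicalSpace K'] [ConvexCombSpace K] [ConvexCombSpace K']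
  {A : Type} [AddCommGroup A] [Module (ZMod 2) A]

/-- The chain of a single simplex. -/
def of {n : ℕ} (σ : C(Spx n, X)) : SChain X := Finsupp.single ⟨n, σ⟩ 1

/-- The linear map with prescribed values on simplices. -/
def lift (f : ∀ n, C(Spx n, X) → A) : SChain X →ₗ[ZMod 2] A :=
  Finsupp.linearCombination (ZMod 2) fun p : Σ n, C(Spx n, X) => f p.1 p.2

@[simp] lemma lift_of (f : ∀ n, C(Spx n, X) → A) {n : ℕ} (σ : C(Spx n, X)) :
    lift f (of σ) = f n σ := by simp [lift, of]

lemma hom_ext {f g : SChain X →ₗ[ZMod 2] A}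
    (h : ∀ (n : ℕ) (σ : C(Spx n, X)), f (of σ) = g (of σ)) : f = g :=
  Finsupp.lhom_ext' fun p => LinearMap.ext_ring (h p.1 p.2)

/-- The chains with all simplices in the set `s` of simplices. -/
abbrev supp (s : Set (Σ n, C(Spx n, X))) : Submodule (ZMod 2) (SChain X) :=
  Finsupp.supported (ZMod 2) (ZMod 2) s

lemma of_mem_supp {s : Set (Σ n, C(Spx n, X))} {n : ℕ} {σ : C(Spx n, X)} (h : ⟨n, σ⟩ ∈ s) :
    of σ ∈ supp s := Finsupp.single_mem_supported _ _ h

lemma supp_induction {s : Set (Σ n, C(Spx n, X))} {B : Submodule (ZMod 2) (SChain X)}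
    (h : ∀ (n : ℕ) (σ : C(Spx n, X)), ⟨n, σ⟩ ∈ s → of σ ∈ B) : supp s ≤ B := by
  rw [supp, Finsupp.supported_eq_span_single, Submodule.span_le]
  rintro _ ⟨p, hp, rfl⟩
  exact h p.1 p.2 hp

lemma map_mem_of_supp {s : Set (Σ n, C(Spx n, X))} {B : Submodule (ZMod 2) A}
    (f : SChain X →ₗ[ZMod 2] A)
    (h : ∀ (n : ℕ) (σ : C(Spx n, X)), ⟨n, σ⟩ ∈ s → f (of σ) ∈ B) {c : SChain X}
    (hc : c ∈ supp s) : f c ∈ B := by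
  have : supp s ≤ B.comap f := by
    rw [supp, Finsupp.supported_eq_span_single, Submodule.span_le]
    rintro _ ⟨p, hp, rfl⟩
    exact h p.1 p.2 hp
  exact this hc

/-- The chains with image in `B`. -/
def chainsIn (B : Set X) : Submodule (ZMod 2) (SChain X) := supp {p | range p.2 ⊆ B}

/-- The homogeneous chains of degree `n`. -/
def deg (X : Type) [TopologicalSpace X] (n : ℕ) : Submodule (ZMod 2) (SChain X) :=
  supp {p | p.1 = n + 1}

/-- The map induced by a continuous map. -/
def push (f : C(X, Y)) : SChain X →ₗ[ZMod 2] SChain Y := lift fun _ σ => of (f.comp σ)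

@[simp] lemma push_of (f : C(X, Y)) {n : ℕ} (σ : C(Spx n, X)) : push f (of σ) = of (f.comp σ) :=
  lift_of _ σ

lemma push_push (f : C(X, Y)) (g : C(Y, Z)) (c : SChain X) :
    push g (push f c) = push (g.comp f) c := by
  have : push g ∘ₗ push f = push (g.comp f) := hom_ext fun n σ => by
    simp [ContinuousMap.comp_assoc]
  exact LinearMap.congr_fun this c

lemma push_id (c : SChain X) : push (ContinuousMap.id X) c = c := by
  have : push (ContinuousMap.id X) = LinearMap.id := hom_ext fun n σ => by simp
  exact LinearMap.congr_fun this c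

lemma chainsIn_mono {B B' : Set X} (h : B ⊆ B') : chainsIn B ≤ chainsIn B' :=
  Finsupp.supported_mono fun _ hp => Subset.trans hp h

lemma mem_chainsIn_univ (c : SChain X) : c ∈ chainsIn (univ : Set X) := by
  simp [chainsIn, supp]

lemma mem_chainsIn_inter {B B' : Set X} {c : SChain X} (h : c ∈ chainsIn B) (h' : c ∈ chainsIn B') :
    c ∈ chainsIn (B ∩ B') := fun p hp => subset_inter (h hp) (h' hp)

lemma push_mem {f : C(X, Y)} {B : Set X} {B' : Set Y} (h : MapsTo f B B') {c : SChain X}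
    (hc : c ∈ chainsIn B) : push f c ∈ chainsIn B' := by
  refine map_mem_of_supp _ (fun n σ hσ => ?_) hc
  rw [push_of]
  refine of_mem_supp ?_
  rintro _ ⟨t, rfl⟩
  exact h (hσ ⟨t, rfl⟩)

lemma push_mem_range (f : C(X, Y)) (c : SChain X) : push f c ∈ chainsIn (range f) :=
  push_mem (fun x _ => mem_range_self x) (mem_chainsIn_univ c)

lemma push_mem_deg (f : C(X, Y)) {n : ℕ} {c : SChain X} (hc : c ∈ deg X n) :
    push f c ∈ deg Y n := by
  refine map_mem_of_supp _ (fun k σ hσ => ?_) hc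
  rw [push_of]
  exact of_mem_supp hσ

/-- The singular chain of an affine chain. -/
def realize : AffChain K →ₗ[ZMod 2] SChain K := AffChain.lift fun _ v => of (affineSimplex v)

@[simp] lemma realize_of {n : ℕ} (v : Fin n → K) :
    realize (AffChain.of v) = of (affineSimplex v) := AffChain.lift_of _ v

lemma push_realize (g : C(K, K')) (hg : PreservesComb g) (c : AffChain K) :
    push g (realize c) = realize (AffChain.map g c) := by
  have : push g ∘ₗ realize = realize ∘ₗ AffChain.map g := AffChain.hom_ext fun n v => by
    simp only [LinearMap.comp_apply, realize_of, push_of, AffChain.map_of]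
    congr 1
    ext t
    exact hg n t v
  exact LinearMap.congr_fun this c

/-- The tautological affine chain on the standard simplex. -/
def taut (n : ℕ) : AffChain (Spx n) := AffChain.of spxVertex

lemma map_affineSimplex_taut [LawfulConvexCombSpace K] {n : ℕ} (v : Fin n → K) :
    AffChain.map (affineSimplex v) (taut n) = AffChain.of v := by
  rw [taut, AffChain.map_of]
  congr 1
  funext i
  exact LawfulConvexCombSpace.comb_vertex i v

lemma push_realize_taut {n : ℕ} (σ : C(Spx n, X)) : push σ (realize (taut n)) = of σ := by
  rw [taut, realize_of, push_of]
  congr 1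
  ext t
  simp [comb_spxVertex_right]

/-- The natural operator on singular chains with prescribed values on the tautological simplices. -/
def op (θ : ∀ n, AffChain (Spx n)) : SChain X →ₗ[ZMod 2] SChain X :=
  lift fun n σ => push σ (realize (θ n))

lemma op_of (θ : ∀ n, AffChain (Spx n)) {n : ℕ} (σ : C(Spx n, X)) :
    op θ (of σ) = push σ (realize (θ n)) := lift_of _ σ

lemma push_op (θ : ∀ n, AffChain (Spx n)) (f : C(X, Y)) (c : SChain X) :
    push f (op θ c) = op θ (push f c) := by
  have : push f ∘ₗ op θ = op θ ∘ₗ push f := hom_ext fun n σ => by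
    simp [op_of, push_push]
  exact LinearMap.congr_fun this c

lemma op_mem (θ : ∀ n, AffChain (Spx n)) {B : Set X} {c : SChain X} (hc : c ∈ chainsIn B) :
    op θ c ∈ chainsIn B := by
  refine map_mem_of_supp _ (fun n σ hσ => ?_) hc
  rw [op_of]
  exact chainsIn_mono hσ (push_mem_range σ _)

/-- An operator on affine chains that commutes with affine maps. -/
structure IsNatural (Θ : ∀ (K : Type) [TopologicalSpace K] [ConvexCombSpace K],
    AffChain K →ₗ[ZMod 2] AffChain K) : Prop where
  map : ∀ {K K' : Type} [TopologicalSpace K] [TopologicalSpace K'] [ConvexCombSpace K]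
    [ConvexCombSpace K'] {g : K → K'}, PreservesComb g → ∀ c,
      AffChain.map g (Θ K c) = Θ K' (AffChain.map g c)

/-- An affine simplex is the image of the tautological one under an affine map. Hence an operator
defined only by its values on tautological simplices is computed on affine chains by the affine
operator, and identities between affine operators pass to singular chains. -/
lemma IsNatural.op_realize {Θ : ∀ (K : Type) [TopologicalSpace K] [ConvexCombSpace K],
    AffChain K →ₗ[ZMod 2] AffChain K} (h : IsNatural Θ) [LawfulConvexCombSpace K]
    (c : AffChain K) : op (fun n => Θ _ (taut n)) (realize c) = realize (Θ K c) := by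
  have : op (fun n => Θ _ (taut n)) ∘ₗ realize = realize ∘ₗ Θ K := AffChain.hom_ext fun n v => by
    simp only [LinearMap.comp_apply, realize_of, op_of]
    rw [push_realize _ (preservesComb_affineSimplex v), h.map (preservesComb_affineSimplex v),
      map_affineSimplex_taut]
  exact LinearMap.congr_fun this c

lemma isNatural_bd : IsNatural fun _ _ _ => AffChain.bd :=
  ⟨fun _ c => AffChain.map_bd _ c⟩

lemma isNatural_subdiv : IsNatural fun _ _ _ => AffChain.subdiv :=
  ⟨fun hg c => AffChain.map_subdiv hg c⟩

lemma isNatural_subdivHtpy : IsNatural fun _ _ _ => AffChain.subdivHtpy :=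
  ⟨fun hg c => AffChain.map_subdivHtpy hg c⟩

/-- The boundary operator. -/
def bd : SChain X →ₗ[ZMod 2] SChain X := op fun n => AffChain.bd (taut n)

/-- The barycentric subdivision. -/
def subdiv : SChain X →ₗ[ZMod 2] SChain X := op fun n => AffChain.subdiv (taut n)

/-- The homotopy between the identity and the barycentric subdivision. -/
def subdivHtpy : SChain X →ₗ[ZMod 2] SChain X := op fun n => AffChain.subdivHtpy (taut n)

lemma bd_of {n : ℕ} (σ : C(Spx n, X)) : bd (of σ) = push σ (realize (AffChain.bd (taut n))) :=
  op_of _ σ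

lemma push_bd (f : C(X, Y)) (c : SChain X) : push f (bd c) = bd (push f c) := push_op _ f c

lemma bd_mem {B : Set X} {c : SChain X} (hc : c ∈ chainsIn B) : bd c ∈ chainsIn B := op_mem _ hc

lemma subdiv_mem {B : Set X} {c : SChain X} (hc : c ∈ chainsIn B) : subdiv c ∈ chainsIn B :=
  op_mem _ hc

lemma subdivHtpy_mem {B : Set X} {c : SChain X} (hc : c ∈ chainsIn B) :
    subdivHtpy c ∈ chainsIn B := op_mem _ hc

lemma bd_realize [LawfulConvexCombSpace K] (c : AffChain K) :
    bd (realize c) = realize (AffChain.bd c) := isNatural_bd.op_realize c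

@[simp] lemma bd_bd (c : SChain X) : bd (bd c) = 0 := by
  have : (bd ∘ₗ bd : SChain X →ₗ[ZMod 2] SChain X) = 0 := hom_ext fun n σ => by
    simp only [LinearMap.comp_apply, LinearMap.zero_apply]
    rw [bd_of, ← push_bd, bd_realize, AffChain.bd_bd, map_zero, map_zero]
  exact LinearMap.congr_fun this c

lemma add_subdiv (c : SChain X) : c + subdiv c = bd (subdivHtpy c) + subdivHtpy (bd c) := by
  have : LinearMap.id + subdiv = bd ∘ₗ subdivHtpy + subdivHtpy ∘ₗ (bd : SChain X →ₗ[ZMod 2] _) :=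
    hom_ext fun n σ => by
      simp only [LinearMap.comp_apply, LinearMap.add_apply, LinearMap.id_apply]
      rw [bd_of, subdivHtpy, ← push_op, isNatural_subdivHtpy.op_realize, op_of, ← push_bd,
        bd_realize, ← map_add, ← map_add, subdiv, op_of, AffChain.bd_subdivHtpy, add_assoc,
        ZModModule.add_self, add_zero, map_add, map_add, push_realize_taut]
  exact LinearMap.congr_fun this c

lemma bd_basis {n : ℕ} (σ : C(Spx (n + 1), X)) :
    bd (of σ) = ∑ i : Fin (n + 1), of (σ.comp (affineSimplex (spxVertex ∘ i.succAbove))) := by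
  rw [bd_of, taut, AffChain.bd, AffChain.lift_of, AffChain.bdBasis, map_sum, map_sum]
  simp

lemma bd_of_zero (σ : C(Spx 0, X)) : bd (of σ) = 0 := by
  rw [bd_of, taut, AffChain.bd_of_zero, map_zero, map_zero]

lemma bd_mem_deg {n : ℕ} {c : SChain X} (hc : c ∈ deg X (n + 1)) : bd c ∈ deg X n := by
  refine map_mem_of_supp _ (fun k σ hσ => ?_) hc
  obtain rfl : k = n + 2 := hσ
  rw [bd_basis]
  exact Submodule.sum_mem _ fun i _ => of_mem_supp rfl

/-! #### Small simplices -/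

lemma bd_subdiv (c : SChain X) : bd (subdiv c) = subdiv (bd c) := by
  have h1 := congrArg bd (add_subdiv c)
  have h2 := add_subdiv (bd c)
  simp only [map_add, bd_bd, map_zero, zero_add, add_zero] at h1 h2
  rw [← h2] at h1
  exact add_left_cancel h1

/-- The homotopies add up: if `T` serves `k` subdivisions, then `subdivHtpy + subdiv ∘ₗ T` serves
one more, because subdivision commutes with the boundary. That `T` enlarges no image is what
excision needs. -/
lemma iterate_subdiv (k : ℕ) : ∃ T : SChain X →ₗ[ZMod 2] SChain X,
    (∀ B : Set X, ∀ c ∈ chainsIn B, T c ∈ chainsIn B) ∧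
    ∀ c, c + (subdiv^[k]) c = bd (T c) + T (bd c) := by
  induction k with
  | zero => exact ⟨0, fun B c _ => Submodule.zero_mem _, fun c => by simp [ZModModule.add_self]⟩
  | succ k ih =>
    obtain ⟨T, hT, h⟩ := ih
    refine ⟨subdivHtpy + subdiv ∘ₗ T, fun B c hc => ?_, fun c => ?_⟩
    · rw [LinearMap.add_apply]
      exact (chainsIn B).add_mem (subdivHtpy_mem hc) (subdiv_mem (hT B c hc))
    calc c + subdiv^[k + 1] c = (c + subdiv c) + subdiv (c + subdiv^[k] c) := by
          rw [Function.iterate_succ_apply', map_add, add_assoc, ← add_assoc (subdiv c),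
            ZModModule.add_self, zero_add]
      _ = _ := by
          rw [add_subdiv, h, map_add, ← bd_subdiv, add_add_add_comm, ← map_add bd]
          rfl

end SChain

end SingularChains

/-! ### Subdivision into small simplices, excision and homotopy invariance -/

section SmallSimplices

namespace AffChain

open ConvexCombSpace

/-- The affine chains with all tuples satisfying `p`. -/
def tuples {K : Type} (p : ∀ n, (Fin n → K) → Prop) : Submodule (ZMod 2) (AffChain K) :=
  Finsupp.supported (ZMod 2) (ZMod 2) {q | p q.1 q.2}

lemma of_mem_tuples {K : Type} {p : ∀ n, (Fin n → K) → Prop} {n : ℕ} {v : Fin n → K} (h : p n v) :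
    of v ∈ tuples p :=
  Finsupp.single_mem_supported _ _ (by exact h)

lemma map_mem_of_tuples {K : Type} {A : Type} [AddCommGroup A] [Module (ZMod 2) A]
    {p : ∀ n, (Fin n → K) → Prop} {B : Submodule (ZMod 2) A} (f : AffChain K →ₗ[ZMod 2] A)
    (h : ∀ (n : ℕ) (v : Fin n → K), p n v → f (of v) ∈ B) {c : AffChain K}
    (hc : c ∈ tuples p) : f c ∈ B := by
  have : tuples p ≤ B.comap f := by
    rw [tuples, Finsupp.supported_eq_span_single, Submodule.span_le]
    rintro _ ⟨q, hq, rfl⟩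
    exact h q.1 q.2 hq
  exact this hc

variable {N : ℕ}

lemma dist_comb_le {n : ℕ} (t : Spx n) (v : Fin n → Spx N) (x : Spx N) {r : ℝ}
    (h : ∀ i, dist (v i) x ≤ r) : dist (comb t v) x ≤ r := by
  have := (convex_closedBall (x : Fin N → ℝ) r).sum_mem (t := Finset.univ) (w := t)
    (z := fun i => (v i : Fin N → ℝ)) (fun i _ => t.2.1 i) t.2.2 fun i _ => h i
  exact this

/-- The difference between a vertex and the barycenter is the average of its differences with all `n
+ 1` vertices, one of which is zero; this leaves `n` terms out of `n + 1`. -/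
lemma dist_bary_le {n : ℕ} (v : Fin (n + 1) → Spx N) {r : ℝ} (h : ∀ i j, dist (v i) (v j) ≤ r)
    (i : Fin (n + 1)) : dist (v i) (bary v) ≤ n / (n + 1) * r := by
  have hn : (0 : ℝ) < n + 1 := by positivity
  have hb : (bary v : Spx N).1 = ∑ j, ((n : ℝ) + 1)⁻¹ • (v j).1 := by
    refine (coe_comb _ _).trans (Finset.sum_congr rfl fun j _ => ?_)
    have e : (stdSimplex.barycenter : Spx (n + 1)) j = ((n : ℝ) + 1)⁻¹ := by
      refine (stdSimplex.barycenter_apply j).trans ?_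
      simp
    rw [e]
  have hd : (v i).1 - (bary v : Spx N).1 = ∑ j, ((n : ℝ) + 1)⁻¹ • ((v i).1 - (v j).1) := by
    simp only [smul_sub, Finset.sum_sub_distrib]
    rw [hb, Finset.sum_const, Finset.card_univ, Fintype.card_fin, ← Nat.cast_smul_eq_nsmul ℝ,
      smul_smul]
    push_cast
    rw [mul_inv_cancel₀ hn.ne', one_smul]
  rw [Subtype.dist_eq, dist_eq_norm, hd, Fin.sum_univ_succAbove _ i]
  simp only [sub_self, smul_zero, zero_add]
  refine (norm_sum_le _ _).trans ((Finset.sum_le_card_nsmul _ _ (((n : ℝ) + 1)⁻¹ * r)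
    fun j _ => ?_).trans_eq ?_)
  · rw [norm_smul, Real.norm_of_nonneg (by positivity), ← dist_eq_norm]
    exact mul_le_mul_of_nonneg_left (h _ _) (by positivity)
  · simp only [Finset.card_univ, Fintype.card_fin, nsmul_eq_mul]
    field_simp

/-- The tuple `w` has at most `n` points and diameter at most `r`. -/
def Fine (n : ℕ) (r : ℝ) : ∀ k, (Fin k → Spx N) → Prop :=
  fun k w => k ≤ n ∧ ∀ i j, dist (w i) (w j) ≤ r

/-- The new vertices are the barycenter and vertices of subdivided faces. The induction also records
that all of them are convex combinations of the original points, since this bounds their distance to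
the new barycenter. A common factor `ρ` for all dimensions lets the estimate be iterated. -/
lemma subdiv_of_mem {M : ℕ} {ρ : ℝ} (hρ : ∀ n < M, (n : ℝ) / (n + 1) ≤ ρ) {r : ℝ} (hr : 0 ≤ r) :
    ∀ n ≤ M, ∀ v : Fin n → Spx N, (∀ i j, dist (v i) (v j) ≤ r) →
      subdiv (of v) ∈ tuples fun k w => Fine n (ρ * r) k w ∧ ∀ i, ∃ t : Spx n, w i = comb t v := by
  intro n
  induction n with
  | zero =>
    intro _ v _
    rw [subdiv_of_zero]
    exact of_mem_tuples ⟨⟨le_rfl, fun i => i.elim0⟩, fun i => i.elim0⟩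
  | succ n ih =>
    intro hn v hv
    rw [subdiv_of_succ, bd, lift_of, bdBasis, map_sum, map_sum]
    refine Submodule.sum_mem _ fun i _ => ?_
    refine map_mem_of_tuples _ (fun k w hw => ?_) (ih (by omega) (v ∘ i.succAbove)
      fun j k => hv _ _)
    rw [cone_of]
    have hcomb : ∀ j, ∃ t : Spx (n + 1), w j = comb t v := fun j => by
      obtain ⟨t, ht⟩ := hw.2 j
      refine ⟨comb t fun l => spxVertex (i.succAbove l), ?_⟩
      rw [LawfulConvexCombSpace.comb_comb, ht]
      simp only [LawfulConvexCombSpace.comb_vertex]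
      rfl
    have hdist : ∀ j, dist (w j) (bary v) ≤ ρ * r := fun j => by
      obtain ⟨t, ht⟩ := hcomb j
      rw [ht]
      exact dist_comb_le _ _ _ fun l => (dist_bary_le v hv l).trans
        (mul_le_mul_of_nonneg_right (hρ n (by omega)) hr)
    have hρr : 0 ≤ ρ * r := mul_nonneg (le_trans (by positivity) (hρ n (by omega))) hr
    refine of_mem_tuples ⟨⟨by have := hw.1.1; omega, fun j l => ?_⟩, fun j => ?_⟩
    · refine Fin.cases ?_ (fun j => ?_) j <;> refine Fin.cases ?_ (fun l => ?_) l
      · simpa using hρr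
      · simpa [dist_comm] using hdist l
      · simpa using hdist j
      · simpa using hw.1.2 j l
    · refine Fin.cases ?_ (fun j => ?_) j
      · exact ⟨_, rfl⟩
      · simpa using hcomb j

lemma iterate_subdiv_mem {n : ℕ} {ρ : ℝ} (hρ : ∀ k < n, (k : ℝ) / (k + 1) ≤ ρ) (hρ0 : 0 ≤ ρ)
    (v : Fin n → Spx N) {r : ℝ} (hr : 0 ≤ r) (hv : ∀ i j, dist (v i) (v j) ≤ r) (m : ℕ) :
    (subdiv^[m]) (of v) ∈ tuples (Fine n (ρ ^ m * r)) := by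
  induction m with
  | zero => exact of_mem_tuples ⟨le_rfl, by simpa using hv⟩
  | succ m ih =>
    rw [Function.iterate_succ_apply']
    refine map_mem_of_tuples _ (fun k w hw => ?_) ih
    refine Finsupp.supported_mono ?_ (subdiv_of_mem hρ (by positivity) k hw.1 w hw.2)
    rintro ⟨l, u⟩ ⟨⟨h1, h2⟩, -⟩
    exact ⟨h1.trans hw.1, by simpa [pow_succ', mul_assoc] using h2⟩

/-- Each subdivision contracts diameters by at least the factor `n / (n + 1) < 1`, starting from
diameter at most one. -/
lemma exists_iterate_subdiv_taut_mem (n : ℕ) {ε : ℝ} (hε : 0 < ε) :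
    ∃ m, (subdiv^[m]) (of (spxVertex : Fin n → Spx n)) ∈ tuples (Fine n ε) := by
  have hn : (0 : ℝ) < n + 1 := by positivity
  have hlt : (n : ℝ) / (n + 1) < 1 := (div_lt_one hn).2 (by linarith)
  obtain ⟨m, hm⟩ := exists_pow_lt_of_lt_one hε hlt
  refine ⟨m, ?_⟩
  have := iterate_subdiv_mem (n := n) (ρ := (n : ℝ) / (n + 1)) (fun k hk => ?_) (by positivity)
    (spxVertex : Fin n → Spx n) zero_le_one (fun i j => ?_) m
  · refine Finsupp.supported_mono ?_ this
    rintro ⟨l, u⟩ ⟨h1, h2⟩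
    exact ⟨h1, fun i j => (h2 i j).trans (by linarith)⟩
  · rw [div_le_div_iff₀ (by positivity) hn]
    have : (k : ℝ) ≤ n := by exact_mod_cast hk.le
    nlinarith
  · exact (Metric.dist_le_diam_of_mem (bounded_stdSimplex _) (spxVertex i).2
      (spxVertex j).2).trans diam_stdSimplex_le

end AffChain

namespace SChain

variable {X Y : Type} [TopologicalSpace X] [TopologicalSpace Y]

lemma iterate_subdiv_of {n : ℕ} (σ : C(Spx n, X)) (m : ℕ) :
    (subdiv^[m]) (of σ) = push σ (realize (AffChain.subdiv^[m] (taut n))) := by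
  induction m with
  | zero => exact (push_realize_taut σ).symm
  | succ m ih =>
    rw [Function.iterate_succ_apply', Function.iterate_succ_apply', ih,
      ← isNatural_subdiv.op_realize, push_op]
    rfl

/-- For one simplex this is the Lebesgue number of the preimages of the two open sets. A chain has
finitely many simplices, and further subdivision does no harm, so one exponent serves them all. -/
lemma exists_iterate_subdiv_mem {U V : Set X} (hU : IsOpen U) (hV : IsOpen V) {c : SChain X}
    (hc : c ∈ chainsIn (U ∪ V)) : ∃ m, (subdiv^[m]) c ∈ chainsIn U ⊔ chainsIn V := by
  have hsub : ∀ c ∈ chainsIn U ⊔ chainsIn V, subdiv c ∈ chainsIn U ⊔ chainsIn V := by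
    intro c hc
    obtain ⟨u, hu, v, hv, rfl⟩ := Submodule.mem_sup.1 hc
    rw [map_add]
    exact Submodule.add_mem_sup (subdiv_mem hu) (subdiv_mem hv)
  have hmono : ∀ c m m', m ≤ m' → (subdiv^[m]) c ∈ chainsIn U ⊔ chainsIn V →
      (subdiv^[m']) c ∈ chainsIn U ⊔ chainsIn V := by
    intro c m m' h hm
    induction m', h using Nat.le_induction with
    | base => exact hm
    | succ k _ ih =>
      rw [Function.iterate_succ_apply']
      exact hsub _ ih
  rw [chainsIn, supp, Finsupp.supported_eq_span_single] at hc
  induction hc using Submodule.span_induction with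
  | zero =>
    exact ⟨0, Submodule.zero_mem _⟩
  | add x y _ _ hx hy =>
    obtain ⟨m, hm⟩ := hx
    obtain ⟨m', hm'⟩ := hy
    refine ⟨max m m', ?_⟩
    rw [← Module.End.pow_apply, map_add, Module.End.pow_apply, Module.End.pow_apply]
    exact Submodule.add_mem _ (hmono _ _ _ (le_max_left _ _) hm)
      (hmono _ _ _ (le_max_right _ _) hm')
  | smul a x _ hx =>
    obtain ⟨m, hm⟩ := hx
    refine ⟨m, ?_⟩
    rw [← Module.End.pow_apply, map_smul, Module.End.pow_apply]
    exact Submodule.smul_mem _ _ hm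
  | mem x hx =>
    obtain ⟨⟨n, σ⟩, hσ, rfl⟩ := hx
    replace hσ : range σ ⊆ U ∪ V := hσ
    obtain ⟨δ, hδ, hL⟩ := lebesgue_number_lemma_of_metric (s := (univ : Set (Spx n)))
      (c := fun b : Bool => bif b then σ ⁻¹' U else σ ⁻¹' V) isCompact_univ
      (by rintro (_ | _); exacts [hV.preimage σ.continuous, hU.preimage σ.continuous])
      (fun x _ => by
        rcases hσ ⟨x, rfl⟩ with h | h
        · exact mem_iUnion.2 ⟨true, h⟩
        · exact mem_iUnion.2 ⟨false, h⟩)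
    obtain ⟨m, hm⟩ := AffChain.exists_iterate_subdiv_taut_mem n (half_pos hδ)
    refine ⟨m, ?_⟩
    change (subdiv^[m]) (of σ) ∈ _
    rw [iterate_subdiv_of]
    refine AffChain.map_mem_of_tuples (push σ ∘ₗ realize) (fun k w hw => ?_) hm
    rw [LinearMap.comp_apply, realize_of, push_of]
    rcases k with _ | k
    -- The empty simplex has empty image, so it may be assigned to either set.
    · refine Submodule.mem_sup_left (of_mem_supp ?_)
      rintro _ ⟨t, rfl⟩
      exact absurd t.2.2 (by simp)
    · have hball : ∀ t, affineSimplex w t ∈ Metric.ball (w 0) δ := fun t =>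
        (AffChain.dist_comb_le t w (w 0) fun i => hw.2 i 0).trans_lt (half_lt_self hδ)
      obtain ⟨_ | _, hb⟩ := hL (w 0) trivial
      · refine Submodule.mem_sup_right (of_mem_supp ?_)
        rintro _ ⟨t, rfl⟩
        exact hb (hball t)
      · refine Submodule.mem_sup_left (of_mem_supp ?_)
        rintro _ ⟨t, rfl⟩
        exact hb (hball t)

/-- The excision theorem: a chain in `U ∪ V` whose boundary splits is, up to a boundary, a sum of
chains in `U` and in `V`. -/
theorem exists_split {U V : Set X} (hU : IsOpen U) (hV : IsOpen V) {c : SChain X}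
    (hc : c ∈ chainsIn (U ∪ V)) (hd : bd c ∈ chainsIn U ⊔ chainsIn V) :
    ∃ w ∈ chainsIn (U ∪ V), c + bd w ∈ chainsIn U ⊔ chainsIn V := by
  obtain ⟨m, hm⟩ := exists_iterate_subdiv_mem hU hV hc
  obtain ⟨T, hT, h⟩ := iterate_subdiv (X := X) m
  -- The homotopy formula turns `c + bd (T c)` into the subdivided chain plus `T (bd c)`. The first
  -- splits because its simplices are small, the second because `bd c` splits and `T` preserves
  -- supports.
  refine ⟨T c, hT _ _ hc, ?_⟩
  have hTd : T (bd c) ∈ chainsIn U ⊔ chainsIn V := by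
    obtain ⟨u, hu, v, hv, e⟩ := Submodule.mem_sup.1 hd
    rw [← e, map_add]
    exact Submodule.add_mem_sup (hT _ _ hu) (hT _ _ hv)
  have e : c + bd (T c) = T (bd c) + (subdiv^[m]) c := by
    have h1 := h c
    have h2 := ZModModule.add_self ((subdiv^[m]) c)
    have h3 := ZModModule.add_self (bd (T c))
    calc c + bd (T c) = (c + (subdiv^[m]) c) + bd (T c) + (subdiv^[m]) c
          - ((subdiv^[m]) c + (subdiv^[m]) c) := by abel
      _ = (bd (T c) + bd (T c)) + T (bd c) + (subdiv^[m]) c := by rw [h1, h2]; abel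
      _ = _ := by rw [h3, zero_add]
  rw [e]
  exact Submodule.add_mem _ hTd hm

/-! #### Homogeneous components -/

/-- The homogeneous component of degree `n`. -/
def comp (n : ℕ) : SChain X →ₗ[ZMod 2] SChain X :=
  lift fun k σ => if k = n + 1 then of σ else 0

lemma comp_mem_deg (n : ℕ) (c : SChain X) : comp n c ∈ deg X n := by
  refine map_mem_of_supp _ (fun k σ _ => ?_) (mem_chainsIn_univ c)
  rw [comp, lift_of]
  split_ifs with h
  · exact of_mem_supp h
  · exact Submodule.zero_mem _

lemma comp_mem (n : ℕ) {B : Set X} {c : SChain X} (hc : c ∈ chainsIn B) :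
    comp n c ∈ chainsIn B := by
  refine map_mem_of_supp _ (fun k σ hσ => ?_) hc
  rw [comp, lift_of]
  split_ifs with h
  · exact of_mem_supp hσ
  · exact Submodule.zero_mem _

lemma comp_eq {n : ℕ} {c : SChain X} (hc : c ∈ deg X n) : comp n c = c := by
  have : deg X n ≤ LinearMap.ker (comp n - LinearMap.id : SChain X →ₗ[ZMod 2] SChain X) :=
    supp_induction fun k σ hσ => by
      obtain rfl : k = n + 1 := hσ
      simp [comp]
  exact sub_eq_zero.1 (this hc)

lemma comp_bd (n : ℕ) (c : SChain X) : comp n (bd c) = bd (comp (n + 1) c) := by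
  have : comp n ∘ₗ bd = bd ∘ₗ (comp (n + 1) : SChain X →ₗ[ZMod 2] SChain X) := hom_ext fun k σ => by
    simp only [LinearMap.comp_apply]
    rcases k with _ | k
    · simp [comp, bd_of_zero]
    · rw [bd_basis, map_sum]
      by_cases h : k = n + 1
      · simp [comp, h, bd_basis]
      · simp [comp, h]
  exact LinearMap.congr_fun this c

/-! #### Homotopy invariance -/

/-- The chain homotopy induced by a homotopy. -/
def htpy (F : C(Y × unitInterval, X)) : SChain Y →ₗ[ZMod 2] SChain X :=
  lift fun n σ => push (F.comp (σ.prodMap (ContinuousMap.id _)))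
    (realize (AffChain.prism (taut n)))

/-- The map at time `t` of a homotopy. -/
def slice (F : C(Y × unitInterval, X)) (t : unitInterval) : C(Y, X) :=
  ⟨fun y => F (y, t), by fun_prop⟩

/-- The affine prism formula on the standard simplex, transported by `F ∘ (σ × id)`. The term on the
faces is handled by the naturality of the prism under affine face inclusions. -/
lemma bd_htpy (F : C(Y × unitInterval, X)) (c : SChain Y) :
    bd (htpy F c) = push (slice F 0) c + push (slice F 1) c + htpy F (bd c) := by
  have : bd ∘ₗ htpy F = push (slice F 0) + push (slice F 1) + htpy F ∘ₗ bd := hom_ext fun n σ => by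
    have hs : ∀ t : unitInterval, push (F.comp (σ.prodMap (ContinuousMap.id _)))
        (realize (AffChain.map (fun x => (x, t)) (taut n))) = push (slice F t) (of σ) := fun t => by
      have hg : PreservesComb (fun x : Spx n => (x, t)) := fun k s v => by
        refine Prod.ext rfl (Subtype.ext ?_)
        change (t : ℝ) = ((ConvexCombSpace.comb s fun _ => t : unitInterval) : ℝ)
        rw [coe_comb, ← Finset.sum_smul]
        have := s.2.2
        simp only [stdSimplex.sum_eq_one, one_smul]
      have e := push_realize (⟨fun x : Spx n => (x, t), by fun_prop⟩ :
        C(Spx n, Spx n × unitInterval)) hg (taut n)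
      simp only [ContinuousMap.coe_mk] at e
      rw [← e, push_push, ← push_realize_taut σ, push_push]
      rfl
    have hp : htpy F (bd (of σ)) = push (F.comp (σ.prodMap (ContinuousMap.id _)))
        (realize (AffChain.prism (AffChain.bd (taut n)))) := by
      have : ∀ c : AffChain (Spx n), htpy F (push σ (realize c))
          = push (F.comp (σ.prodMap (ContinuousMap.id _))) (realize (AffChain.prism c)) := by
        intro c
        have : htpy F ∘ₗ push σ ∘ₗ realize
            = push (F.comp (σ.prodMap (ContinuousMap.id _))) ∘ₗ realize ∘ₗ AffChain.prism :=
          AffChain.hom_ext fun k v => by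
            simp only [LinearMap.comp_apply, realize_of, push_of, htpy, lift_of]
            have e := push_realize ((affineSimplex v).prodMap (ContinuousMap.id unitInterval))
              (preservesComb_affineSimplex v).prodMap_id (AffChain.prism (taut k))
            rw [← map_affineSimplex_taut v, ← AffChain.map_prism]
            refine Eq.trans ?_ (congrArg _ e)
            rw [push_push]
            rfl
        exact LinearMap.congr_fun this c
      rw [bd_of, this]
    simp only [LinearMap.comp_apply, LinearMap.add_apply]
    rw [hp, ← hs 0, ← hs 1, htpy, lift_of, ← push_bd, bd_realize, AffChain.bd_prism]
    simp only [map_add]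
  exact LinearMap.congr_fun this c

lemma htpy_mem (F : C(Y × unitInterval, X)) {B : Set Y} {B' : Set X}
    (h : ∀ y ∈ B, ∀ t, F (y, t) ∈ B') {c : SChain Y} (hc : c ∈ chainsIn B) :
    htpy F c ∈ chainsIn B' := by
  refine map_mem_of_supp _ (fun n σ hσ => ?_) hc
  rw [htpy, lift_of]
  refine chainsIn_mono ?_ (push_mem_range _ _)
  rintro _ ⟨⟨s, t⟩, rfl⟩
  exact h _ (hσ ⟨s, rfl⟩) t

end SChain

end SmallSimplices

/-! ### Relative cycles, Mayer–Vietoris arguments and excision to open subsets -/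

section LocalHomology

namespace SChain

variable {X Y : Type} [TopologicalSpace X] [TopologicalSpace Y]

/-! #### Supports of pushed chains -/

lemma push_eq_mapDomain (f : C(X, Y)) (c : SChain X) :
    push f c = Finsupp.mapDomain (fun p : Σ n, C(Spx n, X) => ⟨p.1, f.comp p.2⟩) c := by
  have : push f = Finsupp.lmapDomain (ZMod 2) (ZMod 2)
      (fun p : Σ n, C(Spx n, X) => (⟨p.1, f.comp p.2⟩ : Σ n, C(Spx n, Y))) := hom_ext fun n σ => by
    rw [push_of, Finsupp.lmapDomain_apply, of, of, Finsupp.mapDomain_single]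
  exact LinearMap.congr_fun this c

lemma injective_comp_left {f : C(X, Y)} (hf : Function.Injective f) :
    Function.Injective
      (fun p : Σ n, C(Spx n, X) => (⟨p.1, f.comp p.2⟩ : Σ n, C(Spx n, Y))) := by
  rintro ⟨n, σ⟩ ⟨k, τ⟩ h
  obtain ⟨rfl, h⟩ := Sigma.mk.inj_iff.1 h
  congr 1
  ext t
  exact hf (DFunLike.congr_fun (eq_of_heq h) t)

/-- An injective map sends distinct simplices to distinct simplices, so no cancellation occurs and
supports can be read back. -/
lemma push_mem_supp_iff {f : C(X, Y)} (hf : Function.Injective f) {s : Set (Σ n, C(Spx n, Y))}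
    {c : SChain X} : push f c ∈ supp s ↔
      c ∈ supp ((fun p : Σ n, C(Spx n, X) => (⟨p.1, f.comp p.2⟩ : Σ n, C(Spx n, Y))) ⁻¹' s) := by
  classical
  rw [push_eq_mapDomain, supp, supp, Finsupp.mem_supported, Finsupp.mem_supported,
    Finsupp.mapDomain_support_of_injective (injective_comp_left hf), Finset.coe_image,
    image_subset_iff]

lemma push_mem_iff {f : C(X, Y)} (hf : Function.Injective f) {B : Set Y} {c : SChain X} :
    push f c ∈ chainsIn B ↔ c ∈ chainsIn (f ⁻¹' B) := by
  rw [chainsIn, push_mem_supp_iff hf, chainsIn]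
  have : (fun p : Σ n, C(Spx n, X) => (⟨p.1, f.comp p.2⟩ : Σ n, C(Spx n, Y))) ⁻¹'
      {p | range p.2 ⊆ B} = {p | range p.2 ⊆ f ⁻¹' B} := by
    ext p
    simp [range_subset_iff]
  rw [this]

lemma push_mem_deg_iff {f : C(X, Y)} (hf : Function.Injective f) {n : ℕ} {c : SChain X} :
    push f c ∈ deg Y n ↔ c ∈ deg X n := push_mem_supp_iff hf

lemma exists_push_eq {f : C(X, Y)} (hf : Topology.IsEmbedding f) {c : SChain Y}
    (hc : c ∈ chainsIn (range f)) : ∃ c', push f c' = c := by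
  have : chainsIn (range f) ≤ LinearMap.range (push f) := supp_induction fun n σ hσ => by
    choose g hg using fun t => hσ (mem_range_self t)
    have hg' : Continuous g := by
      rw [hf.continuous_iff]
      convert σ.continuous using 1
      exact funext hg
    refine ⟨of ⟨g, hg'⟩, ?_⟩
    rw [push_of]
    congr 1
    ext t
    exact hg t
  exact this hc

lemma of_mem_chainsIn_iff {B : Set X} {n : ℕ} {σ : C(Spx n, X)} :
    of σ ∈ chainsIn B ↔ range σ ⊆ B := by
  simp [chainsIn, supp, of, Finsupp.mem_supported, Finsupp.support_single]

/-! #### Relative cycles and null chains -/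

/-- The chains that are homologous to zero relative to the complement of `A`. -/
def nulls (A : Set X) : Submodule (ZMod 2) (SChain X) :=
  LinearMap.range (bd : SChain X →ₗ[ZMod 2] SChain X) ⊔ chainsIn Aᶜ

/-- The relative cycles of degree `n` of `(X, X ∖ A)`. -/
def relCycles (n : ℕ) (A : Set X) : Submodule (ZMod 2) (SChain X) :=
  deg X n ⊓ (chainsIn Aᶜ).comap bd

lemma bd_mem_nulls (A : Set X) (w : SChain X) : bd w ∈ nulls A :=
  Submodule.mem_sup_left ⟨w, rfl⟩

lemma chainsIn_le_nulls (A : Set X) : chainsIn Aᶜ ≤ nulls A := le_sup_right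

lemma nulls_anti {A B : Set X} (h : A ⊆ B) : nulls B ≤ nulls A :=
  sup_le_sup_left (chainsIn_mono (compl_subset_compl.2 h)) _

lemma relCycles_anti {A B : Set X} (h : A ⊆ B) (n : ℕ) : relCycles n B ≤ relCycles n A :=
  inf_le_inf_left _ (Submodule.comap_mono (chainsIn_mono (compl_subset_compl.2 h)))

lemma mem_nulls_iff {A : Set X} {z : SChain X} : z ∈ nulls A ↔ ∃ w, z + bd w ∈ chainsIn Aᶜ := by
  constructor
  · rintro h
    obtain ⟨_, ⟨w, rfl⟩, u, hu, rfl⟩ := Submodule.mem_sup.1 h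
    refine ⟨w, ?_⟩
    rwa [add_right_comm, ZModModule.add_self, zero_add]
  · rintro ⟨w, hw⟩
    have := Submodule.add_mem _ (chainsIn_le_nulls A hw) (bd_mem_nulls A w)
    rwa [add_assoc, ZModModule.add_self, add_zero] at this

/-- The bounding chain in `nulls` may be inhomogeneous; its component of degree `n + 1` already does
the work. -/
lemma exists_deg_of_mem_nulls {A : Set X} {n : ℕ} {z : SChain X} (hz : z ∈ deg X n)
    (h : z ∈ nulls A) : ∃ w ∈ deg X (n + 1), z + bd w ∈ chainsIn Aᶜ := by
  obtain ⟨w, hw⟩ := mem_nulls_iff.1 h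
  refine ⟨comp (n + 1) w, comp_mem_deg _ _, ?_⟩
  have := comp_mem n hw
  rwa [map_add, comp_eq hz, comp_bd] at this

lemma add_mem_iff_left {B : Submodule (ZMod 2) (SChain X)} {x y : SChain X} (h : x + y ∈ B) :
    x ∈ B ↔ y ∈ B :=
  ⟨fun hx => (Submodule.add_mem_iff_right _ hx).1 h, fun hy => (Submodule.add_mem_iff_left _ hy).1 h⟩

lemma exists_split_add {U V : Set X} (hU : IsOpen U) (hV : IsOpen V) {c : SChain X}
    (hc : c ∈ chainsIn (U ∪ V)) (hd : bd c ∈ chainsIn U ⊔ chainsIn V) :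
    ∃ w ∈ chainsIn (U ∪ V), ∃ u ∈ chainsIn U, ∃ v ∈ chainsIn V, c + bd w = u + v := by
  obtain ⟨w, hw, h⟩ := exists_split hU hV hc hd
  obtain ⟨u, hu, v, hv, e⟩ := Submodule.mem_sup.1 h
  exact ⟨w, hw, u, hu, v, hv, e.symm⟩

lemma eq_add_of_add_eq {x y u v : SChain X} (h : x + y = u + v) : x + u = y + v := by
  have h1 := ZModModule.add_self y
  have h2 := ZModModule.add_self u
  calc x + u = (x + y) + (u - y) := by abel
    _ = (u + u) + v - y := by rw [h]; abel
    _ = v - y + (y + y) := by rw [h1, h2]; abel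
    _ = y + v := by abel

/-- The Mayer–Vietoris argument for vanishing. -/
lemma mem_nulls_union {A B : Set X} (hA : IsClosed A) (hB : IsClosed B) {n : ℕ}
    (hV : ∀ z ∈ relCycles (n + 1) (A ∩ B), z ∈ nulls (A ∩ B)) {z : SChain X}
    (hz : z ∈ relCycles n (A ∪ B)) (h1 : z ∈ nulls A) (h2 : z ∈ nulls B) : z ∈ nulls (A ∪ B) := by
  obtain ⟨w1, hw1, h1⟩ := exists_deg_of_mem_nulls hz.1 h1
  obtain ⟨w2, hw2, h2⟩ := exists_deg_of_mem_nulls hz.1 h2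
  have e0 : bd (w1 + w2) = (z + bd w1) + (z + bd w2) := by
    rw [add_add_add_comm, ZModModule.add_self, zero_add, map_add]
  have hsup : bd (w1 + w2) ∈ chainsIn Aᶜ ⊔ chainsIn Bᶜ := by
    rw [e0]; exact Submodule.add_mem_sup h1 h2
  have hle : chainsIn Aᶜ ⊔ chainsIn Bᶜ ≤ chainsIn (A ∩ B)ᶜ := by
    rw [compl_inter]
    exact sup_le (chainsIn_mono subset_union_left) (chainsIn_mono subset_union_right)
  -- The two bounding chains differ by a relative cycle one degree higher along the intersection,
  -- which is null by hypothesis.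
  obtain ⟨y, hy⟩ := mem_nulls_iff.1 (hV (w1 + w2) ⟨Submodule.add_mem _ hw1 hw2, hle hsup⟩)
  rw [compl_inter] at hy
  obtain ⟨r, -, u, hu, v, hv, e⟩ := exists_split_add hA.isOpen_compl hB.isOpen_compl hy
    (by rw [map_add, bd_bd, add_zero]; exact hsup)
  -- Here `u` misses `A` and `v` misses `B`. After these corrections the two chains have the same
  -- boundary, so one chain bounds `z` away from both sets.
  have e1 : bd (w1 + u) = bd (w2 + v) := by
    have := congrArg bd e
    simp only [map_add, bd_bd, add_zero] at this ⊢
    exact eq_add_of_add_eq this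
  refine mem_nulls_iff.2 ⟨w1 + u, ?_⟩
  rw [compl_union]
  refine mem_chainsIn_inter ?_ ?_
  · rw [map_add, ← add_assoc]
    exact Submodule.add_mem _ h1 (bd_mem hu)
  · rw [e1, map_add, ← add_assoc]
    exact Submodule.add_mem _ h2 (bd_mem hv)

/-- The Mayer–Vietoris argument for gluing. -/
lemma exists_glue {A B : Set X} (hA : IsClosed A) (hB : IsClosed B) {n : ℕ} {a b : SChain X}
    (ha : a ∈ relCycles n A) (hb : b ∈ relCycles n B) (hab : a + b ∈ nulls (A ∩ B)) :
    ∃ z ∈ relCycles n (A ∪ B), z + a ∈ nulls A ∧ z + b ∈ nulls B := by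
  obtain ⟨w, hw⟩ := mem_nulls_iff.1 hab
  rw [compl_inter] at hw
  obtain ⟨r, -, u, hu, v, hv, e⟩ := exists_split_add hA.isOpen_compl hB.isOpen_compl hw
    (by rw [map_add, bd_bd, add_zero, map_add]; exact Submodule.add_mem_sup ha.2 hb.2)
  have e0 := congrArg (comp n) e
  simp only [map_add, comp_bd, comp_eq ha.1, comp_eq hb.1] at e0
  set u' := comp n u
  set v' := comp n v
  -- The glued cycle has two expressions, `b + v'` and `a + u' + q`. The boundary `q` affects
  -- neither the boundary of the cycle nor its relative class, so the second expression is used near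
  -- `A` and the first near `B`.
  set q := bd (comp (n + 1) w) + bd (comp (n + 1) r) with hq
  have hqb : bd q = 0 := by simp [hq]
  have e1 : a + u' + q = b + v' := by
    have : (a + q) + b = u' + v' := by rw [← e0, hq]; abel
    rw [add_right_comm]
    exact eq_add_of_add_eq this
  have hqn : ∀ C : Set X, q ∈ nulls C := fun C =>
    Submodule.add_mem _ (bd_mem_nulls _ _) (bd_mem_nulls _ _)
  refine ⟨b + v', ⟨Submodule.add_mem _ hb.1 (comp_mem_deg _ _), ?_⟩, ?_, ?_⟩
  · rw [compl_union]
    refine mem_chainsIn_inter ?_ ?_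
    · rw [← e1, map_add, map_add, hqb, add_zero]
      exact Submodule.add_mem _ ha.2 (bd_mem (comp_mem n hu))
    · rw [map_add]
      exact Submodule.add_mem _ hb.2 (bd_mem (comp_mem n hv))
  · rw [← e1]
    have : a + u' + q + a = u' + q + (a + a) := by abel
    rw [this, ZModModule.add_self, add_zero]
    exact Submodule.add_mem _ (chainsIn_le_nulls _ (comp_mem n hu)) (hqn _)
  · have : b + v' + b = v' + (b + b) := by abel
    rw [this, ZModModule.add_self, add_zero]
    exact chainsIn_le_nulls _ (comp_mem n hv)

/-- The homology of `(X, X ∖ A)` vanishes above degree `m` and its classes of degree `m` are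
detected at the points of `A`. -/
structure Detects (m : ℕ) (A : Set X) : Prop where
  vanish : ∀ n, m < n → ∀ z ∈ relCycles n A, z ∈ nulls A
  detect : ∀ z ∈ relCycles m A, (∀ p ∈ A, z ∈ nulls {p}) → z ∈ nulls A

/-- There is a class of degree `m` in the homology of `(X, X ∖ A)` that does not vanish at any
point of `A`. -/
def HasFundamental (m : ℕ) (A : Set X) : Prop :=
  ∃ z ∈ relCycles m A, ∀ p ∈ A, z ∉ nulls {p}

/-- The homology of `(X, X ∖ {p})` is that of Euclidean space of dimension `m`, in degrees `≥ m`. -/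
structure IsEuclideanAt (m : ℕ) (p : X) : Prop where
  vanish : ∀ n, m < n → ∀ z ∈ relCycles n {p}, z ∈ nulls {p}
  unique : ∀ z ∈ relCycles m {p}, ∀ z' ∈ relCycles m {p}, z ∉ nulls {p} → z' ∉ nulls {p} →
    z + z' ∈ nulls {p}
  exist : HasFundamental m {p}

lemma HasFundamental.mono {m : ℕ} {A B : Set X} (h : A ⊆ B) (hB : HasFundamental m B) :
    HasFundamental m A := by
  obtain ⟨z, hz, hp⟩ := hB
  exact ⟨z, relCycles_anti h _ hz, fun p hpA => hp p (h hpA)⟩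

lemma mem_nulls_empty (z : SChain X) : z ∈ nulls (∅ : Set X) :=
  chainsIn_le_nulls _ (by rw [compl_empty]; exact mem_chainsIn_univ z)

lemma detects_empty (m : ℕ) : Detects m (∅ : Set X) :=
  ⟨fun _ _ z _ => mem_nulls_empty z, fun z _ _ => mem_nulls_empty z⟩

lemma Detects.union {m : ℕ} {A B : Set X} (hA : IsClosed A) (hB : IsClosed B) (dA : Detects m A)
    (dB : Detects m B) (dAB : Detects m (A ∩ B)) : Detects m (A ∪ B) where
  vanish n hn z hz := mem_nulls_union hA hB (dAB.vanish _ (by omega)) hz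
    (dA.vanish n hn z (relCycles_anti subset_union_left _ hz))
    (dB.vanish n hn z (relCycles_anti subset_union_right _ hz))
  detect z hz hp := mem_nulls_union hA hB (dAB.vanish _ (by omega)) hz
    (dA.detect z (relCycles_anti subset_union_left _ hz) fun p hpA => hp p (Or.inl hpA))
    (dB.detect z (relCycles_anti subset_union_right _ hz) fun p hpB => hp p (Or.inr hpB))

/-- At each point of the intersection both classes are the unique nonzero local class, so their sum
vanishes pointwise. Detection by points upgrades this to agreement along the whole intersection,
which is the condition for gluing. -/
lemma HasFundamental.union {m : ℕ} {A B : Set X} (hA : IsClosed A) (hB : IsClosed B)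
    (fA : HasFundamental m A) (fB : HasFundamental m B) (dAB : Detects m (A ∩ B))
    (hloc : ∀ p : X, IsEuclideanAt m p) : HasFundamental m (A ∪ B) := by
  obtain ⟨a, ha, ha'⟩ := fA
  obtain ⟨b, hb, hb'⟩ := fB
  have hab : a + b ∈ nulls (A ∩ B) := dAB.detect _
    (Submodule.add_mem _ (relCycles_anti inter_subset_left _ ha)
      (relCycles_anti inter_subset_right _ hb)) fun p hp => (hloc p).unique a
        (relCycles_anti (singleton_subset_iff.2 hp.1) _ ha) b
        (relCycles_anti (singleton_subset_iff.2 hp.2) _ hb) (ha' p hp.1) (hb' p hp.2)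
  obtain ⟨z, hz, h1, h2⟩ := exists_glue hA hB ha hb hab
  refine ⟨z, hz, ?_⟩
  rintro p (hp | hp) h
  · exact ha' p hp ((add_mem_iff_left (nulls_anti (singleton_subset_iff.2 hp) h1)).1 h)
  · exact hb' p hp ((add_mem_iff_left (nulls_anti (singleton_subset_iff.2 hp) h2)).1 h)

/-- The union of a list of sets. -/
def listUnion (l : List (Set X)) : Set X := l.foldr (· ∪ ·) ∅

lemma mem_listUnion {l : List (Set X)} {x : X} : x ∈ listUnion l ↔ ∃ A ∈ l, x ∈ A := by
  induction l with
  | nil => simp [listUnion]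
  | cons A l ih =>
    change x ∈ A ∪ listUnion l ↔ _
    simp [ih]

lemma isClosed_listUnion {l : List (Set X)} (h : ∀ A ∈ l, IsClosed A) : IsClosed (listUnion l) := by
  induction l with
  | nil => exact isClosed_empty
  | cons A l ih =>
    exact (h A (by simp)).union (ih fun B hB => h B (by simp [hB]))

lemma inter_listUnion (A : Set X) (l : List (Set X)) :
    A ∩ listUnion l = listUnion (l.map (A ∩ ·)) := by
  ext x
  simp only [mem_inter_iff, mem_listUnion, List.mem_map]
  constructor
  · rintro ⟨h, B, hB, hx⟩
    exact ⟨_, ⟨B, hB, rfl⟩, h, hx⟩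
  · rintro ⟨_, ⟨B, hB, rfl⟩, h, hx⟩
    exact ⟨h, B, hB, hx⟩

/-- The induction runs on the length of the list: after one set `A` is split off, the intersection
of `A` with the remaining union is the union of a different list, of the same length as the tail. -/
lemma detects_listUnion {m : ℕ} {𝒦 : Set (Set X)} (hc : ∀ A ∈ 𝒦, IsClosed A)
    (hi : ∀ A ∈ 𝒦, ∀ B ∈ 𝒦, A ∩ B ∈ 𝒦) (hd : ∀ A ∈ 𝒦, Detects m A) :
    ∀ (k : ℕ) (l : List (Set X)), l.length = k → (∀ A ∈ l, A ∈ 𝒦) → Detects m (listUnion l) := by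
  intro k
  induction k with
  | zero =>
    intro l hl _
    rw [List.length_eq_zero_iff.1 hl]
    exact detects_empty m
  | succ k ih =>
    rintro (_ | ⟨A, l⟩) hl h
    · simp at hl
    · have hA : A ∈ 𝒦 := h A (by simp)
      have hl' : ∀ B ∈ l, B ∈ 𝒦 := fun B hB => h B (by simp [hB])
      have hlen : l.length = k := by simpa using hl
      refine Detects.union (hc A hA) (isClosed_listUnion fun B hB => hc B (hl' B hB)) (hd A hA)
        (ih l hlen hl') ?_
      change Detects m (A ∩ listUnion l)
      rw [inter_listUnion]
      refine ih _ (by simpa using hlen) fun B hB => ?_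
      obtain ⟨B, hB', rfl⟩ := List.mem_map.1 hB
      exact hi A hA B (hl' B hB')

lemma hasFundamental_listUnion {m : ℕ} {𝒦 : Set (Set X)} (hc : ∀ A ∈ 𝒦, IsClosed A)
    (hi : ∀ A ∈ 𝒦, ∀ B ∈ 𝒦, A ∩ B ∈ 𝒦) (hd : ∀ A ∈ 𝒦, Detects m A)
    (hf : ∀ A ∈ 𝒦, HasFundamental m A) (hloc : ∀ p : X, IsEuclideanAt m p) :
    ∀ l : List (Set X), (∀ A ∈ l, A ∈ 𝒦) → HasFundamental m (listUnion l) := by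
  intro l
  induction l with
  | nil => exact fun _ => ⟨0, Submodule.zero_mem _, fun p hp => hp.elim⟩
  | cons A l ih =>
    intro h
    have hA : A ∈ 𝒦 := h A (by simp)
    have hl' : ∀ B ∈ l, B ∈ 𝒦 := fun B hB => h B (by simp [hB])
    refine HasFundamental.union (hc A hA) (isClosed_listUnion fun B hB => hc B (hl' B hB)) (hf A hA)
      (ih hl') ?_ hloc
    change Detects m (A ∩ listUnion l)
    rw [inter_listUnion]
    refine detects_listUnion hc hi hd _ _ rfl fun B hB => ?_
    obtain ⟨B, hB', rfl⟩ := List.mem_map.1 hB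
    exact hi A hA B (hl' B hB')

/-! #### Excision to open subsets -/

section OpenEmbedding

variable {j : C(Y, X)} {A : Set Y}

lemma push_mem_compl_image (hj : Topology.IsOpenEmbedding j) {c : SChain Y} :
    push j c ∈ chainsIn (j '' A)ᶜ ↔ c ∈ chainsIn Aᶜ := by
  rw [push_mem_iff hj.injective, preimage_compl, preimage_image_eq _ hj.injective]

/-- Excision, injectivity half. The open sets `range j` and `(j '' A)ᶜ` cover the space, so a
bounding chain splits along them, and only the part in `range j`, which lifts, matters along `A`. -/
lemma mem_nulls_push_iff (hj : Topology.IsOpenEmbedding j) (hA : IsClosed (j '' A)) {z : SChain Y} :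
    push j z ∈ nulls (j '' A) ↔ z ∈ nulls A := by
  constructor
  · intro h
    obtain ⟨w, hw⟩ := mem_nulls_iff.1 h
    have hu : range j ∪ (j '' A)ᶜ = univ := by
      rw [eq_univ_iff_forall]
      exact fun x => (em (x ∈ j '' A)).imp (fun ⟨y, _, e⟩ => ⟨y, e⟩) id
    have hbd : bd w ∈ chainsIn (range j) ⊔ chainsIn (j '' A)ᶜ := by
      have := Submodule.add_mem_sup (push_mem_range j z) hw
      rwa [← add_assoc, ZModModule.add_self, zero_add] at this
    obtain ⟨r, -, u, hu, v, hv, e⟩ := exists_split_add hj.isOpen_range hA.isOpen_compl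
      (c := w) (by rw [hu]; exact mem_chainsIn_univ _) hbd
    obtain ⟨u, rfl⟩ := exists_push_eq hj.isEmbedding hu
    refine mem_nulls_iff.2 ⟨u, ?_⟩
    rw [← push_mem_compl_image hj, map_add, push_bd]
    have e' := congrArg bd e
    simp only [map_add, bd_bd, add_zero] at e'
    rw [e', ← add_assoc] at hw
    exact (Submodule.add_mem_iff_left _ (bd_mem hv)).1 hw
  · intro h
    obtain ⟨w, hw⟩ := mem_nulls_iff.1 h
    refine mem_nulls_iff.2 ⟨push j w, ?_⟩
    rwa [← push_bd, ← map_add, push_mem_compl_image hj]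

/-- Excision, surjectivity half: the same cover splits the cycle itself, and the part off `j '' A`
is null. -/
lemma exists_relCycles_push (hj : Topology.IsOpenEmbedding j) (hA : IsClosed (j '' A)) {n : ℕ}
    {z : SChain X} (hz : z ∈ relCycles n (j '' A)) :
    ∃ z' ∈ relCycles n A, z + push j z' ∈ nulls (j '' A) := by
  have hu : range j ∪ (j '' A)ᶜ = univ := by
    rw [eq_univ_iff_forall]
    exact fun x => (em (x ∈ j '' A)).imp (fun ⟨y, _, e⟩ => ⟨y, e⟩) id
  obtain ⟨r, -, u, hu, v, hv, e⟩ := exists_split_add hj.isOpen_range hA.isOpen_compl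
    (c := z) (by rw [hu]; exact mem_chainsIn_univ _) (Submodule.mem_sup_right hz.2)
  have e0 := congrArg (comp n) e
  simp only [map_add, comp_bd, comp_eq hz.1] at e0
  obtain ⟨u', hu'⟩ := exists_push_eq hj.isEmbedding (comp_mem n hu)
  rw [← hu'] at e0
  refine ⟨u', ⟨(push_mem_deg_iff hj.injective).1 (hu' ▸ comp_mem_deg _ _), ?_⟩, ?_⟩
  · change bd u' ∈ chainsIn Aᶜ
    rw [← push_mem_compl_image hj, push_bd]
    have e1 := congrArg bd e0
    simp only [map_add, bd_bd, add_zero] at e1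
    exact (Submodule.add_mem_iff_left _ (bd_mem (comp_mem n hv))).1 (e1 ▸ hz.2)
  · rw [eq_add_of_add_eq e0]
    exact Submodule.add_mem _ (bd_mem_nulls _ _) (chainsIn_le_nulls _ (comp_mem n hv))

lemma push_mem_relCycles (hj : Topology.IsOpenEmbedding j) {n : ℕ} {z : SChain Y} (hz : z ∈ relCycles n A) :
    push j z ∈ relCycles n (j '' A) := by
  refine ⟨push_mem_deg j hz.1, ?_⟩
  change bd (push j z) ∈ chainsIn (j '' A)ᶜ
  rw [← push_bd, push_mem_compl_image hj]
  exact hz.2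

end OpenEmbedding

lemma Detects.image [T1Space X] {j : C(Y, X)} (hj : Topology.IsOpenEmbedding j) {A : Set Y}
    (hA : IsClosed (j '' A)) {m : ℕ} (h : Detects m A) : Detects m (j '' A) := by
  have key : ∀ n, ∀ z ∈ relCycles n (j '' A), (∀ z' ∈ relCycles n A,
      z + push j z' ∈ nulls (j '' A) → z' ∈ nulls A) → z ∈ nulls (j '' A) := by
    intro n z hz h'
    obtain ⟨z', hz', hn⟩ := exists_relCycles_push hj hA hz
    exact (add_mem_iff_left hn).2 ((mem_nulls_push_iff hj hA).2 (h' z' hz' hn))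
  refine ⟨fun n hn z hz => key n z hz fun z' hz' _ => h.vanish n hn z' hz',
    fun z hz hp => key m z hz fun z' hz' hn => h.detect z' hz' fun p hpA => ?_⟩
  rw [← mem_nulls_push_iff hj (by rw [image_singleton]; exact isClosed_singleton),
    image_singleton]
  have hm := mem_image_of_mem j hpA
  exact (add_mem_iff_left (nulls_anti (singleton_subset_iff.2 hm) hn)).1 (hp _ hm)

lemma HasFundamental.image [T1Space X] {j : C(Y, X)} (hj : Topology.IsOpenEmbedding j) {A : Set Y}
    (hA : IsClosed (j '' A)) {m : ℕ} (h : HasFundamental m A) : HasFundamental m (j '' A) := by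
  obtain ⟨z, hz, hp⟩ := h
  refine ⟨push j z, push_mem_relCycles hj hz, ?_⟩
  rintro _ ⟨p, hpA, rfl⟩ h
  refine hp p hpA ?_
  rwa [← mem_nulls_push_iff hj (by rw [image_singleton]; exact isClosed_singleton),
    image_singleton]

lemma IsEuclideanAt.image [T1Space X] {j : C(Y, X)} (hj : Topology.IsOpenEmbedding j) {p : Y}
    {m : ℕ} (h : IsEuclideanAt m p) : IsEuclideanAt m (j p) := by
  have hA : IsClosed (j '' {p}) := by rw [image_singleton]; exact isClosed_singleton
  have d : Detects m ({p} : Set Y) := ⟨h.vanish, fun z _ hp => hp p rfl⟩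
  refine ⟨?_, ?_, ?_⟩
  · have := (d.image hj hA).vanish
    rwa [image_singleton] at this
  · intro z hz z' hz' hn hn'
    rw [← image_singleton] at hz hz' hn hn' ⊢
    obtain ⟨y, hy, h1⟩ := exists_relCycles_push hj hA hz
    obtain ⟨y', hy', h2⟩ := exists_relCycles_push hj hA hz'
    rw [add_mem_iff_left h1, mem_nulls_push_iff hj hA] at hn
    rw [add_mem_iff_left h2, mem_nulls_push_iff hj hA] at hn'
    have h3 := (mem_nulls_push_iff hj hA).2
      (h.unique y hy y' hy' hn hn')
    refine (add_mem_iff_left (y := push j (y + y')) ?_).2 h3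
    rw [map_add, add_add_add_comm]
    exact Submodule.add_mem _ h1 h2
  · have := h.exist.image hj hA
    rwa [image_singleton] at this

end SChain

end LocalHomology

/-! ### Local homology of Euclidean spaces -/

section EuclideanSpaces

namespace SChain

variable {X Y : Type} [TopologicalSpace X] [TopologicalSpace Y]

lemma push_comp (n : ℕ) (f : C(X, Y)) (c : SChain X) : comp n (push f c) = push f (comp n c) := by
  have : comp n ∘ₗ push f = push f ∘ₗ comp n := hom_ext fun k σ => by
    by_cases h : k = n + 1 <;> simp [comp, h]
  exact LinearMap.congr_fun this c

/-- A homotopy of the identity moves a chain by a boundary, up to the track of its boundary. -/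
lemma add_push_slice (F : C(X × unitInterval, X)) (h0 : ∀ x, F (x, 0) = x) (c : SChain X) :
    c + push (slice F 1) c = bd (htpy F c) + htpy F (bd c) := by
  have : slice F 0 = ContinuousMap.id X := ContinuousMap.ext h0
  rw [bd_htpy, this, push_id, add_assoc, ZModModule.add_self, add_zero]

/-- A relative cycle can be pushed off a set into its complement along a homotopy of pairs. -/
lemma exists_add_bd_mem_of_homotopy {B : Set X} (F : C(X × unitInterval, X))
    (h0 : ∀ x, F (x, 0) = x) (hB : ∀ x ∈ B, ∀ t, F (x, t) ∈ B) {D : Set X} (h1 : ∀ x ∈ D, F (x, 1) ∈ B)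
    {z : SChain X} (hz : z ∈ chainsIn D) (hb : bd z ∈ chainsIn B) :
    ∃ y, z + bd y ∈ chainsIn B := by
  refine ⟨htpy F z, ?_⟩
  have e : z + bd (htpy F z) = push (slice F 1) z + htpy F (bd z) :=
    eq_add_of_add_eq (add_push_slice F h0 z)
  rw [e]
  exact Submodule.add_mem _ (push_mem (fun x hx => h1 x hx) hz) (htpy_mem F hB hb)

/-! #### Spaces with a single point -/

section Unique

variable [Unique X]

lemma mem_deg_cases {n : ℕ} {z : SChain X} (hz : z ∈ deg X n) :
    z = 0 ∨ z = of (ContinuousMap.const (Spx (n + 1)) default) := by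
  have : deg X n ≤ Submodule.span (ZMod 2) {of (ContinuousMap.const (Spx (n + 1)) default)} :=
    supp_induction fun k σ hσ => by
      obtain rfl : k = n + 1 := hσ
      have : σ = ContinuousMap.const _ default := by ext; exact Subsingleton.elim _ _
      rw [this]
      exact Submodule.mem_span_singleton_self _
  obtain ⟨a, rfl⟩ := Submodule.mem_span_singleton.1 (this hz)
  rcases (by decide : ∀ a : ZMod 2, a = 0 ∨ a = 1) a with rfl | rfl
  · simp
  · simp

lemma bd_of_const (n : ℕ) : bd (of (ContinuousMap.const (Spx (n + 1)) (default : X)))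
    = (n + 1) • of (ContinuousMap.const (Spx n) (default : X)) := by
  rw [bd_basis]
  have : ∀ i : Fin (n + 1), (ContinuousMap.const (Spx (n + 1)) (default : X)).comp
      (affineSimplex (spxVertex ∘ i.succAbove)) = ContinuousMap.const (Spx n) (default : X) :=
    fun i => rfl
  simp only [this, Finset.sum_const, Finset.card_univ, Fintype.card_fin]

lemma even_nsmul (n : ℕ) (hn : Even n) (c : SChain X) : n • c = 0 := by
  obtain ⟨k, rfl⟩ := hn
  rw [add_nsmul, ZModModule.add_self]

lemma odd_nsmul (n : ℕ) (hn : Odd n) (c : SChain X) : n • c = c := by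
  obtain ⟨k, rfl⟩ := hn
  rw [add_nsmul, even_nsmul _ (even_two_mul k), one_nsmul, zero_add]

lemma of_const_notMem {n : ℕ} {x : X} : of (ContinuousMap.const (Spx (n + 1)) x) ∉
    chainsIn (∅ : Set X) := fun h =>
  of_mem_chainsIn_iff.1 h ⟨spxVertex 0, rfl⟩

/-- There is one simplex in each degree, and its boundary is the next lower one times its number of
vertices. Modulo two the boundary is therefore alternately zero and an isomorphism. -/
lemma isEuclideanAt_unique (p : X) : IsEuclideanAt 0 p := by
  have hp : ({p} : Set X)ᶜ = ∅ := by
    rw [compl_empty_iff, eq_univ_iff_forall]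
    exact fun x => Subsingleton.elim _ _
  have h0 : of (ContinuousMap.const (Spx 1) (default : X)) ∈ relCycles 0 {p} := by
    refine ⟨of_mem_supp rfl, ?_⟩
    change bd _ ∈ chainsIn _
    rw [bd_of_const, odd_nsmul _ (by decide), of_mem_chainsIn_iff]
    -- The boundary of a vertex is the empty simplex; its image is empty, so it lies in every
    -- `chainsIn`, and the augmentation does not affect degree zero.
    rintro _ ⟨t, rfl⟩
    exact absurd t.2.2 (by simp)
  refine ⟨fun n hn z hz => ?_, fun z hz z' hz' hn hn' => ?_, _, h0, ?_⟩
  · rcases mem_deg_cases hz.1 with rfl | rfl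
    · exact Submodule.zero_mem _
    · obtain ⟨n, rfl⟩ : ∃ k, n = k + 1 := ⟨n - 1, by omega⟩
      rcases Nat.even_or_odd n with hn | hn
      · have e := bd_of_const (X := X) (n + 2)
        rw [odd_nsmul _ (by obtain ⟨k, rfl⟩ := hn; exact ⟨k + 1, by ring⟩)] at e
        rw [← e]
        exact bd_mem_nulls _ _
      · have h : bd _ ∈ chainsIn _ := hz.2
        rw [bd_of_const, odd_nsmul _ (by obtain ⟨k, rfl⟩ := hn; exact ⟨k + 1, by ring⟩), hp] at h
        exact absurd h of_const_notMem
  · rcases mem_deg_cases hz.1 with rfl | rfl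
    · exact absurd (Submodule.zero_mem _) hn
    · rcases mem_deg_cases hz'.1 with rfl | rfl
      · exact absurd (Submodule.zero_mem _) hn'
      · rw [ZModModule.add_self]
        exact Submodule.zero_mem _
  · rintro q - h
    obtain rfl : q = p := Subsingleton.elim _ _
    obtain ⟨w, hw, h⟩ := exists_deg_of_mem_nulls h0.1 h
    have hbw : bd w = 0 := by
      rcases mem_deg_cases hw with rfl | rfl
      · simp
      · rw [bd_of_const, even_nsmul _ (by decide)]
    rw [hbw, add_zero, hp] at h
    exact of_const_notMem h

end Unique

/-! #### Suspension -/

section Suspension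

variable (x : Y)

/-- The half space `s < 0`. -/
def negHalf (Y : Type) : Set (ℝ × Y) := {q | q.1 < 0}

/-- The complement of the ray `{(s, x) | s ≤ 0}`. -/
def rayCompl : Set (ℝ × Y) := {q | q.1 ≤ 0 ∧ q.2 = x}ᶜ

/-- This open cover drives the suspension argument. Chains can be pushed into the second set along
the line, and the intersection is the product of the open negative half-line with `{x}ᶜ`; so the
part of a boundary in the half space plays the role of the connecting map. -/
lemma negHalf_union_rayCompl : negHalf Y ∪ rayCompl x = {((0 : ℝ), x)}ᶜ := by
  ext ⟨s, y⟩
  simp only [negHalf, rayCompl, mem_union, mem_ofPred_eq, mem_compl_iff, mem_singleton_iff,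
    Prod.mk.injEq, not_and]
  constructor
  · rintro (h | h) rfl
    · exact absurd h (lt_irrefl _)
    · exact h le_rfl
  · intro h
    rcases lt_or_ge s 0 with hs | hs
    · exact Or.inl hs
    · exact Or.inr fun hs' => h (le_antisymm hs' hs)

/-- The first coordinate is raised to `max s 1`. It never decreases, so points off the ray stay off
it, and at time one it is positive. -/
lemma exists_push_off_ray {z : SChain (ℝ × Y)} (hz : bd z ∈ chainsIn (rayCompl x)) :
    ∃ y, z + bd y ∈ chainsIn (rayCompl x) := by
  have hle : ∀ (s : ℝ) (t : unitInterval), s ≤ s + t * (max s 1 - s) := fun s t => by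
    have := mul_nonneg t.2.1 (sub_nonneg.2 (le_max_left s 1))
    linarith
  refine exists_add_bd_mem_of_homotopy (B := rayCompl x) (D := univ)
    ⟨fun q : (ℝ × Y) × unitInterval => (q.1.1 + q.2 * (max q.1.1 1 - q.1.1), q.1.2), by fun_prop⟩
    (fun q => by simp) (fun q hq t h => hq ⟨(hle _ t).trans h.1, h.2⟩) (fun q _ h => ?_)
    (mem_chainsIn_univ z) hz
  have h1 : q.1 + (1 : unitInterval) * (max q.1 1 - q.1) ≤ 0 := h.1
  have := le_max_right q.1 1
  rw [Set.Icc.coe_one, one_mul] at h1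
  linarith

/-- The section of the projection `ℝ × Y → Y` at `-1`. -/
def negSection (Y : Type) [TopologicalSpace Y] : C(Y, ℝ × Y) := ⟨fun y => (-1, y), by fun_prop⟩

/-- The half space contracts along the line onto the slice at `-1`, so a bounding chain of the
projection can be placed in that slice and joined to `a` by the track of the contraction. -/
lemma exists_of_snd_mem_nulls {a : SChain (ℝ × Y)} (ha : a ∈ chainsIn (negHalf Y))
    (hb : bd a ∈ chainsIn (rayCompl x)) (h : push ContinuousMap.snd a ∈ nulls {x}) :
    ∃ w ∈ chainsIn (negHalf Y), a + bd w ∈ chainsIn (rayCompl x) := by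
  have hneg : ∀ (s : ℝ) (t : unitInterval), s < 0 → s + t * (-1 - s) < 0 := fun s t hs => by
    have h0 := t.2.1
    have h1 := t.2.2
    rcases h1.lt_or_eq with h1 | h1
    · nlinarith
    · rw [h1]; linarith
  let F : C((ℝ × Y) × unitInterval, ℝ × Y) :=
    ⟨fun q => (q.1.1 + q.2 * (-1 - q.1.1), q.1.2), by fun_prop⟩
  have hF1 : slice F 1 = (negSection Y).comp ContinuousMap.snd := by
    ext q
    · change q.1 + ((1 : unitInterval) : ℝ) * (-1 - q.1) = -1
      simp
    · rfl
  have e := eq_add_of_add_eq (add_push_slice F (fun q => by simp [F]) a)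
  rw [hF1, ← push_push] at e
  obtain ⟨w, hw⟩ := mem_nulls_iff.1 h
  refine ⟨htpy F a + push (negSection Y) w, Submodule.add_mem _ ?_ ?_, ?_⟩
  · exact htpy_mem F (fun q hq t => hneg _ t hq) ha
  · refine chainsIn_mono ?_ (push_mem_range _ w)
    rintro _ ⟨y, rfl⟩
    exact (neg_one_lt_zero : (-1 : ℝ) < 0)
  · have e' : a + bd (htpy F a + push (negSection Y) w)
        = push (negSection Y) (push ContinuousMap.snd a + bd w) + htpy F (bd a) := by
      rw [map_add, ← add_assoc, e, map_add, push_bd]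
      abel
    rw [e']
    refine Submodule.add_mem _ (push_mem (f := negSection Y) (B := {x}ᶜ) (B' := rayCompl x) (fun y hy h => hy h.2) hw) ?_
    refine chainsIn_mono ?_ (htpy_mem F (B' := negHalf Y ∩ {q | q.2 ≠ x})
      (B := negHalf Y ∩ rayCompl x) (fun q hq t => ⟨hneg _ t hq.1, fun h => hq.2 ⟨hq.1.le, h⟩⟩)
      (mem_chainsIn_inter (bd_mem ha) hb))
    exact fun q hq h => hq.2 h.2

/-- `a` is the part in the half space `s < 0` of the boundary of `z`. -/
def IsNegBd (z a : SChain (ℝ × Y)) : Prop :=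
  a ∈ chainsIn (negHalf Y) ∧ ∃ r ∈ chainsIn ({((0 : ℝ), x)}ᶜ : Set (ℝ × Y)),
    bd z + bd r + a ∈ chainsIn (rayCompl x)

variable {x}

lemma IsNegBd.add {z z' a a' : SChain (ℝ × Y)} (h : IsNegBd x z a) (h' : IsNegBd x z' a') :
    IsNegBd x (z + z') (a + a') := by
  obtain ⟨ha, r, hr, e⟩ := h
  obtain ⟨ha', r', hr', e'⟩ := h'
  refine ⟨Submodule.add_mem _ ha ha', r + r', Submodule.add_mem _ hr hr', ?_⟩
  convert Submodule.add_mem _ e e' using 1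
  simp only [map_add]
  abel

lemma IsNegBd.bd_mem {z a : SChain (ℝ × Y)} (h : IsNegBd x z a) :
    bd a ∈ chainsIn (rayCompl x) := by
  obtain ⟨-, r, -, e⟩ := h
  have := SChain.bd_mem e
  simpa only [map_add, bd_bd, zero_add] using this

lemma isOpen_negHalf : IsOpen (negHalf Y) := isOpen_lt continuous_fst continuous_const

lemma isOpen_rayCompl [T1Space Y] : IsOpen (rayCompl x) := by
  refine IsClosed.isOpen_compl (self := ?_)
  exact (isClosed_le continuous_fst continuous_const).inter
    (isClosed_singleton.preimage continuous_snd)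

/-- The connecting map followed by the projection is injective and well defined on classes. Both
directions correct by `r`, which avoids the point and so does not affect the class of `z`. -/
lemma IsNegBd.mem_nulls_iff [T1Space Y] {z a : SChain (ℝ × Y)} (h : IsNegBd x z a) :
    z ∈ nulls {((0 : ℝ), x)} ↔ push ContinuousMap.snd a ∈ nulls {x} := by
  obtain ⟨ha, r, hr, e⟩ := id h
  have hsub : chainsIn (rayCompl x) ≤ chainsIn ({((0 : ℝ), x)}ᶜ : Set (ℝ × Y)) := by
    rw [← negHalf_union_rayCompl]
    exact chainsIn_mono subset_union_right
  have hsub' : chainsIn (negHalf Y) ≤ chainsIn ({((0 : ℝ), x)}ᶜ : Set (ℝ × Y)) := by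
    rw [← negHalf_union_rayCompl]
    exact chainsIn_mono subset_union_left
  constructor
  -- If `z` is null, the correcting chain splits along the cover. Its part `u` in the half space
  -- moves `a` into the intersection, where the projection avoids `x`.
  · intro hz
    obtain ⟨w, hw⟩ := SChain.mem_nulls_iff.1 hz
    have hq := Submodule.add_mem _ hw hr
    have hbq : bd (z + bd w + r) = (bd z + bd r + a) + a := by
      simp only [map_add, bd_bd, add_zero]
      rw [add_assoc _ a a, ZModModule.add_self, add_zero]
    rw [← negHalf_union_rayCompl] at hq
    obtain ⟨r', -, u, hu, v, hv, e'⟩ := exists_split_add isOpen_negHalf (isOpen_rayCompl (x := x))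
      hq (by rw [hbq]; exact Submodule.add_mem _ (Submodule.mem_sup_right e)
              (Submodule.mem_sup_left ha))
    have e1 := congrArg bd e'
    rw [map_add, bd_bd, add_zero, hbq, map_add] at e1
    have e2 : a + bd u = bd v + (bd z + bd r + a) := by
      rw [add_comm _ a] at e1
      rw [eq_add_of_add_eq e1, add_comm]
    have hm : a + bd u ∈ chainsIn (negHalf Y ∩ rayCompl x) :=
      mem_chainsIn_inter (Submodule.add_mem _ ha (SChain.bd_mem hu))
        (by rw [e2]; exact Submodule.add_mem _ (SChain.bd_mem hv) e)
    refine SChain.mem_nulls_iff.2 ⟨push ContinuousMap.snd u, ?_⟩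
    rw [← push_bd, ← map_add]
    exact push_mem (fun q hq h => hq.2 ⟨(show q.1 < 0 from hq.1).le, h⟩) hm
  -- Conversely, a chain `w` in the half space moves `a` off the ray. Then `z + r + w` has its
  -- boundary off the ray and can be pushed off it, while `r` and `w` avoid the point.
  · intro hn
    obtain ⟨w, hw, h'⟩ := exists_of_snd_mem_nulls x ha h.bd_mem hn
    have hb : bd (z + r + w) ∈ chainsIn (rayCompl x) := by
      have := Submodule.add_mem _ e h'
      convert this using 1
      simp only [map_add]
      have h2 := ZModModule.add_self a
      calc bd z + bd r + bd w = bd z + bd r + bd w + (a + a) := by rw [h2, add_zero]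
        _ = _ := by abel
    obtain ⟨y, hy⟩ := exists_push_off_ray x hb
    refine SChain.mem_nulls_iff.2 ⟨y, ?_⟩
    have e3 : z + r + w + bd y = z + bd y + (r + w) := by abel
    have := hsub hy
    rw [e3] at this
    exact (Submodule.add_mem_iff_left _ (Submodule.add_mem _ hr (hsub' hw))).1 this

/-- Excision for the cover of the punctured product, applied to the cycle `bd z`; homogeneous
components are taken to fix the degree of `a`. -/
lemma exists_isNegBd [T1Space Y] {n : ℕ} {z : SChain (ℝ × Y)}
    (hz : z ∈ relCycles (n + 1) {((0 : ℝ), x)}) : ∃ a ∈ deg (ℝ × Y) n, IsNegBd x z a := by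
  have hb : bd z ∈ chainsIn ({((0 : ℝ), x)}ᶜ : Set (ℝ × Y)) := hz.2
  have hb' := hb
  rw [← negHalf_union_rayCompl] at hb'
  obtain ⟨r, hr, a, ha, b, hb'', e⟩ := exists_split_add isOpen_negHalf (isOpen_rayCompl (x := x))
    hb' (by rw [bd_bd]; exact Submodule.zero_mem _)
  rw [negHalf_union_rayCompl] at hr
  have e0 := congrArg (comp n) e
  rw [map_add, map_add, comp_eq (bd_mem_deg hz.1), comp_bd] at e0
  refine ⟨comp n a, comp_mem_deg _ _, comp_mem n ha, comp (n + 1) r, comp_mem _ hr, ?_⟩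
  rw [e0, add_right_comm, ZModModule.add_self, zero_add]
  exact comp_mem n hb''

lemma IsNegBd.snd_mem_relCycles {n : ℕ} {z a : SChain (ℝ × Y)} (h : IsNegBd x z a)
    (ha : a ∈ deg (ℝ × Y) n) : push ContinuousMap.snd a ∈ relCycles n {x} := by
  refine ⟨push_mem_deg _ ha, ?_⟩
  change bd (push ContinuousMap.snd a) ∈ chainsIn ({x}ᶜ : Set Y)
  rw [← push_bd]
  exact push_mem (fun q hq h => hq.2 ⟨(show q.1 < 0 from hq.1).le, h⟩)
    (mem_chainsIn_inter (SChain.bd_mem h.1) h.bd_mem)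

/-- Local homology of a product with a line. -/
lemma IsEuclideanAt.line_prod [T1Space Y] {m : ℕ} (hx : IsEuclideanAt m x) :
    IsEuclideanAt (m + 1) ((0 : ℝ), x) := by
  refine ⟨fun n hn z hz => ?_, fun z hz z' hz' hn hn' => ?_, ?_⟩
  · obtain ⟨n, rfl⟩ : ∃ k, n = k + 1 := ⟨n - 1, by omega⟩
    obtain ⟨a, ha, h⟩ := exists_isNegBd hz
    exact h.mem_nulls_iff.2 (hx.vanish n (by omega) _ (h.snd_mem_relCycles ha))
  · obtain ⟨a, ha, h⟩ := exists_isNegBd hz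
    obtain ⟨a', ha', h'⟩ := exists_isNegBd hz'
    rw [(h.add h').mem_nulls_iff, map_add]
    exact hx.unique _ (h.snd_mem_relCycles ha) _ (h'.snd_mem_relCycles ha')
      (fun e => hn (h.mem_nulls_iff.2 e)) (fun e => hn' (h'.mem_nulls_iff.2 e))
  · obtain ⟨b, hb, hbx⟩ := hx.exist
    -- The generator upstairs is the cylinder over a generator `b`, from height `-1` to height `1`.
    -- The part of its boundary in the half space is the bottom copy of `b`, which projects back to
    -- `b`.
    let G : C(Y × unitInterval, ℝ × Y) := ⟨fun q => (2 * q.2 - 1, q.1), by fun_prop⟩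
    have hG0 : slice G 0 = negSection Y := by
      ext y
      · change 2 * ((0 : unitInterval) : ℝ) - 1 = -1
        simp
      · rfl
    have e : bd (comp (m + 1) (htpy G b)) + push (negSection Y) b
        = comp m (push (slice G 1) b + htpy G (bd b)) := by
      rw [← comp_bd, bd_htpy, hG0, add_assoc, map_add, push_comp, comp_eq hb.1, add_right_comm,
        ZModModule.add_self, zero_add]
    have h3 : bd (comp (m + 1) (htpy G b)) + push (negSection Y) b ∈ chainsIn (rayCompl x) := by
      rw [e]
      refine comp_mem m (Submodule.add_mem _ (chainsIn_mono ?_ (push_mem_range _ b)) ?_)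
      · rintro _ ⟨y, rfl⟩ h
        have : 2 * ((1 : unitInterval) : ℝ) - 1 ≤ 0 := h.1
        norm_num at this
      · exact htpy_mem G (B := {x}ᶜ) (B' := rayCompl x) (fun y hy t h => hy h.2) hb.2
    have h1 : push (negSection Y) b ∈ chainsIn (negHalf Y) := by
      refine chainsIn_mono ?_ (push_mem_range _ b)
      rintro _ ⟨y, rfl⟩
      exact (neg_one_lt_zero : (-1 : ℝ) < 0)
    have h : IsNegBd x (comp (m + 1) (htpy G b)) (push (negSection Y) b) :=
      ⟨h1, 0, Submodule.zero_mem _, by rwa [map_zero, add_zero]⟩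
    have hz : comp (m + 1) (htpy G b) ∈ relCycles (m + 1) {((0 : ℝ), x)} := by
      refine ⟨comp_mem_deg _ _, ?_⟩
      change bd _ ∈ chainsIn _
      rw [← negHalf_union_rayCompl]
      exact (Submodule.add_mem_iff_left _ (chainsIn_mono subset_union_left h1)).1
        (chainsIn_mono subset_union_right h3)
    refine ⟨_, hz, ?_⟩
    rintro _ rfl hn
    rw [h.mem_nulls_iff, push_push] at hn
    have : (ContinuousMap.snd : C(ℝ × Y, Y)).comp (negSection Y) = ContinuousMap.id Y := rfl
    rw [this, push_id] at hn
    exact hbx x rfl hn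

end Suspension

end SChain

end EuclideanSpaces

/-! ### Fundamental classes along compact subsets of manifolds -/

section FundamentalClass

namespace SChain

variable {X : Type} [TopologicalSpace X]

lemma isEuclideanAt_pi (m : ℕ) : ∀ p : Fin m → ℝ, IsEuclideanAt m p := by
  induction m with
  | zero => exact isEuclideanAt_unique
  | succ m ih =>
    intro p
    -- The shift by `p 0` sends `(0, Fin.tail p)` to `p`, as the local computation is made at height
    -- zero only.
    let h : ℝ × (Fin m → ℝ) ≃ₜ (Fin (m + 1) → ℝ) :=
      { toFun := fun q => Fin.cons (q.1 + p 0) q.2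
        invFun := fun v => (v 0 - p 0, Fin.tail v)
        left_inv := fun q => by simp
        right_inv := fun v => by simp
        continuous_toFun := by
          refine continuous_pi fun i => ?_
          refine Fin.cases ?_ (fun i => ?_) i
          · simpa using by fun_prop
          · simpa using by fun_prop
        continuous_invFun := by
          refine Continuous.prodMk (by fun_prop) (continuous_pi fun i => ?_)
          exact continuous_apply i.succ }
    have := (ih (Fin.tail p)).line_prod.image (j := ⟨h, h.continuous⟩) h.isOpenEmbedding
    convert this
    simp [h]

variable {E : Type} [NormedAddCommGroup E] [NormedSpace ℝ E]

lemma isEuclideanAt_of_finrank [FiniteDimensional ℝ E] {m : ℕ} (hm : finrank ℝ E = m) (p : E) :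
    IsEuclideanAt m p := by
  let e : E ≃L[ℝ] (Fin m → ℝ) := ContinuousLinearEquiv.ofFinrankEq (by simpa using hm)
  have := (isEuclideanAt_pi m (e p)).image (j := ⟨e.symm, e.symm.continuous⟩)
    e.symm.toHomeomorph.isOpenEmbedding
  simpa using this

/-- Away from `p`, everything can be pushed radially out of `B`. A ray from a point of a convex set
never re-enters after leaving, so the boundary of `z` stays outside `B` during the push. -/
lemma mem_nulls_of_convex {B : Set E} (hB : Convex ℝ B) (hb : Bornology.IsBounded B) {p : E}
    (hp : p ∈ B) {z : SChain E} (hz : bd z ∈ chainsIn Bᶜ) (h : z ∈ nulls {p}) : z ∈ nulls B := by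
  obtain ⟨w, hw⟩ := mem_nulls_iff.1 h
  obtain ⟨R, hR⟩ := hb.subset_closedBall p
  have hR0 : 0 ≤ R := by simpa using hR hp
  let j : C(({p}ᶜ : Set E), E) := ⟨Subtype.val, continuous_subtype_val⟩
  obtain ⟨c, hc⟩ := exists_push_eq (f := j) Topology.IsEmbedding.subtypeVal (c := z + bd w)
    (by change _ ∈ chainsIn (range Subtype.val); rwa [Subtype.range_val])
  have hne : ∀ q : ({p}ᶜ : Set E) × unitInterval, ‖q.1.1 - p‖ ≠ 0 := fun q =>
    norm_ne_zero_iff.2 (sub_ne_zero.2 q.1.2)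
  -- The distance to `p` grows by `t * (R + 1)`, so at time one it exceeds `R`, the radius of a ball
  -- containing `B`.
  let F : C(({p}ᶜ : Set E) × unitInterval, E) :=
    ⟨fun q => p + (1 + q.2 * (R + 1) / ‖q.1.1 - p‖) • (q.1.1 - p), by
      refine continuous_const.add (Continuous.smul (continuous_const.add (Continuous.div ?_ ?_ hne))
        ?_) <;> fun_prop⟩
  have hF0 : slice F 0 = j := by
    ext y
    change p + (1 + ((0 : unitInterval) : ℝ) * (R + 1) / ‖y.1 - p‖) • (y.1 - p) = y.1
    simp
  have hcB : bd c ∈ chainsIn (j ⁻¹' Bᶜ) := by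
    rw [← push_mem_iff Subtype.val_injective, push_bd, hc, map_add, bd_bd, add_zero]
    exact hz
  have e := bd_htpy F c
  rw [hF0, hc, add_assoc] at e
  have e' : z + bd (w + htpy F c) = push (slice F 1) c + htpy F (bd c) := by
    rw [map_add, e]
    have h2 := ZModModule.add_self (z + bd w)
    calc z + (bd w + (z + bd w + (push (slice F 1) c + htpy F (bd c))))
        = (z + bd w + (z + bd w)) + (push (slice F 1) c + htpy F (bd c)) := by abel
      _ = _ := by rw [h2, zero_add]
  refine mem_nulls_iff.2 ⟨w + htpy F c, ?_⟩
  rw [e']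
  refine Submodule.add_mem _ (chainsIn_mono ?_ (push_mem_range _ c)) (htpy_mem F ?_ hcB)
  · rintro _ ⟨y, rfl⟩ hy
    have h1 := hR hy
    have hpos : 0 < ‖y.1 - p‖ := lt_of_le_of_ne (norm_nonneg _) (hne (y, 1)).symm
    change p + (1 + ((1 : unitInterval) : ℝ) * (R + 1) / ‖y.1 - p‖) • (y.1 - p) ∈ _ at h1
    rw [Metric.mem_closedBall, dist_eq_norm, add_sub_cancel_left, norm_smul,
      Real.norm_of_nonneg (by simp only [Set.Icc.coe_one]; positivity), add_mul,
      div_mul_cancel₀ _ hpos.ne'] at h1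
    simp only [Set.Icc.coe_one] at h1
    linarith
  · intro y hy t hmem
    refine hy ?_
    have ht0 := t.2.1
    set a : ℝ := 1 + t * (R + 1) / ‖y.1 - p‖ with ha
    have ha1 : 1 ≤ a := by
      rw [ha]
      have : 0 ≤ t * (R + 1) / ‖y.1 - p‖ := by positivity
      linarith
    have hmem' : p + a • (y.1 - p) ∈ B := hmem
    -- The starting point lies on the segment from `p` to its pushed position, so it would be in `B`
    -- if the latter were.
    have := hB.add_smul_sub_mem hp hmem' (t := a⁻¹) ⟨by positivity, inv_le_one_of_one_le₀ ha1⟩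
    rw [add_sub_cancel_left, smul_smul, inv_mul_cancel₀ (by positivity), one_smul,
      add_sub_cancel] at this
    exact this

lemma exists_isCompact_mem_chainsIn {B : Set X} {c : SChain X} (hc : c ∈ chainsIn B) :
    ∃ Q ⊆ B, IsCompact Q ∧ c ∈ chainsIn Q := by
  refine ⟨⋃ p ∈ c.support, range p.2, iUnion₂_subset fun p hp => hc hp,
    c.support.isCompact_biUnion fun p _ => isCompact_range p.2.continuous, fun p hp => ?_⟩
  exact subset_biUnion_of_mem (u := fun p : Σ n, C(Spx n, X) => range p.2) hp

section FiniteDimensional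

variable [FiniteDimensional ℝ E] {m : ℕ}

lemma detects_convex (hm : finrank ℝ E = m) {B : Set E} (hB : Convex ℝ B)
    (hb : Bornology.IsBounded B) : Detects m B := by
  rcases B.eq_empty_or_nonempty with rfl | ⟨p, hp⟩
  · exact detects_empty m
  · have hpB := singleton_subset_iff.2 hp
    exact ⟨fun n hn z hz => mem_nulls_of_convex hB hb hp hz.2
      ((isEuclideanAt_of_finrank hm p).vanish n hn z (relCycles_anti hpB n hz)),
      fun z hz h => mem_nulls_of_convex hB hb hp hz.2 (h p hp)⟩

/-- The boundary of a given cycle has compact image off `A`, so the cycle is already relative to a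
finite union `K` of closed balls centred in `A`. Such a union is covered by Mayer–Vietoris, because
compact convex sets are stable under intersection. -/
lemma detects_isCompact (hm : finrank ℝ E = m) {A : Set E} (hA : IsCompact A) : Detects m A := by
  have key : ∀ n, ∀ z ∈ relCycles n A, ∃ K : Set E, A ⊆ K ∧ z ∈ relCycles n K ∧ Detects m K ∧
      ((∀ p ∈ A, z ∈ nulls {p}) → ∀ p ∈ K, z ∈ nulls {p}) := by
    intro n z hz
    obtain ⟨Q, hQA, hQ, hzQ⟩ := exists_isCompact_mem_chainsIn (show bd z ∈ chainsIn Aᶜ from hz.2)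
    obtain ⟨δ, hδ, hsub⟩ := hA.exists_cthickening_subset_open hQ.isClosed.isOpen_compl
      (subset_compl_comm.1 hQA)
    obtain ⟨t, htA, htfin, hcov⟩ := hA.finite_cover_balls hδ
    set l : List (Set E) := htfin.toFinset.toList.map fun a => Metric.closedBall a δ with hl
    have hmem : ∀ {x}, x ∈ listUnion l ↔ ∃ a ∈ t, x ∈ Metric.closedBall a δ := by
      intro x
      rw [mem_listUnion]
      simp [hl]
    have hQl : listUnion l ⊆ Qᶜ := by
      intro x hx
      obtain ⟨a, ha, hxa⟩ := hmem.1 hx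
      exact hsub (Metric.mem_cthickening_of_dist_le x a δ A (htA ha) hxa)
    have hzl : bd z ∈ chainsIn (listUnion l)ᶜ := chainsIn_mono (subset_compl_comm.1 hQl) hzQ
    refine ⟨listUnion l, fun x hx => ?_, ⟨hz.1, hzl⟩, ?_, fun h p hp => ?_⟩
    · obtain ⟨a, ha, hxa⟩ := mem_iUnion₂.1 (hcov hx)
      exact hmem.2 ⟨a, ha, Metric.ball_subset_closedBall hxa⟩
    · refine detects_listUnion (𝒦 := {B | Convex ℝ B ∧ IsCompact B}) (fun B hB => hB.2.isClosed)
        (fun B hB B' hB' => ⟨hB.1.inter hB'.1, hB.2.inter hB'.2⟩)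
        (fun B hB => detects_convex hm hB.1 hB.2.isBounded) _ l rfl fun B hB => ?_
      obtain ⟨a, -, rfl⟩ := List.mem_map.1 hB
      exact ⟨convex_closedBall a δ, isCompact_closedBall a δ⟩
    · obtain ⟨a, ha, hpa⟩ := hmem.1 hp
      have hball : Metric.closedBall a δ ⊆ listUnion l := fun x hx => hmem.2 ⟨a, ha, hx⟩
      -- The enlargement `K` contains points outside `A`; vanishing at the centre of a ball, which
      -- is in `A`, spreads over the ball by convexity.
      exact nulls_anti (singleton_subset_iff.2 hpa) (mem_nulls_of_convex (convex_closedBall a δ)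
        Metric.isBounded_closedBall (Metric.mem_closedBall_self hδ.le)
        (chainsIn_mono (compl_subset_compl.2 hball) hzl) (h a (htA ha)))
  refine ⟨fun n hn z hz => ?_, fun z hz h => ?_⟩
  · obtain ⟨K, hAK, hzK, dK, -⟩ := key n z hz
    exact nulls_anti hAK (dK.vanish n hn z hzK)
  · obtain ⟨K, hAK, hzK, dK, hp⟩ := key m z hz
    exact nulls_anti hAK (dK.detect z hzK (hp h))

/-- A local generator at the origin is a relative cycle along a small ball, and it is nonzero at all
its points by convexity. A homothety enlarges the ball until it contains `A`. -/
lemma hasFundamental_isCompact (hm : finrank ℝ E = m) {A : Set E} (hA : IsCompact A) : HasFundamental m A := by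
  obtain ⟨z, hz, h0⟩ := (isEuclideanAt_of_finrank hm (0 : E)).exist
  obtain ⟨Q, hQ0, hQ, hzQ⟩ := exists_isCompact_mem_chainsIn
    (show bd z ∈ chainsIn ({0}ᶜ : Set E) from hz.2)
  obtain ⟨ρ, hρ, hball⟩ := Metric.isOpen_iff.1 hQ.isClosed.isOpen_compl 0
    (fun h => hQ0 h rfl)
  have hball' : Metric.closedBall (0 : E) (ρ / 2) ⊆ Qᶜ :=
    (Metric.closedBall_subset_ball (half_lt_self hρ)).trans hball
  have hzb : bd z ∈ chainsIn (Metric.closedBall (0 : E) (ρ / 2))ᶜ :=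
    chainsIn_mono (subset_compl_comm.1 hball') hzQ
  have hmem0 : (0 : E) ∈ Metric.closedBall (0 : E) (ρ / 2) :=
    Metric.mem_closedBall_self (half_pos hρ).le
  have hf : HasFundamental m (Metric.closedBall (0 : E) (ρ / 2)) := by
    refine ⟨z, ⟨hz.1, hzb⟩, fun p hp hn => h0 0 rfl ?_⟩
    exact nulls_anti (singleton_subset_iff.2 hmem0) (mem_nulls_of_convex (convex_closedBall _ _)
      Metric.isBounded_closedBall hp hzb hn)
  obtain ⟨R, hR, hAR⟩ := hA.isBounded.subset_closedBall_lt 0 0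
  have ha : R / (ρ / 2) ≠ 0 := by positivity
  let e : E ≃ₜ E := Homeomorph.smulOfNeZero (R / (ρ / 2)) ha
  have him : (⟨e, e.continuous⟩ : C(E, E)) '' Metric.closedBall (0 : E) (ρ / 2)
      = Metric.closedBall 0 R := by
    change (fun x => (R / (ρ / 2)) • x) '' _ = _
    rw [image_smul, smul_closedBall _ _ (by positivity), smul_zero,
      Real.norm_of_nonneg (by positivity), div_mul_cancel₀ _ (by positivity)]
  have := hf.image (j := ⟨e, e.continuous⟩) e.isOpenEmbedding
    (by rw [him]; exact Metric.isClosed_closedBall)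
  rw [him] at this
  exact this.mono hAR

end FiniteDimensional

/-- Every point of `X` has an open neighbourhood homeomorphic to Euclidean space of dimension
`m`. -/
def LocallyEuclidean (m : ℕ) (X : Type) [TopologicalSpace X] : Prop :=
  ∀ x : X, ∃ j : C(EuclideanSpace ℝ (Fin m), X), Topology.IsOpenEmbedding j ∧ x ∈ range j

/-- The fundamental class of a manifold along a compact subset. -/
theorem LocallyEuclidean.hasFundamental [T2Space X] {m : ℕ} (hX : LocallyEuclidean m X) {K : Set X}
    (hK : IsCompact K) : HasFundamental m K := by
  have hm : finrank ℝ (EuclideanSpace ℝ (Fin m)) = m := by simp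
  set 𝒦 : Set (Set X) := {A | IsCompact A ∧
    ∃ j : C(EuclideanSpace ℝ (Fin m), X), Topology.IsOpenEmbedding j ∧ A ⊆ range j}
  have hloc : ∀ p : X, IsEuclideanAt m p := by
    intro p
    obtain ⟨j, hj, v, rfl⟩ := hX p
    exact (isEuclideanAt_of_finrank hm v).image hj
  have himg : ∀ A ∈ 𝒦, ∃ (j : C(EuclideanSpace ℝ (Fin m), X)) (B : Set _),
      Topology.IsOpenEmbedding j ∧ IsCompact B ∧ j '' B = A := by
    rintro A ⟨hA, j, hj, hAj⟩
    exact ⟨j, j ⁻¹' A, hj, hj.isInducing.isCompact_preimage' hA hAj,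
      image_preimage_eq_of_subset hAj⟩
  have hd : ∀ A ∈ 𝒦, Detects m A := by
    intro A hA
    obtain ⟨j, B, hj, hB, rfl⟩ := himg A hA
    exact (detects_isCompact hm hB).image hj hA.1.isClosed
  have hf : ∀ A ∈ 𝒦, HasFundamental m A := by
    intro A hA
    obtain ⟨j, B, hj, hB, rfl⟩ := himg A hA
    exact (hasFundamental_isCompact hm hB).image hj hA.1.isClosed
  have hnhds : ∀ x : X, ∃ N ∈ nhds x, N ∈ 𝒦 := by
    intro x
    obtain ⟨j, hj, v, rfl⟩ := hX x
    refine ⟨j '' Metric.closedBall v 1, hj.isOpenMap.image_mem_nhds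
      (Metric.closedBall_mem_nhds v one_pos), (isCompact_closedBall v 1).image j.continuous, j, hj,
      image_subset_range _ _⟩
  choose N hN hN𝒦 using hnhds
  -- The pieces `K ∩ N x` are compact and each lies in one chart; so do all their intersections,
  -- which is what the finite gluing requires.
  obtain ⟨t, -, ht⟩ := hK.elim_nhds_subcover N fun x _ => hN x
  set l : List (Set X) := t.toList.map fun x => K ∩ N x with hl
  have hKl : K = listUnion l := by
    ext x
    rw [mem_listUnion]
    constructor
    · intro hx
      obtain ⟨y, hy, hxy⟩ := mem_iUnion₂.1 (ht hx)
      exact ⟨_, List.mem_map.2 ⟨y, by simpa using hy, rfl⟩, hx, hxy⟩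
    · rintro ⟨A, hA, hx⟩
      obtain ⟨y, -, rfl⟩ := List.mem_map.1 hA
      exact hx.1
  rw [hKl]
  refine hasFundamental_listUnion (𝒦 := 𝒦) (fun A hA => hA.1.isClosed) (fun A hA B hB =>
    ⟨hA.1.inter hB.1, hA.2.imp fun j hj => ⟨hj.1, inter_subset_left.trans hj.2⟩⟩) hd hf hloc l
    fun A hA => ?_
  obtain ⟨y, -, rfl⟩ := List.mem_map.1 hA
  exact ⟨hK.inter (hN𝒦 y).1, (hN𝒦 y).2.imp fun j hj => ⟨hj.1, inter_subset_right.trans hj.2⟩⟩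

end SChain

end FundamentalClass

section HomologyClasses

/-! ### Elements of the homology of a complex of modules -/

namespace HomologyElement

variable {R : Type} [Ring R] {K L : ChainComplex (ModuleCat.{0} R) ℕ} {n : ℕ}

/-- The cycle `z` represents the homology class `h`. -/
def Represents (K : ChainComplex (ModuleCat.{0} R) ℕ) (n : ℕ) (z : K.X n) (h : K.homology n) :
    Prop :=
  ∃ c : K.cycles n, K.iCycles n c = z ∧ K.homologyπ n c = h

lemma exists_represents (h : K.homology n) : ∃ z, Represents K n z h := by
  obtain ⟨c, hc⟩ := (ModuleCat.epi_iff_surjective (K.homologyπ n)).1 inferInstance h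
  exact ⟨_, c, rfl, hc⟩

lemma Represents.d_eq_zero {z : K.X n} {h : K.homology n} (hz : Represents K n z h) (j : ℕ) :
    K.d n j z = 0 := by
  obtain ⟨c, rfl, -⟩ := hz
  rw [← ModuleCat.comp_apply, K.iCycles_d]
  rfl

lemma exists_class {z : K.X n} (hz : ∀ j, K.d n j z = 0) : ∃ h, Represents K n z h := by
  have hex := (ShortComplex.exact_of_f_is_kernel
    (ShortComplex.mk _ _ (K.iCycles_d n ((ComplexShape.down ℕ).next n)))
    (K.cyclesIsKernel n _ rfl))
  obtain ⟨c, hc⟩ := (ShortComplex.moduleCat_exact_iff _).1 hex z (hz _)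
  exact ⟨_, c, hc, rfl⟩

lemma iCycles_injective : Function.Injective (K.iCycles n) :=
  (ModuleCat.mono_iff_injective (K.iCycles n)).1 inferInstance

lemma Represents.add {z z' : K.X n} {h h' : K.homology n} (hz : Represents K n z h)
    (hz' : Represents K n z' h') : Represents K n (z + z') (h + h') := by
  obtain ⟨c, rfl, rfl⟩ := hz
  obtain ⟨c', rfl, rfl⟩ := hz'
  exact ⟨c + c', map_add _ _ _, map_add _ _ _⟩

lemma Represents.eq_zero_iff {z : K.X n} {h : K.homology n} (hz : Represents K n z h) :
    h = 0 ↔ ∃ w : K.X (n + 1), K.d (n + 1) n w = z := by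
  obtain ⟨c, rfl, rfl⟩ := hz
  have hp : (ComplexShape.down ℕ).prev n = n + 1 := (ComplexShape.down ℕ).prev_eq' rfl
  have hex := (ShortComplex.exact_of_g_is_cokernel
    (ShortComplex.mk _ _ (K.toCycles_comp_homologyπ (n + 1) n))
    (K.homologyIsCokernel (n + 1) n hp))
  constructor
  · intro h
    obtain ⟨w, hw⟩ := (ShortComplex.moduleCat_exact_iff _).1 hex c h
    refine ⟨w, ?_⟩
    have hw' : K.toCycles (n + 1) n w = c := hw
    rw [← hw', ← ModuleCat.comp_apply, K.toCycles_i]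
  · rintro ⟨w, hw⟩
    have : K.toCycles (n + 1) n w = c := iCycles_injective (by
      rw [← hw, ← ModuleCat.comp_apply, K.toCycles_i])
    rw [← this, ← ModuleCat.comp_apply, K.toCycles_comp_homologyπ]
    rfl

lemma Represents.map (f : K ⟶ L) {z : K.X n} {h : K.homology n} (hz : Represents K n z h) :
    Represents L n (f.f n z) (HomologicalComplex.homologyMap f n h) := by
  obtain ⟨c, rfl, rfl⟩ := hz
  refine ⟨HomologicalComplex.cyclesMap f n c, ?_, ?_⟩
  · rw [← ModuleCat.comp_apply, HomologicalComplex.cyclesMap_i, ModuleCat.comp_apply]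
  · rw [← ModuleCat.comp_apply, ← HomologicalComplex.homologyπ_naturality, ModuleCat.comp_apply]

lemma cokernel_π_surjective (f : K ⟶ L) (n : ℕ) :
    Function.Surjective ((Limits.cokernel.π f).f n) :=
  (ModuleCat.epi_iff_surjective _).1 inferInstance

lemma cokernel_π_eq_zero_iff (f : K ⟶ L) (n : ℕ) (z : L.X n) :
    (Limits.cokernel.π f).f n z = 0 ↔ ∃ a, f.f n a = z := by
  have hex := (HomologicalComplex.exact_iff_degreewise_exact
    (ShortComplex.mk f (Limits.cokernel.π f) (Limits.cokernel.condition f))).1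
      (ShortComplex.exact_of_g_is_cokernel _ (Limits.cokernelIsCokernel f)) n
  constructor
  · exact (ShortComplex.moduleCat_exact_iff _).1 hex z
  · rintro ⟨a, rfl⟩
    rw [← ModuleCat.comp_apply, ← HomologicalComplex.comp_f, Limits.cokernel.condition]
    rfl

end HomologyElement

/-! ### Comparison of the singular chains -/

namespace SChain

open HomologyElement

variable {X Y : Type} [TopologicalSpace X] [TopologicalSpace Y]

/-- The coefficients. -/
abbrev coeff₂ : ModuleCat.{0} (ZMod 2) := ModuleCat.of (ZMod 2) (ZMod 2)

/-- The simplices of the singular simplicial set are the continuous maps on standard simplices. -/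
def simplexEquiv (X : Type) [TopologicalSpace X] (n : ℕ) :
    (TopCat.toSSet.obj (TopCat.of X)).obj (Opposite.op (SimplexCategory.mk n)) ≃ C(Spx (n + 1), X) :=
  TopCat.toSSetObjEquiv (TopCat.of X) (Opposite.op (SimplexCategory.mk n))

/-- The comparison map from the singular chains. -/
def compare (X : Type) [TopologicalSpace X] (n : ℕ) :
    (singularChains₂.obj (TopCat.of X)).X n ⟶ ModuleCat.of (ZMod 2) (SChain X) :=
  ((TopCat.toSSet.obj (TopCat.of X)).isColimitChainComplexXCofan coeff₂ n).desc
    (Limits.Cofan.mk _ fun σ => ModuleCat.ofHom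
      (LinearMap.toSpanSingleton (ZMod 2) (SChain X) (of (simplexEquiv X n σ))))

/-- The basis chain of a simplex. -/
def basis {n : ℕ} (σ : C(Spx (n + 1), X)) : (singularChains₂.obj (TopCat.of X)).X n :=
  (TopCat.toSSet.obj (TopCat.of X)).ιChainComplex (R := coeff₂) ((simplexEquiv X n).symm σ) (1 : ZMod 2)

lemma compare_basis {n : ℕ} (σ : C(Spx (n + 1), X)) : compare X n (basis σ) = of σ := by
  have h := ((TopCat.toSSet.obj (TopCat.of X)).isColimitChainComplexXCofan coeff₂ n).fac
    (Limits.Cofan.mk _ fun σ => ModuleCat.ofHom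
      (LinearMap.toSpanSingleton (ZMod 2) (SChain X) (of (simplexEquiv X n σ))))
    ⟨(simplexEquiv X n).symm σ⟩
  have h' := congrArg (fun f => f.hom (1 : ZMod 2)) h
  refine h'.trans ?_
  change (1 : ZMod 2) • of (simplexEquiv X n ((simplexEquiv X n).symm σ)) = of σ
  rw [one_smul, Equiv.apply_symm_apply]

lemma chain_hom_ext {n : ℕ} {M : ModuleCat.{0} (ZMod 2)}
    {f g : (singularChains₂.obj (TopCat.of X)).X n ⟶ M}
    (h : ∀ σ : C(Spx (n + 1), X), f (basis σ) = g (basis σ)) : f = g := by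
  refine SSet.chainComplex_hom_ext fun σ => ?_
  refine ModuleCat.hom_ext (LinearMap.ext_ring ?_)
  have := h (simplexEquiv X n σ)
  simp only [basis, Equiv.symm_apply_apply] at this
  exact this

/-- The inverse of the comparison map, on homogeneous chains. -/
def compareInv (X : Type) [TopologicalSpace X] (n : ℕ) :
    SChain X →ₗ[ZMod 2] (singularChains₂.obj (TopCat.of X)).X n :=
  lift fun k σ => if h : k = n + 1 then basis (h ▸ σ) else 0

lemma compareInv_of {n : ℕ} (σ : C(Spx (n + 1), X)) : compareInv X n (of σ) = basis σ := by
  simp [compareInv]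

lemma compareInv_compare {n : ℕ} (x : (singularChains₂.obj (TopCat.of X)).X n) :
    compareInv X n (compare X n x) = x := by
  have : compare X n ≫ ModuleCat.ofHom (compareInv X n) = 𝟙 _ := chain_hom_ext fun σ => by
    rw [ModuleCat.comp_apply, compare_basis]
    exact compareInv_of σ
  exact congrArg (fun f => f.hom x) this

lemma compare_mem_deg {n : ℕ} (x : (singularChains₂.obj (TopCat.of X)).X n) :
    compare X n x ∈ deg X n := by
  have : compare X n ≫ ModuleCat.ofHom (comp n) = compare X n := chain_hom_ext fun σ => by
    rw [ModuleCat.comp_apply, compare_basis]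
    exact comp_eq (of_mem_supp rfl)
  rw [← this]
  exact comp_mem_deg _ _

lemma exists_compare_eq {n : ℕ} {z : SChain X} (hz : z ∈ deg X n) : ∃ x, compare X n x = z := by
  have : deg X n ≤ LinearMap.range (compare X n).hom := supp_induction fun k σ hσ => by
    obtain rfl : k = n + 1 := hσ
    exact ⟨basis σ, compare_basis σ⟩
  exact this hz

lemma compare_injective (X : Type) [TopologicalSpace X] (n : ℕ) :
    Function.Injective (compare X n) :=
  Function.LeftInverse.injective compareInv_compare

lemma compare_map {n : ℕ} (f : C(X, Y)) (x : (singularChains₂.obj (TopCat.of X)).X n) :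
    compare Y n ((singularChains₂.map (TopCat.ofHom f)).f n x) = push f (compare X n x) := by
  have : (singularChains₂.map (TopCat.ofHom f)).f n ≫ compare Y n
      = compare X n ≫ ModuleCat.ofHom (push f) := chain_hom_ext fun σ => by
    rw [ModuleCat.comp_apply, ModuleCat.comp_apply, compare_basis]
    have h := SSet.ι_chainComplexMap_f (R := coeff₂) (f := TopCat.toSSet.map (TopCat.ofHom f)) (x := (simplexEquiv X n).symm σ)
    have h' := congrArg (fun g => g.hom (1 : ZMod 2)) h
    have h'' : (singularChains₂.map (TopCat.ofHom f)).f n (basis σ) = basis (f.comp σ) := by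
      refine h'.trans ?_
      rfl
    rw [h'', compare_basis]
    exact (push_of f σ).symm
  exact congrArg (fun g => g.hom x) this

lemma add_eq_zero_iff_eq₂ {M : Type} [AddCommGroup M] [Module (ZMod 2) M] {x y : M} :
    x + y = 0 ↔ x = y := by
  rw [← ZModModule.sub_eq_add, sub_eq_zero]

lemma neg_one_pow_zsmul {M : Type} [AddCommGroup M] [Module (ZMod 2) M] (k : ℕ) (x : M) :
    (-1 : ℤ) ^ k • x = x := by
  rcases neg_one_pow_eq_or ℤ k with h | h <;> simp [h, ZModModule.neg_eq_self]

lemma affineSimplex_vertex_succAbove {n : ℕ} (i : Fin (n + 1)) (t : Spx n) :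
    affineSimplex (spxVertex ∘ i.succAbove) t = stdSimplex.map i.succAbove t := by
  refine stdSimplex.ext (funext fun j => ?_)
  rw [affineSimplex_apply, coe_comb_spx, stdSimplex.map_coe, FunOnFinite.linearMap_apply_apply]
  simp [spxVertex, stdSimplex.vertex, Pi.single_apply, Finset.sum_ite, eq_comm]

lemma simplexEquiv_δ {n : ℕ} (i : Fin (n + 2)) (σ : C(Spx (n + 2), X)) :
    (TopCat.toSSet.obj (TopCat.of X)).δ i ((simplexEquiv X (n + 1)).symm σ)
      = (simplexEquiv X n).symm (σ.comp (affineSimplex (spxVertex ∘ i.succAbove))) := by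
  rw [Equiv.eq_symm_apply]
  ext t
  change σ (stdSimplex.map _ t) = σ (affineSimplex _ t)
  rw [affineSimplex_vertex_succAbove]
  rfl

lemma compare_d {n : ℕ} (x : (singularChains₂.obj (TopCat.of X)).X (n + 1)) :
    compare X n ((singularChains₂.obj (TopCat.of X)).d (n + 1) n x) = bd (compare X (n + 1) x) := by
  have : (singularChains₂.obj (TopCat.of X)).d (n + 1) n ≫ compare X n
      = compare X (n + 1) ≫ ModuleCat.ofHom bd := chain_hom_ext fun σ => by
    rw [ModuleCat.comp_apply, ModuleCat.comp_apply, compare_basis]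
    have h := SSet.ιChainComplex_d (R := coeff₂) (X := TopCat.toSSet.obj (TopCat.of X))
      ((simplexEquiv X (n + 1)).symm σ)
    have h' := congrArg (fun g => g.hom (1 : ZMod 2)) h
    have h'' : (singularChains₂.obj (TopCat.of X)).d (n + 1) n (basis σ)
        = ∑ i : Fin (n + 2), basis (σ.comp (affineSimplex (spxVertex ∘ i.succAbove))) := by
      refine h'.trans ?_
      simp only [ModuleCat.hom_sum, LinearMap.sum_apply, neg_one_pow_zsmul, simplexEquiv_δ]
      rfl
    rw [h'', map_sum]
    exact (Finset.sum_congr rfl fun i _ => compare_basis _).trans (bd_basis σ).symm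
  exact congrArg (fun g => g.hom x) this

lemma eq_zero_of_mem_deg {n : ℕ} {z : SChain X} (hz : z ∈ deg X n)
    (h : z ∈ chainsIn (∅ : Set X)) : z = 0 := by
  refine Finsupp.support_eq_empty.1 (Finset.eq_empty_of_forall_notMem fun p hp => ?_)
  have h1 : p.1 = n + 1 := hz hp
  have h2 : range p.2 ⊆ ∅ := h hp
  obtain ⟨k, σ⟩ := p
  obtain rfl : k = n + 1 := h1
  exact h2 ⟨spxVertex 0, rfl⟩

/-- Only the empty simplex has empty image, so boundaries in `chainsIn ∅` express cycles of the
unaugmented complex: the condition means zero boundary in positive degrees and is void in degree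
zero. -/
lemma d_eq_zero_of_bd_mem {n : ℕ} {x : (singularChains₂.obj (TopCat.of X)).X n}
    (hx : bd (compare X n x) ∈ chainsIn (∅ : Set X)) (j : ℕ) :
    (singularChains₂.obj (TopCat.of X)).d n j x = 0 := by
  by_cases h : j + 1 = n
  · subst h
    apply compare_injective X j
    rw [compare_d, map_zero]
    exact eq_zero_of_mem_deg (bd_mem_deg (compare_mem_deg x)) hx
  · rw [(singularChains₂.obj (TopCat.of X)).shape n j h]
    rfl

lemma bd_mem_of_d_eq_zero {n : ℕ} {x : (singularChains₂.obj (TopCat.of X)).X n}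
    (hx : ∀ j, (singularChains₂.obj (TopCat.of X)).d n j x = 0) :
    bd (compare X n x) ∈ chainsIn (∅ : Set X) := by
  rcases n with _ | n
  · refine map_mem_of_supp bd (fun k σ hσ => ?_) (compare_mem_deg x)
    obtain rfl : k = 1 := hσ
    rw [bd_basis]
    refine Submodule.sum_mem _ fun i _ => of_mem_supp ?_
    rintro _ ⟨t, rfl⟩
    exact absurd t.2.2 (by simp)
  · rw [← compare_d, hx, map_zero]
    exact Submodule.zero_mem _

/-- The chain `z` represents the singular homology class `h`. -/
def IsClass (n : ℕ) (z : SChain X) (h : singularHomology₂ n X) : Prop :=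
  ∃ x, compare X n x = z ∧ Represents (singularChains₂.obj (TopCat.of X)) n x h

variable {n : ℕ} {z z' : SChain X} {h h' : singularHomology₂ n X}

lemma exists_isClass (h : singularHomology₂ n X) : ∃ z, IsClass n z h := by
  obtain ⟨x, hx⟩ := exists_represents h
  exact ⟨_, x, rfl, hx⟩

lemma IsClass.mem_relCycles (hz : IsClass n z h) : z ∈ relCycles n (univ : Set X) := by
  obtain ⟨x, rfl, hx⟩ := hz
  refine ⟨compare_mem_deg x, ?_⟩
  rw [compl_univ]
  exact bd_mem_of_d_eq_zero hx.d_eq_zero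

lemma exists_isClass_of_mem (hz : z ∈ relCycles n (univ : Set X)) : ∃ h, IsClass n z h := by
  obtain ⟨x, rfl⟩ := exists_compare_eq hz.1
  have hb : bd (compare X n x) ∈ chainsIn (univ : Set X)ᶜ := hz.2
  rw [compl_univ] at hb
  obtain ⟨h, hh⟩ := exists_class (d_eq_zero_of_bd_mem hb)
  exact ⟨h, x, rfl, hh⟩

lemma IsClass.add (hz : IsClass n z h) (hz' : IsClass n z' h') : IsClass n (z + z') (h + h') := by
  obtain ⟨x, rfl, hx⟩ := hz
  obtain ⟨x', rfl, hx'⟩ := hz'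
  exact ⟨x + x', map_add _ _ _, hx.add hx'⟩

lemma IsClass.eq_zero_iff (hz : IsClass n z h) : h = 0 ↔ z ∈ nulls (univ : Set X) := by
  obtain ⟨x, rfl, hx⟩ := hz
  rw [hx.eq_zero_iff]
  constructor
  · rintro ⟨w, rfl⟩
    rw [compare_d]
    exact bd_mem_nulls _ _
  · intro hn
    obtain ⟨w, hw, e⟩ := exists_deg_of_mem_nulls (compare_mem_deg x) hn
    obtain ⟨w, rfl⟩ := exists_compare_eq hw
    refine ⟨w, compare_injective X n ?_⟩
    rw [compl_univ] at e
    have := eq_zero_of_mem_deg (Submodule.add_mem _ (compare_mem_deg x) (bd_mem_deg hw)) e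
    rw [compare_d]
    exact (add_eq_zero_iff_eq₂.1 this).symm

lemma IsClass.eq_iff (hz : IsClass n z h) (hz' : IsClass n z' h') :
    h = h' ↔ z + z' ∈ nulls (univ : Set X) := by
  rw [← (hz.add hz').eq_zero_iff]
  exact add_eq_zero_iff_eq₂.symm

lemma IsClass.push (f : C(X, Y)) (hz : IsClass n z h) :
    IsClass n (push f z) (homologyPush₂ n f h) := by
  obtain ⟨x, rfl, hx⟩ := hz
  exact ⟨_, compare_map f x, hx.map _⟩

lemma compare_map_mem {A : Set X} (a : (singularChains₂.obj (TopCat.of A)).X n) :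
    compare X n ((singularChains₂.map (TopCat.ofHom (inclusionMap A))).f n a) ∈ chainsIn A := by
  rw [compare_map]
  refine chainsIn_mono ?_ (push_mem_range _ _)
  rintro _ ⟨y, rfl⟩
  exact y.2

lemma exists_compare_map_eq {A : Set X} {c : SChain X} (hc : c ∈ chainsIn A) (hd : c ∈ deg X n) :
    ∃ a, compare X n ((singularChains₂.map (TopCat.ofHom (inclusionMap A))).f n a) = c := by
  obtain ⟨b, rfl⟩ := exists_push_eq (f := inclusionMap A) Topology.IsEmbedding.subtypeVal
    (chainsIn_mono (Subtype.range_val (s := A)).ge hc)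
  obtain ⟨a, rfl⟩ := exists_compare_eq ((push_mem_deg_iff (f := inclusionMap A)
    Subtype.val_injective).1 hd)
  exact ⟨a, compare_map _ _⟩

/-- In the quotient complex a cycle bounds exactly when, upstairs, it differs from a boundary by a
chain of the subspace. This uses that the cokernel of complexes is computed degreewise. -/
lemma IsClass.toRelative_eq_zero_iff (A : Set X) (hz : IsClass n z h) :
    toRelativeHomology₂ n Aᶜ h = 0 ↔ z ∈ nulls A := by
  obtain ⟨x, rfl, hx⟩ := hz
  set i := singularChains₂.map (TopCat.ofHom (inclusionMap Aᶜ)) with hi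
  have hr := hx.map (Limits.cokernel.π i)
  refine (hr.eq_zero_iff).trans ?_
  constructor
  · rintro ⟨w, hw⟩
    obtain ⟨w, rfl⟩ := cokernel_π_surjective i (n + 1) w
    rw [← ModuleCat.comp_apply, HomologicalComplex.Hom.comm, ModuleCat.comp_apply, ← sub_eq_zero,
      ← map_sub, cokernel_π_eq_zero_iff] at hw
    obtain ⟨a, ha⟩ := hw
    refine mem_nulls_iff.2 ⟨compare X (n + 1) w, ?_⟩
    have := compare_map_mem a
    rw [← hi, ha, map_sub, compare_d, ZModModule.sub_eq_add, add_comm] at this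
    exact this
  · intro hn
    obtain ⟨w, hw, e⟩ := exists_deg_of_mem_nulls (compare_mem_deg x) hn
    obtain ⟨w, rfl⟩ := exists_compare_eq hw
    obtain ⟨a, ha⟩ := exists_compare_map_eq e
      (Submodule.add_mem _ (compare_mem_deg x) (bd_mem_deg hw))
    refine ⟨(Limits.cokernel.π i).f (n + 1) w, ?_⟩
    rw [← ModuleCat.comp_apply, HomologicalComplex.Hom.comm, ModuleCat.comp_apply, ← sub_eq_zero,
      ← map_sub, cokernel_π_eq_zero_iff]
    refine ⟨a, compare_injective X n ?_⟩
    rw [hi, ha, map_sub, compare_d, ZModModule.sub_eq_add, add_comm]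

lemma IsClass.isFundamentalClass_iff (hz : IsClass n z h) :
    IsFundamentalClass₂ n h ↔ ∀ x, z ∉ nulls {x} :=
  forall_congr' fun x => not_congr (hz.toRelative_eq_zero_iff {x})

end SChain

end HomologyClasses

/-! ### Euclidean neighbourhoods of interior points -/

section InteriorCharts

variable {E : Type} [NormedAddCommGroup E] [NormedSpace ℝ E] [FiniteDimensional ℝ E]
  {H : Type} [TopologicalSpace H] {I : ModelWithCorners ℝ E H} {M : Type} [TopologicalSpace M]
  [ChartedSpace H M]

/-- An interior point of a manifold has arbitrarily small neighbourhoods which are homeomorphic to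
the Euclidean space. -/
theorem ModelWithCorners.IsInteriorPoint.exists_isOpenEmbedding {m : ℕ} (hm : finrank ℝ E = m)
    {x : M} (hx : I.IsInteriorPoint x) {S : Set M} (hS : IsOpen S) (hxS : x ∈ S) :
    ∃ j : C(EuclideanSpace ℝ (Fin m), M), Topology.IsOpenEmbedding j ∧ x ∈ range j ∧
      range j ⊆ S := by
  set φ := extChartAt I x with hφ
  have hcont : ContinuousAt φ.symm (φ x) := continuousAt_extChartAt_symm x
  have h1 : φ.target ∈ nhds (φ x) := by
    have := extChartAt_target_mem_nhdsWithin (I := I) x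
    rwa [nhdsWithin_eq_nhds.2 (mem_interior_iff_mem_nhds.1 hx)] at this
  have h2 : φ.symm ⁻¹' S ∈ nhds (φ x) :=
    hcont.preimage_mem_nhds (by rw [extChartAt_to_inv]; exact hS.mem_nhds hxS)
  obtain ⟨r, hr, hball⟩ := Metric.mem_nhds_iff.1 (Filter.inter_mem h1 h2)
  have hb1 : Metric.ball (φ x) r ⊆ φ.target := fun y hy => (hball hy).1
  let e : EuclideanSpace ℝ (Fin m) ≃L[ℝ] E := ContinuousLinearEquiv.ofFinrankEq (by simp [hm])
  -- This maps all of `E` homeomorphically onto the ball, so the resulting parametrisation is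
  -- defined on the whole Euclidean space.
  let u : E → E := OpenPartialHomeomorph.univBall (φ x) r
  have hu : ∀ v, u v ∈ Metric.ball (φ x) r := fun v => by
    have := (OpenPartialHomeomorph.univBall (φ x) r).map_source (x := v) (by simp)
    rwa [OpenPartialHomeomorph.univBall_target _ hr] at this
  have hucont : Continuous u := OpenPartialHomeomorph.continuous_univBall (φ x) r
  have huo : Topology.IsOpenEmbedding u :=
    (OpenPartialHomeomorph.univBall (φ x) r).isOpenEmbedding (by simp)
  have hc : Continuous fun v => φ.symm (u (e v)) :=
    (continuousOn_extChartAt_symm x).comp_continuous (hucont.comp e.continuous)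
      fun v => hb1 (hu _)
  refine ⟨⟨_, hc⟩, .of_continuous_injective_isOpenMap hc ?_ ?_, ?_, ?_⟩
  · intro v w h
    exact e.injective (huo.injective (φ.symm.injOn (hb1 (hu _)) (hb1 (hu _)) h))
  · intro W hW
    have h3 : IsOpen ((u ∘ e) '' W) := by
      rw [image_comp]
      exact huo.isOpenMap _ (e.toHomeomorph.isOpenMap _ hW)
    have h4 : (fun v => φ.symm (u (e v))) '' W = φ.source ∩ φ ⁻¹' ((u ∘ e) '' W) := by
      have : (fun v => φ.symm (u (e v))) '' W = φ.symm '' ((u ∘ e) '' W) := by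
        rw [← image_comp]; rfl
      rw [this, φ.symm_image_eq_source_inter_preimage]
      rintro _ ⟨v, -, rfl⟩
      exact hb1 (hu _)
    exact h4 ▸ (continuousOn_extChartAt x).isOpen_inter_preimage (isOpen_extChartAt_source x) h3
  · refine ⟨e.symm 0, ?_⟩
    change φ.symm (u (e (e.symm 0))) = x
    rw [e.apply_symm_apply]
    change φ.symm (OpenPartialHomeomorph.univBall (φ x) r 0) = x
    rw [OpenPartialHomeomorph.univBall_apply_zero, hφ, extChartAt_to_inv]
  · rintro _ ⟨v, rfl⟩
    exact (hball (hu (e v))).2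

theorem LocallyEuclidean.of_boundaryless [I.Boundaryless] {m : ℕ} (hm : finrank ℝ E = m) :
    SChain.LocallyEuclidean m M := fun x => by
  obtain ⟨j, hj, hx, -⟩ := (BoundarylessManifold.isInteriorPoint (I := I) (x := x)
    ).exists_isOpenEmbedding hm isOpen_univ (mem_univ x)
  exact ⟨j, hj, hx⟩

theorem SChain.LocallyEuclidean.of_homeomorph {m : ℕ} {X Y : Type} [TopologicalSpace X]
    [TopologicalSpace Y] (e : X ≃ₜ Y) (hX : SChain.LocallyEuclidean m X) :
    SChain.LocallyEuclidean m Y := fun y => by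
  obtain ⟨j, hj, v, hv⟩ := hX (e.symm y)
  exact ⟨(⟨e, e.continuous⟩ : C(X, Y)).comp j, e.isOpenEmbedding.comp hj, v,
    by simp [hv]⟩

end InteriorCharts

/-! ### Fundamental classes of closed submanifolds -/

section ClosedSubmanifold

variable {E : Type} [NormedAddCommGroup E] [NormedSpace ℝ E]
  {H : Type} [TopologicalSpace H] {I : ModelWithCorners ℝ E H} {M : Type} [TopologicalSpace M]
  [ChartedSpace H M] {n : ℕ} {L : Set M}

/-- The presentation of a closed submanifold as a homeomorphism onto the subset. -/
def ClosedSubmanifold.homeomorph (P : ClosedSubmanifold I n L) : P.N ≃ₜ L :=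
  P.isSmoothEmbedding.isEmbedding.toHomeomorph.trans (Homeomorph.setCongr P.range_eq)

theorem ClosedSubmanifold.compactSpace (P : ClosedSubmanifold I n L) : CompactSpace L :=
  P.homeomorph.compactSpace

theorem ClosedSubmanifold.locallyEuclidean (P : ClosedSubmanifold I n L) :
    SChain.LocallyEuclidean n L :=
  .of_homeomorph P.homeomorph (LocallyEuclidean.of_boundaryless (I := P.model) P.finrank_eq)

theorem ClosedSubmanifold.t2Space (P : ClosedSubmanifold I n L) : T2Space L :=
  P.homeomorph.t2Space

/-- A closed submanifold represents a class. -/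
theorem ClosedSubmanifold.exists_representsClass (P : ClosedSubmanifold I n L) :
    ∃ a, RepresentsClass₂ n L a := by
  have := P.compactSpace
  have := P.t2Space
  obtain ⟨z, hz, hz0⟩ := P.locallyEuclidean.hasFundamental (isCompact_univ (X := L))
  obtain ⟨h, hh⟩ := SChain.exists_isClass_of_mem hz
  exact ⟨_, h, hh.isFundamentalClass_iff.2 fun x => hz0 x (mem_univ x), rfl⟩

end ClosedSubmanifold

/-! ### Cobordisms with cylindrical ends -/

section CylindricalEnds

namespace SChain

/-- Simplices are connected, so each one lies in a single piece and no subdivision is needed. -/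
lemma chainsIn_union_le {X : Type} [TopologicalSpace X] {U V : Set X} (hU : IsOpen U)
    (hV : IsOpen V) (hUV : Disjoint U V) : chainsIn (U ∪ V) ≤ chainsIn U ⊔ chainsIn V :=
  supp_induction fun n σ hσ => by
    have : PreconnectedSpace (Spx n) :=
      Subtype.preconnectedSpace (convex_stdSimplex ℝ (Fin n)).isPreconnected
    rcases (isPreconnected_range σ.continuous).subset_or_subset hU hV hUV hσ with h | h
    · exact Submodule.mem_sup_left (of_mem_chainsIn_iff.2 h)
    · exact Submodule.mem_sup_right (of_mem_chainsIn_iff.2 h)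

variable {M : Type} [TopologicalSpace M] {T : Set ((ℝ × ℝ) × M)} {L : Set M} {δ ε : ℝ}

/-- The projection of a subset of the product with the plane. -/
def toBase (T : Set ((ℝ × ℝ) × M)) : C(T, M) := ⟨fun p => p.1.2, by fun_prop⟩

/-- If a chain `z` in a set with a cylindrical end `(0, ε) × {0} × L` represents the generator of
the local homology at every point over `δ < ε`, then the part of its boundary in the end is a
fundamental cycle of `L`. -/
theorem exists_fundamental_of_cylindrical_end (hδ : 0 < δ) (hδε : δ < ε)
    (hT : ∀ p : (ℝ × ℝ) × M, 0 < p.1.1 → p.1.1 < ε → (p ∈ T ↔ p.1.2 = 0 ∧ p.2 ∈ L))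
    (hpos : ∀ p ∈ T, 0 < p.1.1) {n : ℕ} {z u v : SChain T} (hz : bd z = u + v)
    (hu : u ∈ chainsIn {p : T | p.1.1.1 < δ}) (hv : v ∈ chainsIn {p : T | δ < p.1.1.1})
    (hn : u ∈ deg T n) (h0 : ∀ p : T, p.1.1.1 = δ → z ∉ nulls {p}) :
    ∃ w : SChain L, w ∈ relCycles n (univ : Set L) ∧
      push (inclusionMap L) w = push (toBase T) u ∧ ∀ y, w ∉ nulls {y} := by
  set G : Set T := {p : T | p.1.1.1 < δ} with hG
  -- The boundaries of `u` and `v` coincide, although they lie in disjoint regions.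
  have hub : bd u ∈ chainsIn (∅ : Set T) := by
    have h := congrArg bd hz
    rw [bd_bd, map_add] at h
    have h' : bd u = bd v := add_eq_zero_iff_eq₂.1 h.symm
    refine chainsIn_mono ?_ (mem_chainsIn_inter (bd_mem hu) (h' ▸ bd_mem hv))
    rintro p ⟨h1, h2⟩
    exact (lt_asymm (show p.1.1.1 < δ from h1) h2).elim
  have hι : Topology.IsEmbedding (inclusionMap G) := Topology.IsEmbedding.subtypeVal
  obtain ⟨uG, rfl⟩ := exists_push_eq hι (c := u) (by
    rw [show range (inclusionMap G) = G from Subtype.range_val]; exact hu)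
  have hGL : ∀ p : G, p.1.1.1.2 = 0 ∧ p.1.1.2 ∈ L := fun p =>
    (hT p.1.1 (hpos _ p.1.2) (lt_trans p.2 hδε)).1 p.1.2
  let ρ : C(G, L) := ⟨fun p => ⟨p.1.1.2, (hGL p).2⟩, by fun_prop⟩
  have hbG : bd uG ∈ chainsIn (∅ : Set G) := by
    rw [← push_bd, push_mem_iff hι.injective] at hub
    exact hub
  refine ⟨push ρ uG, ⟨push_mem_deg _ ((push_mem_deg_iff hι.injective).1 hn), ?_⟩, ?_, ?_⟩
  · change bd _ ∈ chainsIn _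
    rw [← push_bd]
    exact push_mem (fun _ h => h.elim) hbG
  · rw [push_push, push_push]
    rfl
  -- Suppose the projected cycle is null at `y`. The aim is to make `z` null at the point over `y`
  -- at height `δ`.
  intro y hy
  obtain ⟨w, hw⟩ := mem_nulls_iff.1 hy
  let s : C(L, G) := ⟨fun y => ⟨⟨((δ / 2, 0), y.1),
    (hT _ (half_pos hδ) ((half_lt_self hδ).trans hδε)).2 ⟨rfl, y.2⟩⟩, half_lt_self hδ⟩, by
      fun_prop⟩
  have hx : ∀ q : G × unitInterval, 0 < (1 - (q.2 : ℝ)) * q.1.1.1.1.1 + q.2 * (δ / 2) ∧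
      (1 - (q.2 : ℝ)) * q.1.1.1.1.1 + q.2 * (δ / 2) < δ := by
    rintro ⟨p, t, ht0, ht1⟩
    have h1 : 0 < p.1.1.1.1 := hpos _ p.1.2
    have h2 : p.1.1.1.1 < δ := p.2
    dsimp only
    rcases eq_or_lt_of_le ht0 with rfl | ht
    · constructor <;> linarith
    · constructor
      · have := mul_nonneg (sub_nonneg.2 ht1) h1.le
        have := mul_pos ht (half_pos hδ)
        linarith
      · have := mul_le_mul_of_nonneg_left h2.le (sub_nonneg.2 ht1)
        have := mul_lt_mul_of_pos_left (half_lt_self hδ) ht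
        linarith
  let F : C(G × unitInterval, G) := ⟨fun q =>
    ⟨⟨(((1 - (q.2 : ℝ)) * q.1.1.1.1.1 + q.2 * (δ / 2), q.1.1.1.1.2), q.1.1.1.2),
      (hT _ (hx q).1 ((hx q).2.trans hδε)).2 (hGL q.1)⟩, (hx q).2⟩, by fun_prop⟩
  have hF0 : ∀ p, F (p, 0) = p := fun p => by
    apply Subtype.ext; apply Subtype.ext
    simp [F]
  have hF1 : slice F 1 = s.comp ρ := by
    ext1 p
    apply Subtype.ext; apply Subtype.ext
    change (((1 - ((1 : unitInterval) : ℝ)) * p.1.1.1.1 + ((1 : unitInterval) : ℝ) * (δ / 2),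
      p.1.1.1.2), p.1.1.2) = ((δ / 2, 0), p.1.1.2)
    rw [(hGL p).1]
    simp
  have e := add_push_slice F hF0 uG
  rw [hF1, ← push_push] at e
  -- The first term slides the end cycle to the slice at height `δ / 2`; the second is the assumed
  -- bounding chain placed in that slice. With both, the cycle leaves the fibre over `y`.
  set q : SChain G := htpy F uG + push s w with hq
  have hq1 : uG + bd q ∈ chainsIn {p : G | p.1.1.2 ≠ y.1} := by
    have e1 : uG + bd q = htpy F (bd uG) + push s (push ρ uG + bd w) := by
      rw [hq, map_add, map_add, push_bd, ← add_assoc, eq_add_of_add_eq e]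
      abel
    rw [e1]
    refine Submodule.add_mem _ (htpy_mem (B := ∅) F (fun _ h => h.elim) hbG) (push_mem ?_ hw)
    intro y' hy' h
    exact hy' (Subtype.ext h)
  set Q : SChain T := push (inclusionMap G) q with hQ
  have hQ1 : push (inclusionMap G) uG + bd Q ∈ chainsIn {p : T | p.1.2 ≠ y.1} := by
    rw [hQ, ← push_bd, ← map_add]
    exact push_mem (fun p hp => hp) hq1
  have hQ2 : Q ∈ chainsIn G := chainsIn_mono (by
    rintro _ ⟨p, rfl⟩
    exact p.2) (push_mem_range _ q)
  set B : Set T := {p : T | δ < p.1.1.1 ∨ p.1.2 ≠ y.1} with hB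
  have hzB : bd (z + Q) ∈ chainsIn B := by
    rw [map_add, hz, add_right_comm]
    exact Submodule.add_mem _ (chainsIn_mono (fun p hp => Or.inr hp) hQ1)
      (chainsIn_mono (fun p hp => Or.inl hp) hv)
  -- A height strictly above `δ` at which the set is still cylindrical.
  set η : ℝ := (δ + ε) / 2 with hη
  have hδη : δ < η := by rw [hη]; linarith
  have hηε : η < ε := by rw [hη]; linarith
  have hmax : ∀ q : T × unitInterval,
      ((max q.1.1.1.1 (q.2 * η), q.1.1.1.2), q.1.1.2) ∈ T := by
    rintro ⟨p, t, ht0, ht1⟩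
    dsimp only
    -- Only points below height `ε` are moved, and there the set is a product, so they stay in it.
    rcases le_or_gt (t * η) p.1.1.1 with h | h
    · rw [max_eq_left h]
      exact p.2
    · have h1 := hpos _ p.2
      have h2 : t * η ≤ η := mul_le_of_le_one_left (hδ.trans hδη).le ht1
      rw [max_eq_right h.le]
      exact (hT _ (h1.trans h) (h2.trans_lt hηε)).2
        ((hT _ h1 (h.trans (h2.trans_lt hηε))).1 p.2)
  -- Raising all points to height at least `η > δ` preserves `B` and ends in `B`. Since neither `B`
  -- nor the region of `Q` contains the chosen point at height `δ`, the chain `z` is null there.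
  obtain ⟨Y, hY⟩ := exists_add_bd_mem_of_homotopy (B := B) (D := univ) (z := z + Q)
    ⟨fun q : T × unitInterval => ⟨((max q.1.1.1.1 (q.2 * η), q.1.1.1.2), q.1.1.2), hmax q⟩,
      by fun_prop⟩
    (fun p => Subtype.ext (by simp [(hpos _ p.2).le]))
    (fun p hp t => hp.imp (fun h => lt_max_of_lt_left h) id)
    (fun p _ => Or.inl (lt_max_of_lt_right (by simpa using hδη)))
    (mem_chainsIn_univ _) hzB
  let p : T := ⟨((δ, 0), y.1), (hT _ hδ hδε).2 ⟨rfl, y.2⟩⟩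
  refine h0 p rfl (mem_nulls_iff.2 ⟨Y, ?_⟩)
  have e2 : z + bd Y = (z + Q + bd Y) + Q := by
    have : z + Q + bd Y + Q = z + bd Y + (Q + Q) := by abel
    rw [this, ZModModule.add_self, add_zero]
  rw [e2]
  refine Submodule.add_mem _ (chainsIn_mono ?_ hY) (chainsIn_mono ?_ hQ2)
  · rintro p' hp' rfl
    exact hp'.elim (lt_irrefl _) fun h => h rfl
  · rintro p' hp' rfl
    exact lt_irrefl _ (show δ < δ from hp')

end SChain

end CylindricalEnds

/-! ### Lagrangian cobordant submanifolds are homologous modulo two -/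

section LagrangianCobordant

namespace SChain

variable {M : Type} [TopologicalSpace M]

/-- The reflection of the plane that exchanges the two ends of the strip. -/
def stripReflection (M : Type) [TopologicalSpace M] : ((ℝ × ℝ) × M) ≃ₜ ((ℝ × ℝ) × M) where
  toFun p := ((1 - p.1.1, p.1.2), p.2)
  invFun p := ((1 - p.1.1, p.1.2), p.2)
  left_inv p := by simp
  right_inv p := by simp

/-- A set over the strip with cylindrical ends `L` and `L'` gives a homology between them, if it
has a fundamental class along its compact parts. -/
theorem homologous_of_cylindrical_ends [T2Space M] {T : Set ((ℝ × ℝ) × M)} {L L' : Set M} {δ ε : ℝ}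
    (hδ : 0 < δ) (hδε : δ < ε) (hε : ε ≤ 1 / 2)
    (hT : ∀ p : (ℝ × ℝ) × M, 0 < p.1.1 → p.1.1 < ε → (p ∈ T ↔ p.1.2 = 0 ∧ p.2 ∈ L))
    (hT' : ∀ p : (ℝ × ℝ) × M, 1 - ε < p.1.1 → p.1.1 < 1 → (p ∈ T ↔ p.1.2 = 0 ∧ p.2 ∈ L'))
    (hpos : ∀ p ∈ T, 0 < p.1.1 ∧ p.1.1 < 1) {n : ℕ}
    (hf : HasFundamental (n + 1) {p : T | δ ≤ p.1.1.1 ∧ p.1.1.1 ≤ 1 - δ}) :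
    Homologous₂ n L L' := by
  obtain ⟨z, hz, hz0⟩ := hf
  have hx : Continuous fun p : T => p.1.1.1 := by fun_prop
  have hzb : bd z ∈ chainsIn ({p : T | p.1.1.1 < δ} ∪ {p : T | 1 - δ < p.1.1.1}) :=
    chainsIn_mono (fun p hp => by
      rcases lt_or_ge p.1.1.1 δ with h | h
      · exact Or.inl h
      · exact Or.inr (lt_of_not_ge fun h' => hp ⟨h, h'⟩)) hz.2
  -- The boundary of `z` misses the slab, and the two ends that remain are disjoint because `δ < 1 /
  -- 2`.
  obtain ⟨u, hu, v, hv, huv⟩ := Submodule.mem_sup.1 (chainsIn_union_le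
    (isOpen_lt hx continuous_const) (isOpen_lt continuous_const hx)
    (disjoint_left.2 fun p (h1 : p.1.1.1 < δ) (h2 : 1 - δ < p.1.1.1) => by linarith) hzb)
  have hn := bd_mem_deg hz.1
  have hab : bd z = comp n u + comp n v := by rw [← map_add, huv, comp_eq hn]
  replace hu := comp_mem n hu
  replace hv := comp_mem n hv
  have hun := comp_mem_deg n u
  have hvn := comp_mem_deg n v
  generalize comp n u = a at *
  generalize comp n v = b at *
  obtain ⟨w, hw, hwa, hw0⟩ := exists_fundamental_of_cylindrical_end hδ hδε hT
    (fun p hp => (hpos p hp).1) hab hu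
    (chainsIn_mono (B := {p : T | 1 - δ < p.1.1.1}) (fun p hp => by
      rw [mem_ofPred_eq] at hp ⊢; linarith) hv) hun
    (fun p hp => hz0 p ⟨hp.ge, by rw [hp]; linarith⟩)
  -- Reflection exchanges the ends, so the statement for the left end applies to the right one with
  -- the roles of `a` and `b` exchanged.
  set r := stripReflection M
  set T' : Set ((ℝ × ℝ) × M) := r.symm ⁻¹' T with hTT'
  let e : T ≃ₜ T' := r.sets (by ext p; simp [hTT'])
  let f : C(T, T') := ⟨e, e.continuous⟩
  have hfx : ∀ p, (f p).1.1.1 = 1 - p.1.1.1 := fun p => rfl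
  obtain ⟨w', hw', hwa', hw0'⟩ := exists_fundamental_of_cylindrical_end (T := T') (L := L')
    (z := push f z) (u := push f b) (v := push f a) hδ hδε
    (fun p h1 h2 => hT' (r.symm p) (show 1 - ε < 1 - p.1.1 by linarith)
      (show 1 - p.1.1 < 1 by linarith))
    (fun p hp => sub_pos.1 (by
      have := (hpos _ hp).2
      have : 1 - p.1.1 < 1 := this
      linarith))
    (by rw [← push_bd, hab, map_add, add_comm])
    (push_mem (B := {p : T | 1 - δ < p.1.1.1}) (fun p hp => by
      rw [mem_ofPred_eq] at hp ⊢; rw [hfx]; linarith) hv)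
    (push_mem (B := {p : T | p.1.1.1 < δ}) (fun p hp => by
      rw [mem_ofPred_eq] at hp ⊢; rw [hfx]; linarith) hu)
    (push_mem_deg f hvn)
    (fun p hp => by
      obtain ⟨p, rfl⟩ := e.surjective p
      have hp' : 1 - p.1.1.1 = δ := hp
      have := mem_nulls_push_iff (j := f) e.isOpenEmbedding (A := {p}) (by simp) (z := z)
      rw [image_singleton] at this
      exact mt this.1 (hz0 p ⟨by linarith, by linarith⟩))
  have hbase : (toBase T').comp f = toBase T := rfl
  rw [push_push, hbase] at hwa'
  obtain ⟨h, hh⟩ := exists_isClass_of_mem hw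
  obtain ⟨h', hh'⟩ := exists_isClass_of_mem hw'
  refine ⟨_, ⟨h, hh.isFundamentalClass_iff.2 hw0, rfl⟩, h', hh'.isFundamentalClass_iff.2 hw0', ?_⟩
  -- The sum of the two pushed fundamental cycles is the projection of `bd z`, hence a boundary in
  -- `M`.
  rw [eq_comm, (hh.push _).eq_iff (hh'.push _), hwa, hwa', ← map_add, ← hab, push_bd]
  exact bd_mem_nulls _ _

end SChain

variable {E : Type} [NormedAddCommGroup E] [NormedSpace ℝ E] {H : Type} [TopologicalSpace H]
  {I : ModelWithCorners ℝ E H} {M : Type} [TopologicalSpace M] [ChartedSpace H M]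

/-- The boundary of `V` lies over the end points of the strip, so the part over `0 < x < 1` consists
of interior points and is locally Euclidean; compactness of `V` makes the middle slab compact. -/
theorem LagrangianCobordant.homologous [T2Space M] {Ω : TwoForm I M} {n : ℕ} {L L' : Set M}
    (h : LagrangianCobordant Ω n L L') : Homologous₂ n L L' := by
  obtain ⟨V, _, _, _, _, _, i, hi, -, h01, hbd, ε', hε', hl, hr⟩ := h
  have hemb := hi.isEmbedding
  -- The bound by `1 / 2` keeps the two cylindrical ends apart.
  set ε : ℝ := min ε' (1 / 2) with hε
  have hεpos : 0 < ε := lt_min hε' one_half_pos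
  have hεε' : ε ≤ ε' := min_le_left _ _
  have hε2 : ε ≤ 1 / 2 := min_le_right _ _
  set T : Set ((ℝ × ℝ) × M) := range i ∩ {p | 0 < p.1.1 ∧ p.1.1 < 1} with hTdef
  have hS : IsOpen {v : V | 0 < (i v).1.1 ∧ (i v).1.1 < 1} := by
    have hc : Continuous fun v => (i v).1.1 := by
      have := hemb.continuous
      fun_prop
    exact (isOpen_lt continuous_const hc).inter (isOpen_lt hc continuous_const)
  have hTeucl : SChain.LocallyEuclidean (n + 1) T := by
    rintro ⟨_, ⟨v, rfl⟩, hv⟩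
    have hint : (𝓡∂ (n + 1)).IsInteriorPoint v := by
      rw [ModelWithCorners.isInteriorPoint_iff_not_isBoundaryPoint]
      intro hb
      have : i v ∈ i '' (𝓡∂ (n + 1)).boundary V := ⟨v, hb, rfl⟩
      rw [hbd] at this
      rcases this with ⟨h, -⟩ | ⟨h, -⟩
      · exact hv.1.ne' (congrArg Prod.fst (mem_singleton_iff.1 h))
      · exact hv.2.ne (congrArg Prod.fst (mem_singleton_iff.1 h))
    obtain ⟨j, hj, hvj, hjS⟩ := hint.exists_isOpenEmbedding (m := n + 1) (by simp) hS hv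
    have hjT : ∀ x, i (j x) ∈ T := fun x => ⟨mem_range_self _, hjS (mem_range_self x)⟩
    refine ⟨⟨fun x => ⟨i (j x), hjT x⟩, (hemb.continuous.comp j.continuous).subtype_mk _⟩,
      ⟨(hemb.comp hj.isEmbedding).codRestrict T hjT, ?_⟩, ?_⟩
    · obtain ⟨O, hO, hOj⟩ := hemb.isInducing.isOpen_iff.1 hj.isOpen_range
      convert hO.preimage (continuous_subtype_val (p := (· ∈ T))) using 1
      ext p
      obtain ⟨w, hw⟩ := p.2.1
      constructor
      · rintro ⟨x, rfl⟩
        exact hOj.ge ⟨x, rfl⟩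
      · intro h
        obtain ⟨x, rfl⟩ := hOj.le (show i w ∈ O by rw [hw]; exact h)
        exact ⟨x, Subtype.ext hw⟩
    · obtain ⟨x, hx⟩ := hvj
      exact ⟨x, Subtype.ext (congrArg i hx)⟩
  have hK : IsCompact {p : T | ε / 2 ≤ p.1.1.1 ∧ p.1.1.1 ≤ 1 - ε / 2} := by
    rw [Topology.IsEmbedding.subtypeVal.isCompact_iff]
    have : Subtype.val '' {p : T | ε / 2 ≤ p.1.1.1 ∧ p.1.1.1 ≤ 1 - ε / 2}
        = i '' {v : V | ε / 2 ≤ (i v).1.1 ∧ (i v).1.1 ≤ 1 - ε / 2} := by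
      ext p
      constructor
      · rintro ⟨⟨_, ⟨v, rfl⟩, hv⟩, hp, rfl⟩
        exact ⟨v, hp, rfl⟩
      · rintro ⟨v, hv, rfl⟩
        exact ⟨⟨i v, ⟨v, rfl⟩, by linarith [hv.1], by linarith [hv.2]⟩, hv, rfl⟩
    rw [this]
    have hc : Continuous fun v => (i v).1.1 := by
      have := hemb.continuous
      fun_prop
    exact ((isClosed_le continuous_const hc).inter
      (isClosed_le hc continuous_const)).isCompact.image hemb.continuous
  refine SChain.homologous_of_cylindrical_ends (T := T) (half_pos hεpos) (half_lt_self hεpos) hε2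
    (fun p h1 h2 => ?_) (fun p h1 h2 => ?_) (fun p hp => hp.2) (hTeucl.hasFundamental hK)
  · have h3 : p ∈ range i ↔ p ∈ range i ∩ {p | p.1.1 ∈ Ico 0 ε'} :=
      ⟨fun h => ⟨h, h1.le, h2.trans_le hεε'⟩, fun h => h.1⟩
    have h4 : p ∈ T ↔ p ∈ range i := ⟨fun h => h.1, fun h => ⟨h, h1, by linarith⟩⟩
    rw [h4, h3, hl]
    exact ⟨fun h => ⟨h.1.2, h.2⟩, fun h => ⟨⟨⟨h1.le, h2.trans_le hεε'⟩, h.1⟩, h.2⟩⟩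
  · have h3 : p ∈ range i ↔ p ∈ range i ∩ {p | p.1.1 ∈ Ioc (1 - ε') 1} :=
      ⟨fun h => ⟨h, by linarith, h2.le⟩, fun h => h.1⟩
    have h4 : p ∈ T ↔ p ∈ range i := ⟨fun h => h.1, fun h => ⟨h, by linarith, h2⟩⟩
    rw [h4, h3, hr]
    exact ⟨fun h => ⟨h.1.2, h.2⟩, fun h => ⟨⟨⟨by linarith, h2.le⟩, h.1⟩, h.2⟩⟩

end LagrangianCobordant

/-! ### The classes of the antidiagonal and of the Clifford torus -/

section Classes

namespace SChain

variable {X Y : Type} [TopologicalSpace X] [TopologicalSpace Y]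

lemma push_mem_nulls_univ (f : C(X, Y)) {z : SChain X} (hz : z ∈ nulls (univ : Set X)) :
    push f z ∈ nulls (univ : Set Y) := by
  obtain ⟨w, hw⟩ := mem_nulls_iff.1 hz
  refine mem_nulls_iff.2 ⟨push f w, ?_⟩
  rw [← push_bd, ← map_add]
  exact push_mem (fun _ h => (h trivial).elim) hw

/-- The image of a cycle of positive degree by a nullhomotopic map is a boundary. -/
lemma push_mem_nulls_of_nullhomotopic (F : C(X × unitInterval, Y)) (p : Y)
    (hF : ∀ x, F (x, 1) = p) {n : ℕ} (hn : 0 < n) {z : SChain X}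
    (hz : z ∈ relCycles n (univ : Set X)) : push (slice F 0) z ∈ nulls (univ : Set Y) := by
  let c : C(X, Unit) := ⟨fun _ => (), continuous_const⟩
  -- At time one the map factors through a point, whose homology vanishes in positive degrees.
  have h1 : push c z ∈ nulls (univ : Set Unit) := by
    have := (isEuclideanAt_unique ()).vanish n hn (push c z) ⟨push_mem_deg _ hz.1, ?_⟩
    · exact (show ({()} : Set Unit) = univ from Set.eq_univ_of_forall fun _ => rfl) ▸ this
    · change bd _ ∈ chainsIn _
      rw [← push_bd]
      exact push_mem (fun _ h => (h trivial).elim) hz.2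
  have h2 : slice F 1 = (⟨fun _ => p, continuous_const⟩ : C(Unit, Y)).comp c :=
    ContinuousMap.ext hF
  have h3 := push_mem_nulls_univ (⟨fun _ => p, continuous_const⟩ : C(Unit, Y)) h1
  rw [push_push, ← h2] at h3
  have h4 : htpy F (bd z) ∈ nulls (univ : Set Y) :=
    chainsIn_le_nulls _ (htpy_mem F (fun _ h => (h trivial).elim) hz.2)
  have h5 := bd_mem_nulls (univ : Set Y) (htpy F z)
  rw [bd_htpy] at h5
  exact ((Submodule.add_mem_iff_left _ h3).1 ((Submodule.add_mem_iff_left _ h4).1 h5))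

end SChain

/-- The pole of the sphere. -/
def northPole : S2 := ⟨EuclideanSpace.single 2 1, by simp⟩

lemma rotation_mem_sphere {y : S2} (hy : y.1 2 = 0) (t : ℝ) :
    Real.cos t • y.1 + Real.sin t • northPole.1 ∈
      Metric.sphere (0 : EuclideanSpace ℝ (Fin 3)) 1 := by
  have h := y.2
  rw [mem_sphere_zero_iff_norm, EuclideanSpace.norm_eq, Real.sqrt_eq_one] at h ⊢
  simp only [Fin.sum_univ_three, Real.norm_eq_abs, sq_abs, hy] at h
  simp [Fin.sum_univ_three, hy, northPole]
  linear_combination Real.cos t ^ 2 * h + Real.cos_sq_add_sin_sq t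

/-- The first projection is a homeomorphism from the antidiagonal to the sphere. -/
def antidiagonalHomeomorph : antidiagonalSphere ≃ₜ S2 where
  toFun p := p.1.1
  invFun x := ⟨(x, -x), rfl⟩
  left_inv p := Subtype.ext (Prod.ext rfl p.2.symm)
  right_inv x := rfl

/-- The first projection separates the classes: it kills that of the torus, whose image is an
equator, and is a homeomorphism on the antidiagonal, where a fundamental cycle cannot become null.
-/
theorem antidiagonal_ne_cliffordTorus {a b : singularHomology₂ 2 (S2 × S2)}
    (ha : RepresentsClass₂ 2 antidiagonalSphere a) (hb : RepresentsClass₂ 2 cliffordTorus b) :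
    a ≠ b := by
  obtain ⟨μ, hμ, rfl⟩ := ha
  obtain ⟨ν, -, rfl⟩ := hb
  obtain ⟨z, hz⟩ := SChain.exists_isClass μ
  obtain ⟨w, hw⟩ := SChain.exists_isClass ν
  intro h
  rw [(hz.push _).eq_iff (hw.push _)] at h
  replace h := SChain.push_mem_nulls_univ ContinuousMap.fst h
  rw [map_add, SChain.push_push, SChain.push_push] at h
  -- A quarter turn along meridians carries the equator to the pole; the second coordinate of the
  -- torus plays no part.
  let F : C(cliffordTorus × unitInterval, S2) := ⟨fun q =>
    ⟨_, rotation_mem_sphere q.1.2.1 (q.2 * (Real.pi / 2))⟩, by fun_prop⟩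
  have hF0 : SChain.slice F 0 = (ContinuousMap.fst).comp (inclusionMap cliffordTorus) := by
    ext1 p
    apply Subtype.ext
    change Real.cos (((0 : unitInterval) : ℝ) * _) • _ +
      Real.sin (((0 : unitInterval) : ℝ) * _) • _ = _
    simp only [Icc.coe_zero, zero_mul, Real.cos_zero, one_smul, Real.sin_zero, zero_smul, add_zero]
    rfl
  have hF1 : ∀ p, F (p, 1) = northPole := fun p => by
    apply Subtype.ext
    change Real.cos (((1 : unitInterval) : ℝ) * _) • _ +
      Real.sin (((1 : unitInterval) : ℝ) * _) • _ = _
    simp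
  have h1 := SChain.push_mem_nulls_of_nullhomotopic F northPole hF1 two_pos hw.mem_relCycles
  rw [hF0] at h1
  replace h := (Submodule.add_mem_iff_left _ h1).1 h
  let e : C(antidiagonalSphere, S2) := ⟨antidiagonalHomeomorph, antidiagonalHomeomorph.continuous⟩
  let x : antidiagonalSphere := antidiagonalHomeomorph.symm northPole
  have h2 := SChain.mem_nulls_push_iff (j := e) antidiagonalHomeomorph.isOpenEmbedding (A := {x})
    (by simp) (z := z)
  exact hz.isFundamentalClass_iff.1 hμ x (h2.1 (SChain.nulls_anti (subset_univ _) h))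

end Classes

/-! ### The inverse function theorem and immersions -/

section InverseFunction

variable {E F : Type} [NormedAddCommGroup E] [NormedSpace ℝ E] [NormedAddCommGroup F]
  [NormedSpace ℝ F]

/-- The inverse function theorem, with smoothness on the whole source and target. -/
theorem ContDiffOn.exists_openPartialHomeomorph [CompleteSpace E] {f : E → F} {U : Set E}
    (hU : IsOpen U) (hf : ContDiffOn ℝ ∞ f U) {a : E} (ha : a ∈ U) {A : E ≃L[ℝ] F}
    (hA : HasFDerivAt f (A : E →L[ℝ] F) a) :
    ∃ e : OpenPartialHomeomorph E F, (∀ x, e x = f x) ∧ a ∈ e.source ∧ e.source ⊆ U ∧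
      ContDiffOn ℝ ∞ e e.source ∧ ContDiffOn ℝ ∞ e.symm e.target := by
  have hfa : ContDiffAt ℝ ∞ f a := hf.contDiffAt (hU.mem_nhds ha)
  set e₀ := hfa.toOpenPartialHomeomorph f hA (by simp) with he₀
  have he₀f : ∀ x, e₀ x = f x := fun x => rfl
  -- Restricting to the open set of points with invertible derivative makes the inverse smooth on
  -- its whole domain, not only near the image of `a`.
  set W : Set E := U ∩ fderiv ℝ f ⁻¹' range ((↑) : (E ≃L[ℝ] F) → E →L[ℝ] F) with hW
  have hWo : IsOpen W := (hf.continuousOn_fderiv_of_isOpen hU (by simp)).isOpen_inter_preimage hU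
    ContinuousLinearEquiv.isOpen
  have haW : a ∈ W := ⟨ha, A, hA.fderiv.symm⟩
  set e := e₀.restrOpen W hWo with he
  have hes : e.source = e₀.source ∩ W := rfl
  have hef : ∀ x, e x = f x := fun x => rfl
  refine ⟨e, hef, ⟨hfa.mem_toOpenPartialHomeomorph_source hA (by simp), haW⟩, fun x hx => hx.2.1,
    hf.mono fun x hx => hx.2.1, fun y hy => ?_⟩
  have hx : e.symm y ∈ e.source := e.map_target hy
  obtain ⟨B, hB⟩ := hx.2.2
  have hfx : ContDiffAt ℝ ∞ f (e.symm y) := hf.contDiffAt (hU.mem_nhds hx.2.1)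
  refine (e.contDiffAt_symm hy (f₀' := B) ?_ hfx).contDiffWithinAt
  rw [hB]
  exact (hfx.differentiableAt (by simp)).hasFDerivAt

variable {N : Type} [TopologicalSpace N] [ChartedSpace E N]

lemma mfderiv_apply_eq_fderiv {M : Type} [TopologicalSpace M] [ChartedSpace F M] {f : N → M} {x : N}
    (hf : MDifferentiableAt 𝓘(ℝ, E) 𝓘(ℝ, F) f x) (v : E) :
    (mfderiv 𝓘(ℝ, E) 𝓘(ℝ, F) f x v : F) =
      fderiv ℝ (chartAt F (f x) ∘ f ∘ (chartAt E x).symm) (chartAt E x x) v := by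
  have h : (mfderiv 𝓘(ℝ, E) 𝓘(ℝ, F) f x : E →L[ℝ] F) = _ := hf.mfderiv
  rw [modelWithCornersSelf_coe, range_id, fderivWithin_univ] at h
  exact DFunLike.congr_fun h v

variable [IsManifold 𝓘(ℝ, E) ∞ N]

theorem OpenPartialHomeomorph.restrOpen_mem_maximalAtlas {φ : OpenPartialHomeomorph N E}
    (hφ : φ ∈ IsManifold.maximalAtlas 𝓘(ℝ, E) ∞ N) {S : Set N} (hS : IsOpen S) :
    φ.restrOpen S hS ∈ IsManifold.maximalAtlas 𝓘(ℝ, E) ∞ N := by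
  refine OpenPartialHomeomorph.mem_maximalAtlas_of_contMDiffOn (I := 𝓘(ℝ, E)) (M := N) (n := ∞) _ ?_ ?_
  · exact (contMDiffOn_of_mem_maximalAtlas hφ).mono fun x hx => hx.1
  · exact (contMDiffOn_symm_of_mem_maximalAtlas hφ).mono fun x hx => hx.1

theorem OpenPartialHomeomorph.trans_contDiff_mem_maximalAtlas {φ : OpenPartialHomeomorph N E}
    (hφ : φ ∈ IsManifold.maximalAtlas 𝓘(ℝ, E) ∞ N) {e : OpenPartialHomeomorph E E}
    (h : ContDiffOn ℝ ∞ e e.source) (h' : ContDiffOn ℝ ∞ e.symm e.target) :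
    φ.trans e ∈ IsManifold.maximalAtlas 𝓘(ℝ, E) ∞ N := by
  refine OpenPartialHomeomorph.mem_maximalAtlas_of_contMDiffOn (I := 𝓘(ℝ, E)) (M := N) (n := ∞) _ ?_ ?_
  · have h1 : ContMDiffOn 𝓘(ℝ, E) 𝓘(ℝ, E) ∞ φ (φ.trans e).source :=
      (contMDiffOn_of_mem_maximalAtlas hφ).mono fun x hx => hx.1
    exact (contMDiffOn_iff_contDiffOn.2 h).comp h1 fun x hx => hx.2
  · have h1 : ContMDiffOn 𝓘(ℝ, E) 𝓘(ℝ, E) ∞ e.symm (φ.trans e).target :=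
      (contMDiffOn_iff_contDiffOn.2 h').mono fun x hx => hx.1
    exact (contMDiffOn_symm_of_mem_maximalAtlas hφ).comp h1 fun x hx => hx.2

/-- A smooth map to the model space whose derivative is injective is locally a chart. -/
theorem exists_chart_of_injective_mfderiv [FiniteDimensional ℝ E] {h : N → E} {S : Set N}
    (hS : IsOpen S) (hh : ContMDiffOn 𝓘(ℝ, E) 𝓘(ℝ, E) ∞ h S) {x : N} (hx : x ∈ S)
    (hinj : Function.Injective (mfderiv 𝓘(ℝ, E) 𝓘(ℝ, E) h x)) :
    ∃ e ∈ IsManifold.maximalAtlas 𝓘(ℝ, E) ∞ N, x ∈ e.source ∧ e.source ⊆ S ∧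
      ∀ y ∈ e.source, e y = h y := by
  set φ := chartAt E x with hφ
  have hxφ : x ∈ φ.source := mem_chart_source E x
  set U : Set E := φ.target ∩ φ.symm ⁻¹' S with hUdef
  have hU : IsOpen U := φ.symm.isOpen_inter_preimage hS
  have hf : ContDiffOn ℝ ∞ (h ∘ φ.symm) U := by
    rw [← contMDiffOn_iff_contDiffOn]
    exact hh.comp ((contMDiffOn_symm_of_mem_maximalAtlas
      (IsManifold.chart_mem_maximalAtlas x)).mono fun y hy => hy.1) fun y hy => hy.2
  have ha : φ x ∈ U := ⟨φ.map_source hxφ, by simpa [φ.left_inv hxφ] using hx⟩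
  have hd := (hf.contDiffAt (hU.mem_nhds ha)).differentiableAt (by simp)
  have hmd : MDifferentiableAt 𝓘(ℝ, E) 𝓘(ℝ, E) h x :=
    (hh.contMDiffAt (hS.mem_nhds hx)).mdifferentiableAt (by simp)
  replace hinj : Function.Injective (fderiv ℝ (h ∘ φ.symm) (φ x)) := fun v w hvw =>
    hinj (((mfderiv_apply_eq_fderiv hmd v).trans hvw).trans (mfderiv_apply_eq_fderiv hmd w).symm)
  let A : E ≃L[ℝ] E := (LinearEquiv.ofInjectiveEndo
    (fderiv ℝ (h ∘ φ.symm) (φ x)).toLinearMap hinj).toContinuousLinearEquiv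
  have hA : HasFDerivAt (h ∘ φ.symm) (A : E →L[ℝ] E) (φ x) := by
    convert hd.hasFDerivAt using 1
    ext v
    rfl
  obtain ⟨e, he, hae, heU, h1, h2⟩ := hf.exists_openPartialHomeomorph hU ha hA
  refine ⟨φ.trans e, OpenPartialHomeomorph.trans_contDiff_mem_maximalAtlas
    (IsManifold.chart_mem_maximalAtlas x) h1 h2, ⟨hxφ, hae⟩, fun y hy => ?_, fun y hy => ?_⟩
  · have : φ.symm (φ y) ∈ S := (heU hy.2).2
    rwa [φ.left_inv hy.1] at this
  · change e (φ y) = h y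
    rw [he, Function.comp_apply, φ.left_inv hy.1]

/-- An injective linear map extends to an isomorphism on the product with a complement. -/
lemma exists_equiv_prod_of_injective [FiniteDimensional ℝ E] [FiniteDimensional ℝ F]
    {A : E →L[ℝ] F} (hA : Function.Injective A) {k : ℕ} (hk : finrank ℝ E + k = finrank ℝ F) :
    ∃ e : (E × EuclideanSpace ℝ (Fin k)) ≃L[ℝ] F, ∀ v, e (v, 0) = A v := by
  obtain ⟨C, hC⟩ := A.toLinearMap.range.exists_isCompl
  have h1 : finrank ℝ A.toLinearMap.range = finrank ℝ E := LinearMap.finrank_range_of_inj hA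
  have h2 := Submodule.finrank_add_eq_of_isCompl hC
  let B : EuclideanSpace ℝ (Fin k) ≃L[ℝ] C :=
    ContinuousLinearEquiv.ofFinrankEq (by rw [finrank_euclideanSpace_fin]; omega)
  let e : (E × EuclideanSpace ℝ (Fin k)) ≃ₗ[ℝ] F :=
    ((LinearEquiv.ofInjective A.toLinearMap hA).prodCongr B.toLinearEquiv).trans
      (Submodule.prodEquivOfIsCompl _ _ hC)
  refine ⟨e.toContinuousLinearEquiv, fun v => ?_⟩
  change e (v, 0) = A v
  simp [e]

variable {M : Type} [TopologicalSpace M] [ChartedSpace F M] [IsManifold 𝓘(ℝ, F) ∞ M]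

/-- A smooth map between manifolds without boundary whose derivatives are injective is an
immersion. -/
theorem ContMDiff.isImmersion_of_injective_mfderiv [FiniteDimensional ℝ E] [FiniteDimensional ℝ F]
    {f : N → M} (hf : ContMDiff 𝓘(ℝ, E) 𝓘(ℝ, F) ∞ f)
    (hinj : ∀ x, Function.Injective (mfderiv 𝓘(ℝ, E) 𝓘(ℝ, F) f x)) {k : ℕ}
    (hk : finrank ℝ E + k = finrank ℝ F) : Manifold.IsImmersion 𝓘(ℝ, E) 𝓘(ℝ, F) ∞ f := by
  refine ⟨EuclideanSpace ℝ (Fin k), inferInstance, inferInstance, fun x => ?_⟩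
  set φ := chartAt E x with hφ
  set ψ := chartAt F (f x) with hψ
  have hxφ : x ∈ φ.source := mem_chart_source E x
  have hxψ : f x ∈ ψ.source := mem_chart_source F (f x)
  set g : E → F := ψ ∘ f ∘ φ.symm with hg
  set U : Set E := φ.target ∩ φ.symm ⁻¹' (f ⁻¹' ψ.source) with hUdef
  have hU : IsOpen U := φ.symm.isOpen_inter_preimage (ψ.open_source.preimage hf.continuous)
  have hgU : ContDiffOn ℝ ∞ g U := by
    rw [← contMDiffOn_iff_contDiffOn]
    exact (contMDiffOn_of_mem_maximalAtlas (IsManifold.chart_mem_maximalAtlas (f x))).comp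
      (hf.comp_contMDiffOn ((contMDiffOn_symm_of_mem_maximalAtlas
        (IsManifold.chart_mem_maximalAtlas x)).mono fun y hy => hy.1)) fun y hy => hy.2
  have ha : φ x ∈ U := ⟨φ.map_source hxφ, by simpa [φ.left_inv hxφ] using hxψ⟩
  have hd := (hgU.contDiffAt (hU.mem_nhds ha)).differentiableAt (by simp)
  have hmd : MDifferentiableAt 𝓘(ℝ, E) 𝓘(ℝ, F) f x := hf.mdifferentiableAt (by simp)
  have hAinj : Function.Injective (fderiv ℝ g (φ x)) := fun v w hvw =>
    hinj x (((mfderiv_apply_eq_fderiv hmd v).trans hvw).trans (mfderiv_apply_eq_fderiv hmd w).symm)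
  obtain ⟨L, hL⟩ := exists_equiv_prod_of_injective hAinj hk
  set U' : Set F := {y | (L.symm y).1 ∈ U} with hU'def
  have hU' : IsOpen U' := hU.preimage (by fun_prop)
  -- The map `g` is extended by translations in directions complementary to the image of its
  -- derivative. Since `L (v, 0)` is the derivative of `g` in direction `v`, the derivative of `G`
  -- at `a` is the identity, and composing the target chart with the local inverse of `G`
  -- straightens the image.
  set G : F → F := fun y => g (L.symm y).1 + L (0, (L.symm y).2) with hGdef
  have hG : ContDiffOn ℝ ∞ G U' := by
    refine ContDiffOn.add (hgU.comp (t := U) (f := fun y => (L.symm y).1) ?_ fun y hy => hy) ?_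
    · exact ContDiff.contDiffOn (by fun_prop)
    · exact ContDiff.contDiffOn (by fun_prop)
  set a : F := L (φ x, 0) with hadef
  have haU' : a ∈ U' := by
    change (L.symm (L (φ x, 0))).1 ∈ U
    rwa [L.symm_apply_apply]
  have hGa : HasFDerivAt G ((ContinuousLinearEquiv.refl ℝ F : F ≃L[ℝ] F) : F →L[ℝ] F) a := by
    have h1 : HasFDerivAt (fun y => (L.symm y).1)
        ((ContinuousLinearMap.fst ℝ E (EuclideanSpace ℝ (Fin k))).comp
          (L.symm : F →L[ℝ] E × EuclideanSpace ℝ (Fin k))) a :=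
      ((ContinuousLinearMap.fst ℝ E (EuclideanSpace ℝ (Fin k))).comp
          (L.symm : F →L[ℝ] E × EuclideanSpace ℝ (Fin k))).hasFDerivAt
    have h2 : HasFDerivAt (fun y => L (0, (L.symm y).2))
        ((L : (E × EuclideanSpace ℝ (Fin k)) →L[ℝ] F).comp ((ContinuousLinearMap.inr ℝ E (EuclideanSpace ℝ (Fin k))).comp
          ((ContinuousLinearMap.snd ℝ E (EuclideanSpace ℝ (Fin k))).comp
            (L.symm : F →L[ℝ] E × EuclideanSpace ℝ (Fin k))))) a :=
      ((L : (E × EuclideanSpace ℝ (Fin k)) →L[ℝ] F).comp ((ContinuousLinearMap.inr ℝ E (EuclideanSpace ℝ (Fin k))).comp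
          ((ContinuousLinearMap.snd ℝ E (EuclideanSpace ℝ (Fin k))).comp
            (L.symm : F →L[ℝ] E × EuclideanSpace ℝ (Fin k))))).hasFDerivAt
    have h3 : HasFDerivAt g (fderiv ℝ g (φ x)) (L.symm a).1 := by
      rw [hadef, L.symm_apply_apply]
      exact hd.hasFDerivAt
    refine ((h3.comp a h1).add h2).congr_fderiv ?_
    ext v
    symm
    change v = fderiv ℝ g (φ x) (L.symm v).1 + L (0, (L.symm v).2)
    rw [← hL, ← map_add]
    simp
  obtain ⟨e, he, hae, heU, h1, h2⟩ := hG.exists_openPartialHomeomorph hU' haU' hGa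
  set S : Set E := {u | L (u, 0) ∈ e.source} with hSdef
  have hS : IsOpen S := e.open_source.preimage (by fun_prop)
  have hSU : S ⊆ U := fun u hu => by
    have : (L.symm (L (u, 0))).1 ∈ U := heU hu
    rwa [L.symm_apply_apply] at this
  have heL : ∀ u, e (L (u, 0)) = g u := fun u => by
    rw [he, hGdef]
    simp only [L.symm_apply_apply]
    rw [show ((0 : E), (0 : EuclideanSpace ℝ (Fin k))) = 0 from rfl, map_zero, add_zero]
  refine .mk_of_continuousAt hf.continuous.continuousAt L (φ.restrOpen (φ.source ∩ φ ⁻¹' S)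
    (φ.isOpen_inter_preimage hS)) (ψ.trans e.symm) ⟨hxφ, hxφ, hae⟩ ⟨hxψ, ?_⟩ ?_ ?_ ?_
  · change ψ (f x) ∈ e.target
    have : g (φ x) = ψ (f x) := by simp [hg, φ.left_inv hxφ]
    rw [← this, ← heL]
    exact e.map_source hae
  · exact OpenPartialHomeomorph.restrOpen_mem_maximalAtlas
      (IsManifold.chart_mem_maximalAtlas x) (φ.isOpen_inter_preimage hS)
  · exact OpenPartialHomeomorph.trans_contDiff_mem_maximalAtlas (e := e.symm)
      (IsManifold.chart_mem_maximalAtlas (f x)) h2 (by simpa using h1)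
  · intro u hu
    have hu' : u ∈ φ.target ∧ u ∈ S := by
      simp only [OpenPartialHomeomorph.extend_target, modelWithCornersSelf_coe_symm,
        modelWithCornersSelf_coe, range_id, inter_univ, preimage_id] at hu
      have hu2 : u ∈ φ.target ∧ φ.symm u ∈ φ.source ∩ φ ⁻¹' S := by simpa using hu
      exact ⟨hu2.1, by simpa [φ.right_inv hu2.1] using hu2.2.2⟩
    change e.symm (g u) = L (u, 0)
    rw [← heL, e.left_inv hu'.2]

end InverseFunction

/-! ### Symplectic forms on products and on the sphere -/

section PullbackForms

variable {E E' E'' F F' G X : Type} [NormedAddCommGroup E] [NormedSpace ℝ E]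
  [NormedAddCommGroup E'] [NormedSpace ℝ E'] [NormedAddCommGroup E''] [NormedSpace ℝ E'']
  [NormedAddCommGroup F] [NormedSpace ℝ F] [NormedAddCommGroup F'] [NormedSpace ℝ F']
  [NormedAddCommGroup G] [NormedSpace ℝ G] [NormedAddCommGroup X] [NormedSpace ℝ X]
  {H H' H'' : Type} [TopologicalSpace H] [TopologicalSpace H'] [TopologicalSpace H'']
  {I : ModelWithCorners ℝ E H} {I' : ModelWithCorners ℝ E' H'} {I'' : ModelWithCorners ℝ E'' H''}
  {M M' M'' : Type} [TopologicalSpace M] [ChartedSpace H M] [TopologicalSpace M']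
  [ChartedSpace H' M'] [TopologicalSpace M''] [ChartedSpace H'' M'']

lemma contDiff_clm_flip : ContDiff ℝ ∞ fun A : E →L[ℝ] F →L[ℝ] G => A.flip :=
  IsBoundedLinearMap.contDiff ⟨⟨fun _ _ => rfl, fun _ _ => rfl⟩, 1, one_pos, fun A => by
    rw [ContinuousLinearMap.opNorm_flip, one_mul]⟩

lemma ContDiffOn.bilinearComp {f : X → E →L[ℝ] F →L[ℝ] G} {g : X → E' →L[ℝ] E}
    {h : X → F' →L[ℝ] F} {s : Set X} (hf : ContDiffOn ℝ ∞ f s) (hg : ContDiffOn ℝ ∞ g s)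
    (hh : ContDiffOn ℝ ∞ h s) :
    ContDiffOn ℝ ∞ (fun x => (f x).bilinearComp (g x) (h x)) s := by
  exact contDiff_clm_flip.comp_contDiffOn
    ((contDiff_clm_flip.comp_contDiffOn (hf.clm_comp hg)).clm_comp hh)

lemma fderiv_bilinear_apply {f : X → E →L[ℝ] F →L[ℝ] G} {x : X} (hf : DifferentiableAt ℝ f x)
    (u : X) (v : E) (w : F) : fderiv ℝ f x u v w = fderiv ℝ (fun y => f y v w) x u := by
  have h1 : HasFDerivAt (fun y => f y v) ((fderiv ℝ f x).flip v) x := by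
    simpa using hf.hasFDerivAt.clm_apply (hasFDerivAt_const v x)
  have h2 : HasFDerivAt (fun y => f y v w) (((fderiv ℝ f x).flip v).flip w) x := by
    simpa using h1.clm_apply (hasFDerivAt_const w x)
  rw [h2.fderiv]
  rfl

lemma TwoForm.pullback_apply (f : M' → M) (Ω : TwoForm I M) (x : M') (u v : TangentSpace I' x) :
    Ω.pullback I' f x u v = Ω (f x) (mfderiv I' I f x u) (mfderiv I' I f x v) := rfl

lemma TwoForm.pullback_pullback_apply {f : M' → M} {g : M'' → M'} (Ω : TwoForm I M) {x : M''}
    (hf : MDifferentiableAt I' I f (g x)) (hg : MDifferentiableAt I'' I' g x)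
    (u v : TangentSpace I'' x) :
    (Ω.pullback I' f).pullback I'' g x u v = Ω.pullback I'' (f ∘ g) x u v := by
  rw [TwoForm.pullback_apply, TwoForm.pullback_apply, TwoForm.pullback_apply,
    mfderiv_comp x hf hg]
  rfl

lemma TwoForm.pullback_prod_apply {f : M'' → M × M'} (Ω : TwoForm I M) (Ω' : TwoForm I' M') {x : M''}
    (hf : MDifferentiableAt I'' (I.prod I') f x) (u v : TangentSpace I'' x) :
    (Ω.prod Ω').pullback I'' f x u v =
      Ω.pullback I'' (Prod.fst ∘ f) x u v + Ω'.pullback I'' (Prod.snd ∘ f) x u v := by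
  rw [← TwoForm.pullback_pullback_apply (I' := I.prod I') Ω mdifferentiableAt_fst hf,
    ← TwoForm.pullback_pullback_apply (I' := I.prod I') Ω' mdifferentiableAt_snd hf]
  rfl

lemma TwoForm.prod_apply (Ω : TwoForm I M) (Ω' : TwoForm I' M') (p : M × M') (u v : E × E') :
    (Ω.prod Ω' p : E × E' →L[ℝ] E × E' →L[ℝ] ℝ) u v =
      (Ω p.1 : E →L[ℝ] E →L[ℝ] ℝ) u.1 v.1 + (Ω' p.2 : E' →L[ℝ] E' →L[ℝ] ℝ) u.2 v.2 := by
  have h : ∀ w : E × E', (mfderiv (I.prod I') I Prod.fst p : E × E' →L[ℝ] E) w = w.1 := fun w => by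
    rw [mfderiv_fst]; rfl
  have h' : ∀ w : E × E', (mfderiv (I.prod I') I' Prod.snd p : E × E' →L[ℝ] E') w = w.2 :=
    fun w => by rw [mfderiv_snd]; rfl
  change (Ω p.1 : E →L[ℝ] E →L[ℝ] ℝ) ((mfderiv (I.prod I') I Prod.fst p : E × E' →L[ℝ] E) u)
    ((mfderiv (I.prod I') I Prod.fst p : E × E' →L[ℝ] E) v) +
    (Ω' p.2 : E' →L[ℝ] E' →L[ℝ] ℝ) ((mfderiv (I.prod I') I' Prod.snd p : E × E' →L[ℝ] E') u)
    ((mfderiv (I.prod I') I' Prod.snd p : E × E' →L[ℝ] E') v) = _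
  rw [h, h, h', h']

variable [I.Boundaryless] [I'.Boundaryless] [IsManifold I ∞ M] [IsManifold I' ∞ M']

lemma mdifferentiableAt_extChartAt_symm_of_mem {x : M} {y : E}
    (hy : y ∈ (extChartAt I x).target) :
    MDifferentiableAt 𝓘(ℝ, E) I (extChartAt I x).symm y :=
  ((contMDiffOn_extChartAt_symm x).contMDiffAt
    ((isOpen_extChartAt_target x).mem_nhds hy)).mdifferentiableAt (n := ∞) (by simp)

/-- Charts of a product are products of charts, so each summand depends on the coordinates of its
own factor only; smoothness and closedness reduce to the factors. -/
lemma TwoForm.inChart_prod (Ω : TwoForm I M) (Ω' : TwoForm I' M') (p : M × M') {y : E × E'}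
    (hy : y ∈ (extChartAt (I.prod I') p).target) :
    (Ω.prod Ω').inChart p y =
      (Ω.inChart p.1 y.1).bilinearComp (ContinuousLinearMap.fst ℝ E E')
        (ContinuousLinearMap.fst ℝ E E') +
      (Ω'.inChart p.2 y.2).bilinearComp (ContinuousLinearMap.snd ℝ E E')
        (ContinuousLinearMap.snd ℝ E E') := by
  have hy' := hy
  rw [extChartAt_prod] at hy'
  have h1 := mdifferentiableAt_extChartAt_symm_of_mem hy'.1
  have h2 := mdifferentiableAt_extChartAt_symm_of_mem hy'.2
  have hfst : ∀ w : E × E', (mfderiv 𝓘(ℝ, E × E') 𝓘(ℝ, E) Prod.fst y : E × E' →L[ℝ] E) w = w.1 :=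
    fun w => by rw [mfderiv_eq_fderiv, fderiv_fst]; rfl
  have hsnd : ∀ w : E × E', (mfderiv 𝓘(ℝ, E × E') 𝓘(ℝ, E') Prod.snd y : E × E' →L[ℝ] E') w = w.2 :=
    fun w => by rw [mfderiv_eq_fderiv, fderiv_snd]; rfl
  have d1 : MDifferentiableAt 𝓘(ℝ, E × E') 𝓘(ℝ, E) Prod.fst y :=
    differentiableAt_fst.mdifferentiableAt
  have d2 : MDifferentiableAt 𝓘(ℝ, E × E') 𝓘(ℝ, E') Prod.snd y :=
    differentiableAt_snd.mdifferentiableAt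
  have key : ∀ u v : E × E', (Ω.prod Ω').inChart p y u v =
      Ω.inChart p.1 y.1 u.1 v.1 + Ω'.inChart p.2 y.2 u.2 v.2 := by
    intro u v
    have e := TwoForm.pullback_prod_apply (I'' := 𝓘(ℝ, E × E')) Ω Ω'
      (mdifferentiableAt_extChartAt_symm_of_mem hy) u v
    have e1 := TwoForm.pullback_pullback_apply (I'' := 𝓘(ℝ, E × E')) Ω (x := y) h1 d1 u v
    have e2 := TwoForm.pullback_pullback_apply (I'' := 𝓘(ℝ, E × E')) Ω' (x := y) h2 d2 u v
    have f1 : Prod.fst ∘ (extChartAt (I.prod I') p).symm = (extChartAt I p.1).symm ∘ Prod.fst := by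
      rw [extChartAt_prod]; rfl
    have f2 : Prod.snd ∘ (extChartAt (I.prod I') p).symm = (extChartAt I' p.2).symm ∘ Prod.snd := by
      rw [extChartAt_prod]; rfl
    rw [f1, f2, ← e1, ← e2] at e
    refine Eq.trans e ?_
    refine congrArg₂ (· + ·) ?_ ?_
    · change (Ω.inChart p.1 y.1) (mfderiv 𝓘(ℝ, E × E') 𝓘(ℝ, E) Prod.fst y u : E)
        (mfderiv 𝓘(ℝ, E × E') 𝓘(ℝ, E) Prod.fst y v : E) = _
      exact congrArg₂ (fun a b => Ω.inChart p.1 y.1 a b) (hfst u) (hfst v)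
    · change (Ω'.inChart p.2 y.2) (mfderiv 𝓘(ℝ, E × E') 𝓘(ℝ, E') Prod.snd y u : E')
        (mfderiv 𝓘(ℝ, E × E') 𝓘(ℝ, E') Prod.snd y v : E') = _
      exact congrArg₂ (fun a b => Ω'.inChart p.2 y.2 a b) (hsnd u) (hsnd v)
  exact ContinuousLinearMap.ext fun u => ContinuousLinearMap.ext fun v => key u v

lemma IsSymplectic.smooth_prod {Ω : TwoForm I M} {Ω' : TwoForm I' M'} (h : IsSymplectic I Ω)
    (h' : IsSymplectic I' Ω') (p : M × M') :
    ContDiffOn ℝ ∞ ((Ω.prod Ω').inChart p) (extChartAt (I.prod I') p).target := by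
  have hsub : ∀ y ∈ (extChartAt (I.prod I') p).target,
      y.1 ∈ (extChartAt I p.1).target ∧ y.2 ∈ (extChartAt I' p.2).target := fun y hy => by
    rw [extChartAt_prod] at hy
    exact hy
  refine ContDiffOn.congr (ContDiffOn.add (ContDiffOn.bilinearComp
    ((h.smooth p.1).comp contDiff_fst.contDiffOn fun y hy => (hsub y hy).1) contDiffOn_const
    contDiffOn_const) (ContDiffOn.bilinearComp ((h'.smooth p.2).comp contDiff_snd.contDiffOn
      fun y hy => (hsub y hy).2) contDiffOn_const contDiffOn_const))
    fun y hy => TwoForm.inChart_prod Ω Ω' p hy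

/-- The product of two symplectic forms is symplectic. -/
theorem IsSymplectic.prod {Ω : TwoForm I M} {Ω' : TwoForm I' M'} (h : IsSymplectic I Ω)
    (h' : IsSymplectic I' Ω') : IsSymplectic (I.prod I') (Ω.prod Ω') where
  alternating p v := by
    have e := TwoForm.prod_apply Ω Ω' p v v
    exact e.trans ((congrArg₂ (· + ·) (h.alternating p.1 _) (h'.alternating p.2 _)).trans (add_zero 0))
  nondegenerate p v hv := by
    refine Prod.ext (h.nondegenerate p.1 _ fun w => ?_) (h'.nondegenerate p.2 _ fun w => ?_)
    · have e := TwoForm.prod_apply Ω Ω' p v ((w, 0) : E × E')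
      have e0 : (Ω' p.2 : E' →L[ℝ] E' →L[ℝ] ℝ) (v : E × E').2 0 = 0 := map_zero _
      exact ((congrArg (_ + ·) e0).trans (add_zero _)).symm.trans (e.symm.trans (hv _))
    · have e := TwoForm.prod_apply Ω Ω' p v ((0, w) : E × E')
      have e0 : (Ω p.1 : E →L[ℝ] E →L[ℝ] ℝ) (v : E × E').1 0 = 0 := map_zero _
      exact ((congrArg (· + _) e0).trans (zero_add _)).symm.trans (e.symm.trans (hv _))
  smooth := h.smooth_prod h'
  closed p y hy u v w := by
    have hopen := isOpen_extChartAt_target (I := I.prod I') p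
    have hy' := hy
    rw [extChartAt_prod] at hy'
    have d1 : DifferentiableAt ℝ (Ω.inChart p.1) y.1 := ((h.smooth p.1).contDiffAt
      ((isOpen_extChartAt_target p.1).mem_nhds hy'.1)).differentiableAt (by simp)
    have d2 : DifferentiableAt ℝ (Ω'.inChart p.2) y.2 := ((h'.smooth p.2).contDiffAt
      ((isOpen_extChartAt_target p.2).mem_nhds hy'.2)).differentiableAt (by simp)
    have d : DifferentiableAt ℝ ((Ω.prod Ω').inChart p) y :=
      ((h.smooth_prod h' p).contDiffAt (hopen.mem_nhds hy)).differentiableAt (by simp)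
    have key : ∀ u v w : E × E', fderiv ℝ ((Ω.prod Ω').inChart p) y u v w =
        fderiv ℝ (Ω.inChart p.1) y.1 u.1 v.1 w.1 + fderiv ℝ (Ω'.inChart p.2) y.2 u.2 v.2 w.2 := by
      intro u v w
      have e : (fun z => (Ω.prod Ω').inChart p z v w) =ᶠ[nhds y]
          fun z => Ω.inChart p.1 z.1 v.1 w.1 + Ω'.inChart p.2 z.2 v.2 w.2 := by
        filter_upwards [hopen.mem_nhds hy] with z hz
        rw [TwoForm.inChart_prod Ω Ω' p hz]
        rfl
      rw [fderiv_bilinear_apply d, e.fderiv_eq, fderiv_bilinear_apply d1, fderiv_bilinear_apply d2]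
      have g1 : HasFDerivAt (fun z : E × E' => Ω.inChart p.1 z.1 v.1 w.1)
          ((fderiv ℝ (fun z => Ω.inChart p.1 z v.1 w.1) y.1).comp (ContinuousLinearMap.fst ℝ E E'))
          y := by
        have : DifferentiableAt ℝ (fun z => Ω.inChart p.1 z v.1 w.1) y.1 := by fun_prop
        exact this.hasFDerivAt.comp y hasFDerivAt_fst
      have g2 : HasFDerivAt (fun z : E × E' => Ω'.inChart p.2 z.2 v.2 w.2)
          ((fderiv ℝ (fun z => Ω'.inChart p.2 z v.2 w.2) y.2).comp
            (ContinuousLinearMap.snd ℝ E E')) y := by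
        have : DifferentiableAt ℝ (fun z => Ω'.inChart p.2 z v.2 w.2) y.2 := by fun_prop
        exact this.hasFDerivAt.comp y hasFDerivAt_snd
      exact DFunLike.congr_fun (g1.add g2).fderiv u
    rw [key, key, key]
    linear_combination h.closed p.1 y.1 hy'.1 u.1 v.1 w.1 + h'.closed p.2 y.2 hy'.2 u.2 v.2 w.2

end PullbackForms

/-! ### The area form of the sphere -/

section AreaForm

lemma contMDiff_coe_sphere_fin (n : ℕ) :
    ContMDiff (𝓡 n) 𝓘(ℝ, EuclideanSpace ℝ (Fin (n + 1))) ∞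
      (Subtype.val : Metric.sphere (0 : EuclideanSpace ℝ (Fin (n + 1))) 1 → _) :=
  haveI := Fact.mk (@finrank_euclideanSpace_fin ℝ _ (n + 1))
  contMDiff_coe_sphere

lemma mfderiv_coe_sphere_fin_injective (n : ℕ)
    (x : Metric.sphere (0 : EuclideanSpace ℝ (Fin (n + 1))) 1) :
    Function.Injective (mfderiv (𝓡 n) 𝓘(ℝ, EuclideanSpace ℝ (Fin (n + 1)))
      (Subtype.val : Metric.sphere (0 : EuclideanSpace ℝ (Fin (n + 1))) 1 → _) x) :=
  haveI := Fact.mk (@finrank_euclideanSpace_fin ℝ _ (n + 1))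
  injective_mvfderiv_subtypeVal_sphere x

lemma exists_mfderiv_coe_sphere_fin_eq_iff (n : ℕ)
    (x : Metric.sphere (0 : EuclideanSpace ℝ (Fin (n + 1))) 1) (v : EuclideanSpace ℝ (Fin (n + 1))) :
    (∃ u, mfderiv (𝓡 n) 𝓘(ℝ, EuclideanSpace ℝ (Fin (n + 1)))
      (Subtype.val : Metric.sphere (0 : EuclideanSpace ℝ (Fin (n + 1))) 1 → _) x u = v) ↔
      inner ℝ x.1 v = 0 := by
  have := Fact.mk (@finrank_euclideanSpace_fin ℝ _ (n + 1))
  rw [← Submodule.mem_orthogonal_singleton_iff_inner_right,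
    ← range_mvfderiv_subtypeVal (n := n) x]
  rfl

/-- The form `x₀ dx₁ ∧ dx₂ + x₁ dx₂ ∧ dx₀ + x₂ dx₀ ∧ dx₁` on `ℝ³`. -/
def spaceAreaForm (x : EuclideanSpace ℝ (Fin 3)) :
    EuclideanSpace ℝ (Fin 3) →L[ℝ] EuclideanSpace ℝ (Fin 3) →L[ℝ] ℝ :=
    x 0 • wedge (EuclideanSpace.proj (1 : Fin 3)) (EuclideanSpace.proj (2 : Fin 3))
      + x 1 • wedge (EuclideanSpace.proj (2 : Fin 3)) (EuclideanSpace.proj (0 : Fin 3))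
      + x 2 • wedge (EuclideanSpace.proj (0 : Fin 3)) (EuclideanSpace.proj (1 : Fin 3))

lemma spaceAreaForm_apply (x u v : EuclideanSpace ℝ (Fin 3)) :
    spaceAreaForm x u v =
      x 0 * (u 1 * v 2 - u 2 * v 1) + x 1 * (u 2 * v 0 - u 0 * v 2)
        + x 2 * (u 0 * v 1 - u 1 * v 0) := rfl

lemma contDiff_spaceAreaForm : ContDiff ℝ ∞ spaceAreaForm := by
  refine contDiff_clm_apply_iff.2 fun u => contDiff_clm_apply_iff.2 fun v => ?_
  simp only [spaceAreaForm_apply]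
  fun_prop

/-- The cyclic sum is an alternating form in three vectors, and a plane carries none. This is why
every 2-form on a surface is closed. -/
lemma cyclic_sum_eq_zero (T : EuclideanSpace ℝ (Fin 2) →L[ℝ] EuclideanSpace ℝ (Fin 2) →L[ℝ]
    EuclideanSpace ℝ (Fin 2) →L[ℝ] ℝ) (hT : ∀ u v, T u v v = 0) (u v w : EuclideanSpace ℝ (Fin 2)) :
    T u v w + T v w u + T w u v = 0 := by
  set e : Fin 2 → EuclideanSpace ℝ (Fin 2) := fun i => EuclideanSpace.single i 1
  have hdec : ∀ v : EuclideanSpace ℝ (Fin 2), v = v 0 • e 0 + v 1 • e 1 := fun v => by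
    ext i; fin_cases i <;> simp [e]
  have hanti : ∀ u, T u (e 1) (e 0) = - T u (e 0) (e 1) := fun u => by
    have := hT u (e 0 + e 1)
    simp only [map_add, add_apply, hT] at this
    linarith
  have h1 : ∀ u v w, T u v w = (v 0 * w 1 - v 1 * w 0) * T u (e 0) (e 1) := fun u v w => by
    conv_lhs => rw [hdec v, hdec w]
    simp only [map_add, map_smul, add_apply, smul_apply,
      smul_eq_mul, hT, hanti]
    ring
  have h2 : ∀ u, T u (e 0) (e 1) = u 0 * T (e 0) (e 0) (e 1) + u 1 * T (e 1) (e 0) (e 1) :=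
    fun u => by
      conv_lhs => rw [hdec u]
      simp only [map_add, map_smul, add_apply, smul_apply,
        smul_eq_mul]
  rw [h1 u v w, h1 v w u, h1 w u v, h2 u, h2 v, h2 w]
  ring

lemma TwoForm.smul_pullback_inChart_apply {c : ℝ} {x₀ : S2} {y u v : EuclideanSpace ℝ (Fin 2)}
    (hy : y ∈ (extChartAt (𝓡 2) x₀).target) :
    TwoForm.inChart (I := 𝓡 2) (M := S2) (fun x => c • areaForm x) x₀ y u v =
      c * spaceAreaForm (Subtype.val ((extChartAt (𝓡 2) x₀).symm y))
        (fderiv ℝ (Subtype.val ∘ (extChartAt (𝓡 2) x₀).symm) y u)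
        (fderiv ℝ (Subtype.val ∘ (extChartAt (𝓡 2) x₀).symm) y v) := by
  have h := TwoForm.pullback_pullback_apply (I'' := 𝓡 2) (I' := 𝓡 2)
    (I := 𝓘(ℝ, EuclideanSpace ℝ (Fin 3))) spaceAreaForm (x := y)
    ((contMDiff_coe_sphere_fin 2).mdifferentiableAt (by simp))
    (mdifferentiableAt_extChartAt_symm_of_mem hy) u v
  have e : ∀ w : EuclideanSpace ℝ (Fin 2), (mfderiv (𝓡 2) 𝓘(ℝ, EuclideanSpace ℝ (Fin 3))
      ((Subtype.val : S2 → _) ∘ (extChartAt (𝓡 2) x₀).symm) y w : EuclideanSpace ℝ (Fin 3)) =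
      fderiv ℝ (Subtype.val ∘ (extChartAt (𝓡 2) x₀).symm) y w := fun w => by
    rw [mfderiv_eq_fderiv]; rfl
  exact (congrArg (c * ·) h).trans
    (congrArg₂ (fun a b => c * spaceAreaForm _ a b) (e u) (e v))

lemma contDiffOn_coe_extChartAt_symm (x₀ : S2) :
    ContDiffOn ℝ ∞ ((Subtype.val : S2 → _) ∘ (extChartAt (𝓡 2) x₀).symm)
      (extChartAt (𝓡 2) x₀).target := by
  rw [← contMDiffOn_iff_contDiffOn]
  exact (contMDiff_coe_sphere_fin 2).comp_contMDiffOn (contMDiffOn_extChartAt_symm x₀)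

lemma contDiffOn_inChart_areaForm (c : ℝ) (x₀ : S2) :
    ContDiffOn ℝ ∞ (TwoForm.inChart (I := 𝓡 2) (M := S2) (fun x => c • areaForm x) x₀)
      (extChartAt (𝓡 2) x₀).target := by
  have hg := contDiffOn_coe_extChartAt_symm x₀
  have hd : ContDiffOn ℝ ∞ (fderiv ℝ ((Subtype.val : S2 → _) ∘ (extChartAt (𝓡 2) x₀).symm))
      (extChartAt (𝓡 2) x₀).target :=
    hg.fderiv_of_isOpen (isOpen_extChartAt_target x₀) (by simp)
  refine ContDiffOn.congr (ContDiffOn.const_smul c (ContDiffOn.bilinearComp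
    (contDiff_spaceAreaForm.comp_contDiffOn hg) hd hd)) fun y hy =>
      ContinuousLinearMap.ext fun u => ContinuousLinearMap.ext fun v =>
        TwoForm.smul_pullback_inChart_apply (c := c) (u := u) (v := v) hy

theorem isSymplectic_areaForm {c : ℝ} (hc : c ≠ 0) :
    IsSymplectic (𝓡 2) (fun x : S2 => c • areaForm x) where
  alternating x v := by
    have h : ∀ a : EuclideanSpace ℝ (Fin 3), spaceAreaForm x.1 a a = 0 := fun a => by
      rw [spaceAreaForm_apply]; ring
    exact (congrArg (c * ·) (h _)).trans (mul_zero c)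
  nondegenerate x v hv := by
    set ι : TangentSpace (𝓡 2) x → EuclideanSpace ℝ (Fin 3) := fun u =>
      mfderiv (𝓡 2) 𝓘(ℝ, EuclideanSpace ℝ (Fin 3)) (Subtype.val : S2 → _) x u with hι
    have hinj : Function.Injective ι := mfderiv_coe_sphere_fin_injective 2 x
    set a := ι v with ha
    have hxa : inner ℝ x.1 a = 0 := (exists_mfderiv_coe_sphere_fin_eq_iff 2 x a).1 ⟨v, rfl⟩
    have hx : x.1 0 ^ 2 + x.1 1 ^ 2 + x.1 2 ^ 2 = 1 := by
      have h := x.2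
      rw [mem_sphere_zero_iff_norm, EuclideanSpace.norm_eq, Real.sqrt_eq_one] at h
      simpa [Fin.sum_univ_three] using h
    simp only [PiLp.inner_apply, Fin.sum_univ_three, RCLike.inner_apply, conj_trivial] at hxa
    -- The test vector is the cross product of `x` and `a`, tangent because it is orthogonal to `x`.
    -- The area of `a` and `x × a` is `|x × a|²`, which equals `|a|²` for a unit vector `x`
    -- orthogonal to `a`.
    obtain ⟨w, hw⟩ := (exists_mfderiv_coe_sphere_fin_eq_iff 2 x
      !₂[x.1 1 * a 2 - x.1 2 * a 1, x.1 2 * a 0 - x.1 0 * a 2, x.1 0 * a 1 - x.1 1 * a 0]).2 (by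
        simp [PiLp.inner_apply, Fin.sum_univ_three]; ring)
    have h0 : c * spaceAreaForm x.1 a (ι w) = 0 := hv w
    have hw' : ι w = _ := hw
    rw [hw', spaceAreaForm_apply] at h0
    have h1 := (mul_eq_zero.1 h0).resolve_left hc
    simp at h1
    have h2 : a 0 ^ 2 + a 1 ^ 2 + a 2 ^ 2 = 0 := by
      linear_combination h1 - (a 0 ^ 2 + a 1 ^ 2 + a 2 ^ 2) * hx +
        (a 0 * x.1 0 + a 1 * x.1 1 + a 2 * x.1 2) * hxa
    have ha0 : a = 0 := by
      ext i
      fin_cases i <;> simp <;> nlinarith [sq_nonneg (a 0), sq_nonneg (a 1), sq_nonneg (a 2)]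
    have hz : ι 0 = 0 := map_zero (mfderiv (𝓡 2) 𝓘(ℝ, EuclideanSpace ℝ (Fin 3))
      (Subtype.val : S2 → _) x)
    exact hinj (ha0.trans hz.symm)
  smooth := contDiffOn_inChart_areaForm c
  closed x₀ y hy u v w := by
    have hd : DifferentiableAt ℝ
        (TwoForm.inChart (I := 𝓡 2) (M := S2) (fun x => c • areaForm x) x₀) y :=
      ((contDiffOn_inChart_areaForm c x₀).contDiffAt
        ((isOpen_extChartAt_target x₀).mem_nhds hy)).differentiableAt (by simp)
    refine cyclic_sum_eq_zero _ (fun u v => ?_) u v w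
    have h0 : (fun z => TwoForm.inChart (I := 𝓡 2) (M := S2) (fun x => c • areaForm x) x₀ z v v)
        =ᶠ[nhds y] fun _ => 0 := by
      filter_upwards [(isOpen_extChartAt_target x₀).mem_nhds hy] with z hz
      rw [TwoForm.smul_pullback_inChart_apply hz, spaceAreaForm_apply]
      ring
    rw [fderiv_bilinear_apply hd, h0.fderiv_eq]
    simp

theorem isSymplectic_splitForm {c : ℝ} (hc : c ≠ 0) :
    IsSymplectic ((𝓡 2).prod (𝓡 2)) (splitForm c) :=
  (isSymplectic_areaForm hc).prod (isSymplectic_areaForm hc)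

end AreaForm

/-! ### The antidiagonal and the Clifford torus are closed Lagrangian submanifolds -/

section Presentations

lemma injective_mfderiv_of_comp {E E' E'' : Type} [NormedAddCommGroup E] [NormedSpace ℝ E]
    [NormedAddCommGroup E'] [NormedSpace ℝ E'] [NormedAddCommGroup E''] [NormedSpace ℝ E'']
    {H H' H'' : Type} [TopologicalSpace H] [TopologicalSpace H'] [TopologicalSpace H'']
    {I : ModelWithCorners ℝ E H} {I' : ModelWithCorners ℝ E' H'} {I'' : ModelWithCorners ℝ E'' H''}
    {M M' M'' : Type} [TopologicalSpace M] [ChartedSpace H M] [TopologicalSpace M']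
    [ChartedSpace H' M'] [TopologicalSpace M''] [ChartedSpace H'' M''] {f : M → M'} {g : M' → M''}
    {x : M} (hf : MDifferentiableAt I I' f x) (hg : MDifferentiableAt I' I'' g (f x))
    (h : Function.Injective (mfderiv I I'' (g ∘ f) x)) :
    Function.Injective (mfderiv I I' f x) := by
  rw [mfderiv_comp x hg hf] at h
  exact Function.Injective.of_comp h

theorem ContMDiff.isImmersion_prod_of_injective_mfderiv {E F F' : Type} [NormedAddCommGroup E]
    [NormedSpace ℝ E] [NormedAddCommGroup F] [NormedSpace ℝ F] [NormedAddCommGroup F']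
    [NormedSpace ℝ F'] [FiniteDimensional ℝ E] [FiniteDimensional ℝ F] [FiniteDimensional ℝ F']
    {N M M' : Type} [TopologicalSpace N] [ChartedSpace E N] [IsManifold 𝓘(ℝ, E) ∞ N]
    [TopologicalSpace M] [ChartedSpace F M] [IsManifold 𝓘(ℝ, F) ∞ M]
    [TopologicalSpace M'] [ChartedSpace F' M'] [IsManifold 𝓘(ℝ, F') ∞ M'] {f : N → M × M'}
    (hf : ContMDiff 𝓘(ℝ, E) (𝓘(ℝ, F).prod 𝓘(ℝ, F')) ∞ f)
    (hinj : ∀ x, Function.Injective (mfderiv 𝓘(ℝ, E) (𝓘(ℝ, F).prod 𝓘(ℝ, F')) f x)) {k : ℕ}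
    (hk : finrank ℝ E + k = finrank ℝ (F × F')) :
    Manifold.IsImmersion 𝓘(ℝ, E) (𝓘(ℝ, F).prod 𝓘(ℝ, F')) ∞ f := by
  -- The product of two trivial models is the trivial model on the product vector space; in this
  -- guise the immersion criterion without product models applies.
  let _ : ChartedSpace (F × F') (M × M') := prodChartedSpace F M F' M'
  have hm : IsManifold (𝓘(ℝ, F).prod 𝓘(ℝ, F')) ∞ (M × M') := inferInstance
  rw [← modelWithCornersSelf_prod] at hf hinj hm ⊢
  exact hf.isImmersion_of_injective_mfderiv hinj hk

/-- The antidiagonal embedding of the sphere. -/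
def antidiagonalMap (x : S2) : S2 × S2 := (x, -x)

lemma contMDiff_antidiagonalMap : ContMDiff (𝓡 2) ((𝓡 2).prod (𝓡 2)) ∞ antidiagonalMap :=
  have := Fact.mk (@finrank_euclideanSpace_fin ℝ _ (2 + 1))
  contMDiff_id.prodMk contMDiff_neg_sphere

theorem isSmoothEmbedding_antidiagonalMap :
    Manifold.IsSmoothEmbedding (𝓡 2) ((𝓡 2).prod (𝓡 2)) ∞ antidiagonalMap where
  isImmersion := contMDiff_antidiagonalMap.isImmersion_prod_of_injective_mfderiv (k := 2)
    (fun x => injective_mfderiv_of_comp (I'' := 𝓡 2) (g := Prod.fst)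
      (contMDiff_antidiagonalMap.mdifferentiableAt (by simp)) mdifferentiableAt_fst (by
        have : Prod.fst ∘ antidiagonalMap = id := rfl
        rw [this, mfderiv_id]
        exact Function.injective_id)) (by simp)
  isEmbedding := (contMDiff_antidiagonalMap.continuous.isClosedEmbedding
    fun x y h => congrArg Prod.fst h).isEmbedding

/-- The antidiagonal as a closed submanifold. -/
def antidiagonalPresentation : ClosedSubmanifold ((𝓡 2).prod (𝓡 2)) 2 antidiagonalSphere where
  ModelSpace := EuclideanSpace ℝ (Fin 2)
  ModelTop := EuclideanSpace ℝ (Fin 2)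
  model := 𝓡 2
  N := S2
  finrank_eq := by simp
  emb := antidiagonalMap
  isSmoothEmbedding := isSmoothEmbedding_antidiagonalMap
  range_eq := by
    ext p
    constructor
    · rintro ⟨x, rfl⟩
      rfl
    · intro hp
      exact ⟨p.1, Prod.ext rfl (Eq.symm hp)⟩

/-- The unit circle in the plane. -/
abbrev S1 : Type := Metric.sphere (0 : EuclideanSpace ℝ (Fin 2)) 1

/-- The inclusion of the plane in space. -/
def planeInclusion : EuclideanSpace ℝ (Fin 2) →L[ℝ] EuclideanSpace ℝ (Fin 3) :=
  LinearMap.toContinuousLinearMap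
    { toFun := fun x => !₂[x 0, x 1, 0]
      map_add' := fun x y => by ext i; fin_cases i <;> simp
      map_smul' := fun a x => by ext i; fin_cases i <;> simp }

@[simp] lemma planeInclusion_apply (x : EuclideanSpace ℝ (Fin 2)) :
    planeInclusion x = !₂[x 0, x 1, 0] := rfl

lemma planeInclusion_injective : Function.Injective planeInclusion := fun x y h => by
  have h0 := congrArg (fun v : EuclideanSpace ℝ (Fin 3) => v 0) h
  have h1 := congrArg (fun v : EuclideanSpace ℝ (Fin 3) => v 1) h
  ext i
  fin_cases i
  · simpa using h0
  · simpa using h1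

lemma planeInclusion_mem_sphere (x : S1) :
    planeInclusion x.1 ∈ Metric.sphere (0 : EuclideanSpace ℝ (Fin 3)) 1 := by
  have h := x.2
  rw [mem_sphere_zero_iff_norm, EuclideanSpace.norm_eq, Real.sqrt_eq_one] at h ⊢
  simpa [Fin.sum_univ_succ] using h

/-- The equator of the sphere. -/
def equatorMap (x : S1) : S2 := ⟨planeInclusion x.1, planeInclusion_mem_sphere x⟩

lemma contMDiff_equatorMap : ContMDiff (𝓡 1) (𝓡 2) ∞ equatorMap :=
  have := Fact.mk (@finrank_euclideanSpace_fin ℝ _ (2 + 1))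
  (planeInclusion.contDiff.contMDiff.comp (contMDiff_coe_sphere_fin 1)).codRestrict_sphere
    planeInclusion_mem_sphere

lemma mfderiv_clm_comp_apply {E E' E'' : Type} [NormedAddCommGroup E] [NormedSpace ℝ E]
    [NormedAddCommGroup E'] [NormedSpace ℝ E'] [NormedAddCommGroup E''] [NormedSpace ℝ E'']
    {H : Type} [TopologicalSpace H] {I : ModelWithCorners ℝ E H} {M : Type} [TopologicalSpace M]
    [ChartedSpace H M] (A : E' →L[ℝ] E'') {f : M → E'} {x : M}
    (hf : MDifferentiableAt I 𝓘(ℝ, E') f x) (v : TangentSpace I x) :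
    (mfderiv I 𝓘(ℝ, E'') (A ∘ f) x v : E'') = A (mfderiv I 𝓘(ℝ, E') f x v : E') := by
  rw [mfderiv_comp x A.differentiableAt.mdifferentiableAt hf, mfderiv_eq_fderiv, A.fderiv]
  rfl

theorem isSmoothEmbedding_equatorMap : Manifold.IsSmoothEmbedding (𝓡 1) (𝓡 2) ∞ equatorMap where
  isImmersion := contMDiff_equatorMap.isImmersion_of_injective_mfderiv (k := 1)
    (fun x => injective_mfderiv_of_comp (I'' := 𝓘(ℝ, EuclideanSpace ℝ (Fin 3))) (g := Subtype.val)
      (contMDiff_equatorMap.mdifferentiableAt (by simp))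
      ((contMDiff_coe_sphere_fin 2).mdifferentiableAt (by simp)) (fun u v h => by
        have e := mfderiv_clm_comp_apply planeInclusion (x := x)
          ((contMDiff_coe_sphere_fin 1).mdifferentiableAt (by simp))
        exact mfderiv_coe_sphere_fin_injective 1 x
          (planeInclusion_injective (((e u).symm.trans h).trans (e v))))) (by simp)
  isEmbedding := (contMDiff_equatorMap.continuous.isClosedEmbedding fun x y h =>
    Subtype.ext (planeInclusion_injective (congrArg Subtype.val h))).isEmbedding

lemma range_equatorMap : range equatorMap = {x : S2 | x.1 2 = 0} := by
  ext x
  constructor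
  · rintro ⟨y, rfl⟩
    rfl
  · intro hx
    have hx' : x.1 2 = 0 := hx
    refine ⟨⟨!₂[x.1 0, x.1 1], ?_⟩, ?_⟩
    · have h := x.2
      rw [mem_sphere_zero_iff_norm, EuclideanSpace.norm_eq, Real.sqrt_eq_one] at h ⊢
      simpa [Fin.sum_univ_three, hx'] using h
    · apply Subtype.ext
      change planeInclusion _ = x.1
      ext i
      fin_cases i <;> simp [hx']

/-- The Clifford torus as a closed submanifold. -/
def cliffordPresentation : ClosedSubmanifold ((𝓡 2).prod (𝓡 2)) 2 cliffordTorus where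
  ModelSpace := EuclideanSpace ℝ (Fin 1) × EuclideanSpace ℝ (Fin 1)
  ModelTop := ModelProd (EuclideanSpace ℝ (Fin 1)) (EuclideanSpace ℝ (Fin 1))
  model := (𝓡 1).prod (𝓡 1)
  N := S1 × S1
  finrank_eq := by simp
  emb := Prod.map equatorMap equatorMap
  isSmoothEmbedding := isSmoothEmbedding_equatorMap.prodMap isSmoothEmbedding_equatorMap
  range_eq := by
    rw [range_prodMap, range_equatorMap]
    rfl

lemma pullback_splitForm_apply {E : Type} [NormedAddCommGroup E] [NormedSpace ℝ E] {H : Type}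
    [TopologicalSpace H] {I : ModelWithCorners ℝ E H} {N : Type} [TopologicalSpace N]
    [ChartedSpace H N] (c : ℝ) {f : N → S2 × S2} {x : N}
    (hf : MDifferentiableAt I ((𝓡 2).prod (𝓡 2)) f x) (u v : TangentSpace I x) :
    (splitForm c).pullback I f x u v =
      c * spaceAreaForm (f x).1.1
        (mfderiv I 𝓘(ℝ, EuclideanSpace ℝ (Fin 3)) (Subtype.val ∘ Prod.fst ∘ f) x u)
        (mfderiv I 𝓘(ℝ, EuclideanSpace ℝ (Fin 3)) (Subtype.val ∘ Prod.fst ∘ f) x v) +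
      c * spaceAreaForm (f x).2.1
        (mfderiv I 𝓘(ℝ, EuclideanSpace ℝ (Fin 3)) (Subtype.val ∘ Prod.snd ∘ f) x u)
        (mfderiv I 𝓘(ℝ, EuclideanSpace ℝ (Fin 3)) (Subtype.val ∘ Prod.snd ∘ f) x v) := by
  have h1 := TwoForm.pullback_pullback_apply (I'' := I) (I' := 𝓡 2)
    (I := 𝓘(ℝ, EuclideanSpace ℝ (Fin 3))) (g := Prod.fst ∘ f) spaceAreaForm (x := x)
    ((contMDiff_coe_sphere_fin 2).mdifferentiableAt (by simp)) (mdifferentiableAt_fst.comp x hf) u v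
  have h2 := TwoForm.pullback_pullback_apply (I'' := I) (I' := 𝓡 2)
    (I := 𝓘(ℝ, EuclideanSpace ℝ (Fin 3))) (g := Prod.snd ∘ f) spaceAreaForm (x := x)
    ((contMDiff_coe_sphere_fin 2).mdifferentiableAt (by simp)) (mdifferentiableAt_snd.comp x hf) u v
  exact (TwoForm.pullback_prod_apply _ _ hf u v).trans
    (congrArg₂ (· + ·) (congrArg (c * ·) h1) (congrArg (c * ·) h2))

/-- The antipodal map reverses the area form, a determinant of three vectors that all change sign,
so the contributions of the two factors cancel. -/
theorem isClosedLagrangian_antidiagonalSphere (c : ℝ) :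
    IsClosedLagrangian (splitForm c) 2 antidiagonalSphere := by
  refine ⟨antidiagonalPresentation, ?_⟩
  funext x
  refine ContinuousLinearMap.ext fun u => ContinuousLinearMap.ext fun v => ?_
  refine (pullback_splitForm_apply (I := 𝓡 2) c
    (contMDiff_antidiagonalMap.mdifferentiableAt (by simp)) u v).trans ?_
  have e : ∀ w, (mfderiv (𝓡 2) 𝓘(ℝ, EuclideanSpace ℝ (Fin 3))
      (Subtype.val ∘ Prod.snd ∘ antidiagonalMap) x w : EuclideanSpace ℝ (Fin 3)) =
      -(mfderiv (𝓡 2) 𝓘(ℝ, EuclideanSpace ℝ (Fin 3)) (Subtype.val : S2 → _) x w :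
        EuclideanSpace ℝ (Fin 3)) := fun w =>
    mfderiv_clm_comp_apply (-ContinuousLinearMap.id ℝ (EuclideanSpace ℝ (Fin 3)))
      ((contMDiff_coe_sphere_fin 2).mdifferentiableAt (by simp)) w
  refine (congrArg₂ (· + ·) rfl (congrArg₂ (fun a b => c * spaceAreaForm _ a b) (e u) (e v))).trans
    ?_
  have h : ∀ x a b : EuclideanSpace ℝ (Fin 3),
      c * spaceAreaForm x a b + c * spaceAreaForm (-x) (-a) (-b) = 0 := fun x a b => by
    simp only [spaceAreaForm_apply, PiLp.neg_apply]
    ring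
  exact h _ _ _

/-- In each factor the point and both tangent vectors lie in the plane of the equator, so each
determinant vanishes separately. -/
theorem isClosedLagrangian_cliffordTorus (c : ℝ) :
    IsClosedLagrangian (splitForm c) 2 cliffordTorus := by
  refine ⟨cliffordPresentation, ?_⟩
  funext x
  refine ContinuousLinearMap.ext fun u => ContinuousLinearMap.ext fun v => ?_
  have hf : ContMDiff ((𝓡 1).prod (𝓡 1)) ((𝓡 2).prod (𝓡 2)) ∞ (Prod.map equatorMap equatorMap) :=
    contMDiff_equatorMap.prodMap contMDiff_equatorMap
  refine (pullback_splitForm_apply (I := (𝓡 1).prod (𝓡 1)) c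
    (hf.mdifferentiableAt (by simp)) u v).trans ?_
  have h : ∀ x a b : EuclideanSpace ℝ (Fin 2),
      spaceAreaForm (planeInclusion x) (planeInclusion a) (planeInclusion b) = 0 := fun x a b => by
    simp [spaceAreaForm_apply]
  have e1 : ∀ w, (mfderiv ((𝓡 1).prod (𝓡 1)) 𝓘(ℝ, EuclideanSpace ℝ (Fin 3))
      (Subtype.val ∘ Prod.fst ∘ Prod.map equatorMap equatorMap) x w : EuclideanSpace ℝ (Fin 3)) = _ :=
    fun w => mfderiv_clm_comp_apply planeInclusion (f := (Subtype.val : S1 → _) ∘ Prod.fst)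
      (((contMDiff_coe_sphere_fin 1).comp contMDiff_fst).mdifferentiableAt (by simp)) w
  have e2 : ∀ w, (mfderiv ((𝓡 1).prod (𝓡 1)) 𝓘(ℝ, EuclideanSpace ℝ (Fin 3))
      (Subtype.val ∘ Prod.snd ∘ Prod.map equatorMap equatorMap) x w : EuclideanSpace ℝ (Fin 3)) = _ :=
    fun w => mfderiv_clm_comp_apply planeInclusion (f := (Subtype.val : S1 → _) ∘ Prod.snd)
      (((contMDiff_coe_sphere_fin 1).comp contMDiff_snd).mdifferentiableAt (by simp)) w
  refine (congrArg₂ (· + ·) (congrArg₂ (fun a b => c * spaceAreaForm _ a b) (e1 u) (e1 v))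
    (congrArg₂ (fun a b => c * spaceAreaForm _ a b) (e2 u) (e2 v))).trans ?_
  refine (congrArg₂ (· + ·) (congrArg (c * ·) (h _ _ _)) (congrArg (c * ·) (h _ _ _))).trans ?_
  simp

end Presentations

/-! ### Regular superlevel sets as manifolds with boundary -/

section Superlevel

/-- A smooth function on a Euclidean space for which zero is a regular value. -/
structure RegularFunction (n : ℕ) where
  toFun : EuclideanSpace ℝ (Fin (n + 1)) → ℝ
  contDiff : ContDiff ℝ ∞ toFun
  fderiv_ne_zero : ∀ x, toFun x = 0 → fderiv ℝ toFun x ≠ 0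

/-- The set where a regular function is nonnegative. -/
structure RegularFunction.Superlevel {n : ℕ} (g : RegularFunction n) : Type where
  point : EuclideanSpace ℝ (Fin (n + 1))
  nonneg : 0 ≤ g.toFun point

variable {n : ℕ} (g : RegularFunction n)

namespace RegularFunction

/-- The inclusion of the superlevel set. -/
def val (y : g.Superlevel) : EuclideanSpace ℝ (Fin (n + 1)) := y.point

lemma val_injective : Function.Injective g.val := fun ⟨_, _⟩ ⟨_, _⟩ h => by
  cases h
  rfl

lemma val_nonneg (y : g.Superlevel) : 0 ≤ g.toFun (g.val y) := y.2

instance : TopologicalSpace g.Superlevel := TopologicalSpace.induced g.val inferInstance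

lemma isEmbedding_val : Topology.IsEmbedding g.val := ⟨⟨rfl⟩, g.val_injective⟩

lemma continuous_val : Continuous g.val := g.isEmbedding_val.continuous

instance : T2Space g.Superlevel := g.isEmbedding_val.t2Space

lemma range_val : range g.val = {x | 0 ≤ g.toFun x} := by
  ext x
  exact ⟨fun ⟨y, hy⟩ => hy ▸ g.val_nonneg y, fun hx => ⟨⟨x, hx⟩, rfl⟩⟩

open Classical in
/-- The point `x` of the superlevel set, or `y₀` if `x` does not belong to it. -/
def retract (y₀ : g.Superlevel) (x : EuclideanSpace ℝ (Fin (n + 1))) : g.Superlevel :=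
  if h : 0 ≤ g.toFun x then ⟨x, h⟩ else y₀

lemma val_retract (y₀ : g.Superlevel) {x : EuclideanSpace ℝ (Fin (n + 1))} (h : 0 ≤ g.toFun x) :
    g.val (g.retract y₀ x) = x := by
  rw [retract, dif_pos h]
  rfl

/-- Local coordinates adapted to the superlevel set: it is given by nonnegativity of the coordinate
of index zero. -/
structure IsAdapted
    (e : OpenPartialHomeomorph (EuclideanSpace ℝ (Fin (n + 1))) (EuclideanSpace ℝ (Fin (n + 1)))) :
    Prop where
  contDiffOn : ContDiffOn ℝ ∞ e e.source
  contDiffOn_symm : ContDiffOn ℝ ∞ e.symm e.target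
  nonneg_iff : ∀ x ∈ e.source, 0 ≤ g.toFun x ↔ 0 ≤ e x 0
  eq_zero_iff : ∀ x ∈ e.source, g.toFun x = 0 ↔ e x 0 = 0

/-- Where the function vanishes, regularity lets it serve as the coordinate of index zero. Where it
is positive, a translation makes that coordinate positive nearby, so both sign conditions hold
trivially. -/
theorem exists_isAdapted (y : g.Superlevel) : ∃ e, g.IsAdapted e ∧ g.val y ∈ e.source := by
  rcases (g.val_nonneg y).eq_or_lt with h0 | hpos
  · set p := g.val y with hp
    set w := (InnerProductSpace.toDual ℝ _).symm (fderiv ℝ g.toFun p) with hw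
    have hw0 : w ≠ 0 := by simpa [hw] using g.fderiv_ne_zero p h0.symm
    -- `B` carries the basis vector of index zero to the gradient, so the adjoint of `B` is an
    -- isomorphism whose coordinate of index zero is the differential.
    obtain ⟨B, hB⟩ := SeparatingDual.exists_continuousLinearEquiv_apply_eq (R := ℝ)
      (x := EuclideanSpace.single (0 : Fin (n + 1)) (1 : ℝ)) (by simp) hw0
    let A := ContinuousLinearEquiv.equivOfInverse
      (ContinuousLinearMap.adjoint (B : EuclideanSpace ℝ (Fin (n + 1)) →L[ℝ] _))
      (ContinuousLinearMap.adjoint (B.symm : EuclideanSpace ℝ (Fin (n + 1)) →L[ℝ] _))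
      (fun x => ext_inner_left ℝ fun v => by simp [ContinuousLinearMap.adjoint_inner_right])
      (fun x => ext_inner_left ℝ fun v => by simp [ContinuousLinearMap.adjoint_inner_right])
    have hA (x) : A x 0 = fderiv ℝ g.toFun p x := by
      have h1 : inner ℝ (EuclideanSpace.single (0 : Fin (n + 1)) (1 : ℝ)) (A x) = A x 0 := by
        simp [EuclideanSpace.inner_single_left]
      rw [← h1]
      change inner ℝ _ (ContinuousLinearMap.adjoint (B : EuclideanSpace ℝ (Fin (n + 1)) →L[ℝ] _) x)
        = _
      rw [ContinuousLinearMap.adjoint_inner_right, ContinuousLinearEquiv.coe_coe, hB, hw,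
        InnerProductSpace.toDual_symm_apply]
    -- The linear part is corrected so that the coordinate of index zero is exactly the given
    -- function; the correction has zero derivative at `p`.
    set f : EuclideanSpace ℝ (Fin (n + 1)) → EuclideanSpace ℝ (Fin (n + 1)) := fun x =>
      A x + (g.toFun x - fderiv ℝ g.toFun p x) • EuclideanSpace.single (0 : Fin (n + 1)) (1 : ℝ)
      with hf
    have hf0 (x) : f x 0 = g.toFun x := by simp [hf, hA]
    have hfs : ContDiff ℝ ∞ f := by
      have := g.contDiff
      fun_prop
    have hfd : HasFDerivAt f (A : EuclideanSpace ℝ (Fin (n + 1)) →L[ℝ] _) p := by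
      have h1 := ((g.contDiff.differentiable (by simp)) p).hasFDerivAt
      have h2 := A.toContinuousLinearMap.hasFDerivAt (x := p) |>.add
        ((h1.sub (fderiv ℝ g.toFun p).hasFDerivAt).smul_const
          (EuclideanSpace.single (0 : Fin (n + 1)) (1 : ℝ)))
      refine h2.congr_fderiv ?_
      ext v
      simp
    obtain ⟨e, he, hpe, -, h1, h2⟩ :=
      hfs.contDiffOn.exists_openPartialHomeomorph isOpen_univ (mem_univ p) hfd
    exact ⟨e, ⟨h1, h2, fun x _ => by rw [he, hf0], fun x _ => by rw [he, hf0]⟩, hpe⟩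
  · set p := g.val y with hp
    -- The translation gives `p` the value `1` in the coordinate of index zero.
    set f : EuclideanSpace ℝ (Fin (n + 1)) → EuclideanSpace ℝ (Fin (n + 1)) := fun x =>
      x + (1 - p 0) • EuclideanSpace.single (0 : Fin (n + 1)) (1 : ℝ) with hf
    have hf0 (x) : f x 0 = x 0 + (1 - p 0) := by simp [hf]
    have hfs : ContDiff ℝ ∞ f := by fun_prop
    have hc0 : Continuous fun x => f x 0 := by
      simp only [hf0]
      fun_prop
    have hU : IsOpen {x | 0 < g.toFun x ∧ 0 < f x 0} :=
      (isOpen_lt continuous_const g.contDiff.continuous).inter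
        (isOpen_lt continuous_const hc0)
    have hfd : HasFDerivAt f ((ContinuousLinearEquiv.refl ℝ (EuclideanSpace ℝ (Fin (n + 1))) :
        _ ≃L[ℝ] EuclideanSpace ℝ (Fin (n + 1))) : _ →L[ℝ] EuclideanSpace ℝ (Fin (n + 1))) p :=
      (hasFDerivAt_id p).add_const ((1 - p 0) • EuclideanSpace.single (0 : Fin (n + 1)) (1 : ℝ))
    obtain ⟨e, he, hpe, hs, h1, h2⟩ :=
      hfs.contDiffOn.exists_openPartialHomeomorph hU ⟨hpos, by simp [hf0]⟩ hfd
    refine ⟨e, ⟨h1, h2, fun x hx => ?_, fun x hx => ?_⟩, hpe⟩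
    · rw [he]
      exact iff_of_true (hs hx).1.le (hs hx).2.le
    · rw [he]
      exact iff_of_false (hs hx).1.ne' (hs hx).2.ne'

variable {g}
variable {e e' : OpenPartialHomeomorph (EuclideanSpace ℝ (Fin (n + 1)))
  (EuclideanSpace ℝ (Fin (n + 1)))}

lemma IsAdapted.toFun_symm_nonneg (h : g.IsAdapted e) {u : EuclideanHalfSpace (n + 1)}
    (hu : u.1 ∈ e.target) : 0 ≤ g.toFun (e.symm u.1) := by
  rw [h.nonneg_iff _ (e.map_target hu), e.right_inv hu]
  exact u.2

lemma IsAdapted.val_modelSymm (h : g.IsAdapted e) {y : g.Superlevel} (hy : g.val y ∈ e.source) :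
    ((𝓡∂ (n + 1)).symm (e (g.val y))).1 = e (g.val y) :=
  (𝓡∂ (n + 1)).right_inv (by
    rw [range_modelWithCornersEuclideanHalfSpace]
    exact (h.nonneg_iff _ hy).1 (g.val_nonneg y))

/-- The chart of the superlevel set in adapted coordinates. The point `y₀` only serves as a value
outside of the domain. -/
def IsAdapted.chart (h : g.IsAdapted e) (y₀ : g.Superlevel) :
    OpenPartialHomeomorph g.Superlevel (EuclideanHalfSpace (n + 1)) where
  toFun y := (𝓡∂ (n + 1)).symm (e (g.val y))
  invFun u := g.retract y₀ (e.symm u.1)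
  source := g.val ⁻¹' e.source
  target := Subtype.val ⁻¹' e.target
  map_source' y hy := by
    rw [mem_preimage, h.val_modelSymm hy]
    exact e.map_source hy
  map_target' u hu := by
    rw [mem_preimage, g.val_retract y₀ (h.toFun_symm_nonneg hu)]
    exact e.map_target hu
  left_inv' y hy := by
    have h2 : e.symm ((𝓡∂ (n + 1)).symm (e (g.val y))).1 = g.val y := by
      rw [h.val_modelSymm hy, e.left_inv hy]
    rw [h2]
    exact g.val_injective (g.val_retract y₀ (g.val_nonneg y))
  right_inv' u hu := by
    rw [g.val_retract y₀ (h.toFun_symm_nonneg hu), e.right_inv hu]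
    exact (𝓡∂ (n + 1)).left_inv u
  open_source := e.open_source.preimage g.continuous_val
  open_target := e.open_target.preimage continuous_subtype_val
  continuousOn_toFun := (𝓡∂ (n + 1)).continuous_symm.comp_continuousOn
    (e.continuousOn.comp g.continuous_val.continuousOn fun _ hy => hy)
  continuousOn_invFun := by
    have hc : ContinuousOn (fun u : EuclideanHalfSpace (n + 1) => e.symm u.1)
        (Subtype.val ⁻¹' e.target) :=
      e.continuousOn_symm.comp continuous_subtype_val.continuousOn fun _ hu => hu
    rw [g.isEmbedding_val.continuousOn_iff]
    exact hc.congr fun u hu => g.val_retract y₀ (h.toFun_symm_nonneg hu)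

lemma IsAdapted.val_chart (h : g.IsAdapted e) (y₀ : g.Superlevel) {y : g.Superlevel}
    (hy : g.val y ∈ e.source) : (h.chart y₀ y).1 = e (g.val y) :=
  h.val_modelSymm hy

lemma IsAdapted.val_chart_symm (h : g.IsAdapted e) (y₀ : g.Superlevel)
    {u : EuclideanHalfSpace (n + 1)} (hu : u.1 ∈ e.target) :
    g.val ((h.chart y₀).symm u) = e.symm u.1 :=
  g.val_retract y₀ (h.toFun_symm_nonneg hu)

variable (g)

instance : ChartedSpace (EuclideanHalfSpace (n + 1)) g.Superlevel where
  atlas := {φ | ∃ (e : _) (h : g.IsAdapted e) (y₀ : g.Superlevel), φ = h.chart y₀}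
  chartAt y := (g.exists_isAdapted y).choose_spec.1.chart y
  mem_chart_source _ := (g.exists_isAdapted _).choose_spec.2
  chart_mem_atlas _ := ⟨_, _, _, rfl⟩

instance : IsManifold (𝓡∂ (n + 1)) ∞ g.Superlevel := by
  refine isManifold_of_contDiffOn _ _ _ ?_
  rintro _ _ ⟨e, h, y, rfl⟩ ⟨e', h', y', rfl⟩
  have key : ∀ u ∈ (𝓡∂ (n + 1)).symm ⁻¹' ((h.chart y).symm.trans (h'.chart y')).source ∩
      range (𝓡∂ (n + 1)), u ∈ e.target ∧ e.symm u ∈ e'.source ∧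
      ((h.chart y).symm.trans (h'.chart y') ((𝓡∂ (n + 1)).symm u)).1 = e' (e.symm u) := by
    rintro _ ⟨⟨hu1, hu2⟩, ⟨u, rfl⟩⟩
    rw [(𝓡∂ (n + 1)).left_inv] at hu1 hu2 ⊢
    have hu1' : u.1 ∈ e.target := hu1
    have h3 := h.val_chart_symm y hu1'
    have h4 : g.val ((h.chart y).symm u) ∈ e'.source := hu2
    refine ⟨hu1', h3 ▸ h4, ?_⟩
    exact (h'.val_chart y' h4).trans (congrArg e' h3)
  refine ((h'.contDiffOn.comp (h.contDiffOn_symm.mono inter_subset_left)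
    fun u (hu : u ∈ e.target ∩ e.symm ⁻¹' e'.source) => hu.2).mono
    fun u hu => ⟨(key u hu).1, (key u hu).2.1⟩).congr fun u hu => (key u hu).2.2

theorem mem_boundary_iff (y : g.Superlevel) :
    y ∈ (𝓡∂ (n + 1)).boundary g.Superlevel ↔ g.toFun (g.val y) = 0 := by
  have h := (g.exists_isAdapted y).choose_spec
  have h1 : extChartAt (𝓡∂ (n + 1)) y y = (g.exists_isAdapted y).choose (g.val y) :=
    h.1.val_chart y h.2
  change (𝓡∂ (n + 1)).IsBoundaryPoint y ↔ _
  rw [ModelWithCorners.isBoundaryPoint_iff, h1,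
    frontier_range_modelWithCornersEuclideanHalfSpace, h.1.eq_zero_iff _ h.2]
  exact eq_comm

/-- An immersion in the boundary of the superlevel set. -/
theorem isImmersion_of_injective_mfderiv {E : Type} [NormedAddCommGroup E] [NormedSpace ℝ E]
    [FiniteDimensional ℝ E] (hn : finrank ℝ E = n) {N : Type} [TopologicalSpace N]
    [ChartedSpace E N] [IsManifold 𝓘(ℝ, E) ∞ N] {j : N → g.Superlevel}
    (hj : ContMDiff 𝓘(ℝ, E) 𝓘(ℝ, EuclideanSpace ℝ (Fin (n + 1))) ∞ (g.val ∘ j))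
    (hinj : ∀ x, Function.Injective
      (mfderiv 𝓘(ℝ, E) 𝓘(ℝ, EuclideanSpace ℝ (Fin (n + 1))) (g.val ∘ j) x))
    (h0 : ∀ x, g.toFun (g.val (j x)) = 0) :
    Manifold.IsImmersion 𝓘(ℝ, E) (𝓡∂ (n + 1)) ∞ j := by
  let π : EuclideanSpace ℝ (Fin (n + 1)) →L[ℝ] ℝ := EuclideanSpace.proj 0
  have hπ : finrank ℝ π.toLinearMap.ker = n := by
    have h1 := π.toLinearMap.finrank_range_add_finrank_ker
    have h2 : π.toLinearMap.range = ⊤ := LinearMap.range_eq_top.2 fun t =>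
      ⟨EuclideanSpace.single 0 t, by simp [π]⟩
    rw [h2, finrank_top, finrank_self, finrank_euclideanSpace_fin] at h1
    omega
  let B : E ≃L[ℝ] π.toLinearMap.ker := ContinuousLinearEquiv.ofFinrankEq (hn.trans hπ.symm)
  let A : E →L[ℝ] EuclideanSpace ℝ (Fin (n + 1)) := π.toLinearMap.ker.subtypeL.comp B.toContinuousLinearMap
  have hA : Function.Injective A := Subtype.val_injective.comp B.injective
  -- `K` identifies the first factor with the hyperplane where the coordinate of index zero
  -- vanishes, that is, with the boundary in adapted coordinates.
  obtain ⟨K, hK⟩ := exists_equiv_prod_of_injective hA (k := 1) (by simp [hn])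
  have hK' (z : EuclideanSpace ℝ (Fin (n + 1))) (hz : z 0 = 0) : z = K ((K.symm z).1, 0) := by
    have hz' : A (B.symm ⟨z, hz⟩) = z := by simp [A]
    rw [← hK] at hz'
    conv_rhs => rw [← hz', K.symm_apply_apply, hz']
  refine ⟨EuclideanSpace ℝ (Fin 1), inferInstance, inferInstance, fun x => ?_⟩
  have he := (g.exists_isAdapted (j x)).choose_spec
  set e := (g.exists_isAdapted (j x)).choose with he_def
  set S : Set N := (g.val ∘ j) ⁻¹' e.source with hS_def
  have hS : IsOpen S := e.open_source.preimage hj.continuous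
  set h : N → E := fun y => (K.symm (e (g.val (j y)))).1 with h_def
  have hh : ContMDiffOn 𝓘(ℝ, E) 𝓘(ℝ, E) ∞ h S := by
    have h1 : ContDiff ℝ ∞ (fun z => (K.symm z).1) := by fun_prop
    exact (h1.comp_contDiffOn he.1.contDiffOn).contMDiffOn.comp hj.contMDiffOn fun y hy => hy
  have heh : ∀ y ∈ S, e (g.val (j y)) = K (h y, 0) := fun y hy =>
    hK' _ ((he.1.eq_zero_iff _ hy).1 (h0 y))
  have hx : x ∈ S := he.2
  have hF : g.val ∘ j =ᶠ[nhds x] (fun u => e.symm (K (u, 0))) ∘ h := by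
    filter_upwards [hS.mem_nhds hx] with y hy
    change _ = e.symm (K (h y, 0))
    rw [← heh y hy]
    exact (e.left_inv hy).symm
  have hd : MDifferentiableAt 𝓘(ℝ, E) 𝓘(ℝ, E) h x :=
    (hh.contMDiffAt (hS.mem_nhds hx)).mdifferentiableAt (by simp)
  have hd' : MDifferentiableAt 𝓘(ℝ, E) 𝓘(ℝ, EuclideanSpace ℝ (Fin (n + 1)))
      (fun u => e.symm (K (u, 0))) (h x) := by
    have h1 : ContDiffAt ℝ ∞ e.symm (K (h x, 0)) :=
      he.1.contDiffOn_symm.contDiffAt (e.open_target.mem_nhds (by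
        rw [← heh x hx]
        exact e.map_source hx))
    have h2 : ContDiffAt ℝ ∞ (fun u : E => K (u, 0)) (h x) := ContDiff.contDiffAt (by fun_prop)
    exact ((h1.comp (h x) h2).differentiableAt (by simp)).mdifferentiableAt
  -- The map `h` reads the immersion in boundary coordinates. Since `g.val ∘ j` factors locally
  -- through `h`, its derivative is injective and `h` itself serves as a chart of `N`.
  obtain ⟨φ, hφ, hxφ, hφS, hφh⟩ := exists_chart_of_injective_mfderiv hS hh hx
    (injective_mfderiv_of_comp hd hd' (by
      have := hinj x
      rwa [hF.mfderiv_eq] at this))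
  refine .mk_of_charts K φ (chartAt _ (j x)) hxφ (mem_chart_source _ (j x)) hφ
    (IsManifold.chart_mem_maximalAtlas (j x)) hφS fun u hu => ?_
  have hu' : u ∈ φ.target := by simpa using hu
  have h1 := φ.map_target hu'
  change (he.1.chart (j x) (j (φ.symm u))).1 = K (u, 0)
  rw [he.1.val_chart _ (hφS h1), heh _ (hφS h1), ← hφh _ h1, φ.right_inv hu']

/-- An immersion of a product of two manifolds in the boundary of the superlevel set. -/
theorem isImmersion_of_prod_of_injective_mfderiv {E E' : Type} [NormedAddCommGroup E]
    [NormedSpace ℝ E] [FiniteDimensional ℝ E] [NormedAddCommGroup E'] [NormedSpace ℝ E']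
    [FiniteDimensional ℝ E'] (hn : finrank ℝ (E × E') = n) {N N' : Type} [TopologicalSpace N]
    [ChartedSpace E N] [IsManifold 𝓘(ℝ, E) ∞ N] [TopologicalSpace N'] [ChartedSpace E' N']
    [IsManifold 𝓘(ℝ, E') ∞ N'] {j : N × N' → g.Superlevel}
    (hj : ContMDiff (𝓘(ℝ, E).prod 𝓘(ℝ, E')) 𝓘(ℝ, EuclideanSpace ℝ (Fin (n + 1))) ∞ (g.val ∘ j))
    (hinj : ∀ x, Function.Injective
      (mfderiv (𝓘(ℝ, E).prod 𝓘(ℝ, E')) 𝓘(ℝ, EuclideanSpace ℝ (Fin (n + 1))) (g.val ∘ j) x))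
    (h0 : ∀ x, g.toFun (g.val (j x)) = 0) :
    Manifold.IsImmersion (𝓘(ℝ, E).prod 𝓘(ℝ, E')) (𝓡∂ (n + 1)) ∞ j := by
  let _ : ChartedSpace (E × E') (N × N') := prodChartedSpace E N E' N'
  have hm : IsManifold (𝓘(ℝ, E).prod 𝓘(ℝ, E')) ∞ (N × N') := inferInstance
  rw [← modelWithCornersSelf_prod] at hj hinj hm ⊢
  exact g.isImmersion_of_injective_mfderiv hn hj hinj h0

end RegularFunction

end Superlevel

/-! ### The sphere and the torus are smoothly cobordant -/

section SmoothCobordism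

/-- The function `16 (x² + y²) - (|p|² + 3)²` on space, whose zero set is a torus of revolution. -/
def torusFun (p : EuclideanSpace ℝ (Fin 3)) : ℝ :=
  16 * (p 0 ^ 2 + p 1 ^ 2) - (p 0 ^ 2 + p 1 ^ 2 + p 2 ^ 2 + 3) ^ 2

/-- The function `1 / 4 - |p|²` on space. -/
def ballFun (p : EuclideanSpace ℝ (Fin 3)) : ℝ := 1 / 4 - (p 0 ^ 2 + p 1 ^ 2 + p 2 ^ 2)

lemma contDiff_torusFun : ContDiff ℝ ∞ torusFun := by
  unfold torusFun
  fun_prop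

lemma contDiff_ballFun : ContDiff ℝ ∞ ballFun := by
  unfold ballFun
  fun_prop

/-- The ball of radius `1 / 2` lies in the hole of the solid torus with core radius `2` and tube
radius `1`. Hence the product of the two functions is nonpositive exactly on the disjoint union of
the ball and the solid torus. -/
lemma torusFun_neg_of_ballFun_nonneg {p : EuclideanSpace ℝ (Fin 3)} (h : 0 ≤ ballFun p) :
    torusFun p < 0 := by
  unfold torusFun
  unfold ballFun at h
  nlinarith [sq_nonneg (p 0), sq_nonneg (p 1), sq_nonneg (p 2)]

lemma hasDerivAt_ballFun (p v : EuclideanSpace ℝ (Fin 3)) :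
    HasDerivAt (fun τ : ℝ => ballFun (p + τ • v))
      (-2 * (p 0 * v 0 + p 1 * v 1 + p 2 * v 2)) 0 := by
  have h (i : Fin 3) : HasDerivAt (fun τ : ℝ => (p + τ • v) i) (v i) 0 := by
    simpa using ((hasDerivAt_id (0 : ℝ)).mul_const (v i)).const_add (p i)
  have := ((((h 0).pow 2).add ((h 1).pow 2)).add ((h 2).pow 2)).const_sub (1 / 4 : ℝ)
  refine this.congr_deriv ?_
  simp
  ring

lemma hasDerivAt_torusFun (p v : EuclideanSpace ℝ (Fin 3)) :
    HasDerivAt (fun τ : ℝ => torusFun (p + τ • v))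
      (32 * (p 0 * v 0 + p 1 * v 1) - 4 * (p 0 ^ 2 + p 1 ^ 2 + p 2 ^ 2 + 3) *
        (p 0 * v 0 + p 1 * v 1 + p 2 * v 2)) 0 := by
  have h (i : Fin 3) : HasDerivAt (fun τ : ℝ => (p + τ • v) i) (v i) 0 := by
    simpa using ((hasDerivAt_id (0 : ℝ)).mul_const (v i)).const_add (p i)
  have := ((((h 0).pow 2).add ((h 1).pow 2)).const_mul (16 : ℝ)).sub
    ((((((h 0).pow 2).add ((h 1).pow 2)).add ((h 2).pow 2)).add_const (3 : ℝ)).pow 2)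
  refine this.congr_deriv ?_
  simp
  ring

/-- The regular function whose superlevel set is bounded by a sphere and a torus. -/
def sphereTorusFun : RegularFunction 2 where
  toFun p := -(ballFun p * torusFun p)
  contDiff := (contDiff_ballFun.mul contDiff_torusFun).neg
  fderiv_ne_zero p hp hd := by
    have key (v : EuclideanSpace ℝ (Fin 3)) :
        -2 * (p 0 * v 0 + p 1 * v 1 + p 2 * v 2) * torusFun p +
        ballFun p * (32 * (p 0 * v 0 + p 1 * v 1) - 4 * (p 0 ^ 2 + p 1 ^ 2 + p 2 ^ 2 + 3) *
          (p 0 * v 0 + p 1 * v 1 + p 2 * v 2)) = 0 := by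
      have h1 := ((hasDerivAt_ballFun p v).mul (hasDerivAt_torusFun p v)).neg
      have h2 : HasFDerivAt (fun p => -(ballFun p * torusFun p)) _ p :=
        (((contDiff_ballFun.mul contDiff_torusFun).neg).differentiable (by simp) p).hasFDerivAt
      have h3 := HasDerivAt.unique (h2.hasLineDerivAt v) h1
      have h4 : (fderiv ℝ (fun p => -(ballFun p * torusFun p)) p) v = 0 := by rw [hd]; rfl
      have h5 := h4.symm.trans h3
      simp only [zero_smul, add_zero] at h5
      linarith
    rcases mul_eq_zero.1 (neg_eq_zero.1 hp) with h | h
    · have h1 := torusFun_neg_of_ballFun_nonneg h.ge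
      -- On the sphere the radial direction suffices, as the torus factor does not vanish there.
      have h2 := key p
      rw [h, zero_mul, add_zero] at h2
      rcases mul_eq_zero.1 h2 with h3 | h3
      · unfold ballFun at h
        nlinarith
      · exact h1.ne h3
    · have hb : ballFun p ≠ 0 := fun hb => (torusFun_neg_of_ballFun_nonneg hb.ge).ne h
      simp only [h, mul_zero, zero_add, mul_eq_zero, hb, false_or] at key
      -- On the torus the vertical direction forces height zero. The horizontal radial one then
      -- forces `p 0 ^ 2 + p 1 ^ 2` to be `0` or `5`, and neither value is on the torus.
      have h1 := key (EuclideanSpace.single 2 1)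
      have h2 := key !₂[p 0, p 1, 0]
      simp at h1 h2
      unfold torusFun at h
      have h3 : p 2 = 0 := h1.resolve_left (by positivity)
      rw [h3] at h h2
      have h4 : (p 0 ^ 2 + p 1 ^ 2) * (5 - (p 0 ^ 2 + p 1 ^ 2)) = 0 := by linarith
      rcases mul_eq_zero.1 h4 with h5 | h5
      · rw [h5] at h
        norm_num at h
      · have h6 : p 0 ^ 2 + p 1 ^ 2 = 5 := by linarith
        rw [h6] at h
        norm_num at h

instance : CompactSpace sphereTorusFun.Superlevel := by
  rw [← isCompact_univ_iff, sphereTorusFun.isEmbedding_val.isCompact_iff, image_univ,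
    sphereTorusFun.range_val]
  refine Metric.isCompact_of_isClosed_isBounded
    (isClosed_le continuous_const sphereTorusFun.contDiff.continuous)
    (isBounded_iff_forall_norm_le.2 ⟨3, fun p (hp : 0 ≤ -(ballFun p * torusFun p)) => ?_⟩)
  rw [EuclideanSpace.norm_eq, Real.sqrt_le_left (by norm_num)]
  simp only [Real.norm_eq_abs, sq_abs]
  have hs : ∑ i : Fin (2 + 1), p i ^ 2 = p 0 ^ 2 + p 1 ^ 2 + p 2 ^ 2 := Fin.sum_univ_three _
  rw [hs]
  -- The bound `3` is the outer radius of the torus: for `s > 9` one has `(s + 3)² > 16 s`, so both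
  -- factors are negative.
  by_contra! h
  have h1 : ballFun p < 0 := by
    unfold ballFun
    linarith
  have h2 : torusFun p < 0 := by
    unfold torusFun
    nlinarith [sq_nonneg (p 2)]
  nlinarith [mul_pos_of_neg_of_neg h1 h2]

lemma mem_sphere_fin_three {x : EuclideanSpace ℝ (Fin 3)} :
    x ∈ Metric.sphere (0 : EuclideanSpace ℝ (Fin 3)) 1 ↔ x 0 ^ 2 + x 1 ^ 2 + x 2 ^ 2 = 1 := by
  rw [mem_sphere_zero_iff_norm, EuclideanSpace.norm_eq, Real.sqrt_eq_one]
  simp [Fin.sum_univ_three]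

lemma mem_sphere_fin_two {x : EuclideanSpace ℝ (Fin 2)} :
    x ∈ Metric.sphere (0 : EuclideanSpace ℝ (Fin 2)) 1 ↔ x 0 ^ 2 + x 1 ^ 2 = 1 := by
  rw [mem_sphere_zero_iff_norm, EuclideanSpace.norm_eq, Real.sqrt_eq_one]
  simp [Fin.sum_univ_two]

/-- The sphere of radius `1 / 2`. -/
def smallSphereMap (x : S2) : EuclideanSpace ℝ (Fin 3) := (1 / 2 : ℝ) • x.1

lemma ballFun_smallSphereMap (x : S2) : ballFun (smallSphereMap x) = 0 := by
  have h := mem_sphere_fin_three.1 x.2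
  simp [ballFun, smallSphereMap]
  linarith

lemma smallSphereMap_injective : Function.Injective smallSphereMap := fun x y h =>
  Subtype.ext (smul_right_injective _ (by norm_num : (1 / 2 : ℝ) ≠ 0) h)

lemma contMDiff_smallSphereMap :
    ContMDiff (𝓡 2) 𝓘(ℝ, EuclideanSpace ℝ (Fin 3)) ∞ smallSphereMap :=
  ((1 / 2 : ℝ) • ContinuousLinearMap.id ℝ (EuclideanSpace ℝ (Fin 3))).contDiff.contMDiff.comp
    (contMDiff_coe_sphere_fin 2)

lemma mfderiv_smallSphereMap_injective (x : S2) : Function.Injective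
    (mfderiv (𝓡 2) 𝓘(ℝ, EuclideanSpace ℝ (Fin 3)) smallSphereMap x) := fun u v h => by
  have e := mfderiv_clm_comp_apply
    ((1 / 2 : ℝ) • ContinuousLinearMap.id ℝ (EuclideanSpace ℝ (Fin 3))) (x := x)
    ((contMDiff_coe_sphere_fin 2).mdifferentiableAt (by simp))
  exact mfderiv_coe_sphere_fin_injective 2 x
    (smul_right_injective (EuclideanSpace ℝ (Fin 3)) (by norm_num : (1 / 2 : ℝ) ≠ 0)
      (((e u).symm.trans h).trans (e v)))

/-- The torus of revolution in space. -/
def revolutionMap (p : S1 × S1) : EuclideanSpace ℝ (Fin 3) :=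
  !₂[(2 + p.2.1 0) * p.1.1 0, (2 + p.2.1 0) * p.1.1 1, p.2.1 1]

/-- A map inverse to `revolutionMap` on the torus. -/
def torusInv (p : EuclideanSpace ℝ (Fin 3)) :
    EuclideanSpace ℝ (Fin 2) × EuclideanSpace ℝ (Fin 2) :=
  (!₂[4 * p 0 / (p 0 ^ 2 + p 1 ^ 2 + p 2 ^ 2 + 3), 4 * p 1 / (p 0 ^ 2 + p 1 ^ 2 + p 2 ^ 2 + 3)],
    !₂[(p 0 ^ 2 + p 1 ^ 2 + p 2 ^ 2 + 3) / 4 - 2, p 2])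

/-- On the torus `|p|² + 3` is four times the distance to the axis. This makes the inverse
parametrisation rational with positive denominator, so it extends smoothly to all of space and
yields injectivity of the map and of its derivative. -/
lemma sq_norm_revolutionMap (p : S1 × S1) :
    revolutionMap p 0 ^ 2 + revolutionMap p 1 ^ 2 + revolutionMap p 2 ^ 2 = 5 + 4 * p.2.1 0 := by
  have h1 := mem_sphere_fin_two.1 p.1.2
  have h2 := mem_sphere_fin_two.1 p.2.2
  simp [revolutionMap]
  linear_combination (2 + p.2.1 0) ^ 2 * h1 + h2

lemma torusFun_revolutionMap (p : S1 × S1) : torusFun (revolutionMap p) = 0 := by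
  rw [torusFun, sq_norm_revolutionMap]
  have h1 := mem_sphere_fin_two.1 p.1.2
  simp [revolutionMap]
  linear_combination 16 * (2 + p.2.1 0) ^ 2 * h1

lemma two_add_pos (x : S1) : 0 < 2 + x.1 0 := by
  have := mem_sphere_fin_two.1 x.2
  nlinarith [sq_nonneg (x.1 1), sq_nonneg (x.1 0 + 1)]

lemma torusInv_revolutionMap (p : S1 × S1) : torusInv (revolutionMap p) = (p.1.1, p.2.1) := by
  have h := (two_add_pos p.2).ne'
  rw [torusInv, sq_norm_revolutionMap]
  have h' : 5 + 4 * p.2.1 0 + 3 = 4 * (2 + p.2.1 0) := by ring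
  rw [h']
  refine Prod.ext ?_ ?_
  · ext i
    fin_cases i
    · simp [revolutionMap]
      field_simp
    · simp [revolutionMap]
      field_simp
  · ext i
    fin_cases i <;> simp [revolutionMap]

lemma revolutionMap_injective : Function.Injective revolutionMap := fun p p' h => by
  have h1 := congrArg torusInv h
  rw [torusInv_revolutionMap, torusInv_revolutionMap] at h1
  exact Prod.ext (Subtype.ext (congrArg Prod.fst h1)) (Subtype.ext (congrArg Prod.snd h1))

lemma contDiff_torusInv : ContDiff ℝ ∞ torusInv := by
  have hq : ContDiff ℝ ∞ fun p : EuclideanSpace ℝ (Fin 3) => p 0 ^ 2 + p 1 ^ 2 + p 2 ^ 2 + 3 := by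
    fun_prop
  have h0 : ∀ p : EuclideanSpace ℝ (Fin 3), p 0 ^ 2 + p 1 ^ 2 + p 2 ^ 2 + 3 ≠ 0 :=
    fun p => by positivity
  refine ContDiff.prodMk ?_ ?_
  · rw [contDiff_euclidean]
    intro i
    fin_cases i
    · exact ContDiff.div (by fun_prop) hq h0
    · exact ContDiff.div (by fun_prop) hq h0
  · rw [contDiff_euclidean]
    intro i
    fin_cases i
    · exact (hq.div_const 4).sub contDiff_const
    · change ContDiff ℝ ∞ fun p : EuclideanSpace ℝ (Fin 3) => p 2
      fun_prop

lemma contMDiff_revolutionMap :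
    ContMDiff ((𝓡 1).prod (𝓡 1)) 𝓘(ℝ, EuclideanSpace ℝ (Fin 3)) ∞ revolutionMap := by
  have h1 : ContMDiff ((𝓡 1).prod (𝓡 1))
      𝓘(ℝ, EuclideanSpace ℝ (Fin 2) × EuclideanSpace ℝ (Fin 2)) ∞
      (fun p : S1 × S1 => (p.1.1, p.2.1)) :=
    ((contMDiff_coe_sphere_fin 1).comp contMDiff_fst).prodMk_space
      ((contMDiff_coe_sphere_fin 1).comp contMDiff_snd)
  have h2 : ContDiff ℝ ∞ fun p : EuclideanSpace ℝ (Fin 2) × EuclideanSpace ℝ (Fin 2) =>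
      (!₂[(2 + p.2 0) * p.1 0, (2 + p.2 0) * p.1 1, p.2 1] : EuclideanSpace ℝ (Fin 3)) := by
    rw [contDiff_euclidean]
    intro i
    fin_cases i
    · change ContDiff ℝ ∞ fun p : EuclideanSpace ℝ (Fin 2) × EuclideanSpace ℝ (Fin 2) =>
        (2 + p.2 0) * p.1 0
      fun_prop
    · change ContDiff ℝ ∞ fun p : EuclideanSpace ℝ (Fin 2) × EuclideanSpace ℝ (Fin 2) =>
        (2 + p.2 0) * p.1 1
      fun_prop
    · change ContDiff ℝ ∞ fun p : EuclideanSpace ℝ (Fin 2) × EuclideanSpace ℝ (Fin 2) => p.2 1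
      fun_prop
  exact h2.contMDiff.comp h1

lemma mfderiv_revolutionMap_injective (x : S1 × S1) : Function.Injective
    (mfderiv ((𝓡 1).prod (𝓡 1)) 𝓘(ℝ, EuclideanSpace ℝ (Fin 3)) revolutionMap x) := by
  refine injective_mfderiv_of_comp (g := torusInv)
    (I'' := 𝓘(ℝ, EuclideanSpace ℝ (Fin 2) × EuclideanSpace ℝ (Fin 2)))
    (contMDiff_revolutionMap.mdifferentiableAt (by simp))
    (contDiff_torusInv.contMDiff.mdifferentiableAt (by simp)) fun u v h => ?_
  have hd : MDifferentiableAt ((𝓡 1).prod (𝓡 1))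
      𝓘(ℝ, EuclideanSpace ℝ (Fin 2) × EuclideanSpace ℝ (Fin 2)) (torusInv ∘ revolutionMap) x :=
    (contDiff_torusInv.contMDiff.comp contMDiff_revolutionMap).mdifferentiableAt (by simp)
  have hS (y : S1) : MDifferentiableAt (𝓡 1) 𝓘(ℝ, EuclideanSpace ℝ (Fin 2))
      (Subtype.val : S1 → _) y := (contMDiff_coe_sphere_fin 1).mdifferentiableAt (by simp)
  have h1 : ContinuousLinearMap.fst ℝ (EuclideanSpace ℝ (Fin 2)) (EuclideanSpace ℝ (Fin 2)) ∘
      torusInv ∘ revolutionMap = (Subtype.val : S1 → _) ∘ Prod.fst := by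
    funext p
    change (torusInv (revolutionMap p)).1 = _
    rw [torusInv_revolutionMap]
    rfl
  have h2 : ContinuousLinearMap.snd ℝ (EuclideanSpace ℝ (Fin 2)) (EuclideanSpace ℝ (Fin 2)) ∘
      torusInv ∘ revolutionMap = (Subtype.val : S1 → _) ∘ Prod.snd := by
    funext p
    change (torusInv (revolutionMap p)).2 = _
    rw [torusInv_revolutionMap]
    rfl
  have e1 := mfderiv_clm_comp_apply (ContinuousLinearMap.fst ℝ _ _) hd
  have e2 := mfderiv_clm_comp_apply (ContinuousLinearMap.snd ℝ _ _) hd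
  rw [h1, mfderiv_comp x (hS _) mdifferentiableAt_fst, mfderiv_fst] at e1
  rw [h2, mfderiv_comp x (hS _) mdifferentiableAt_snd, mfderiv_snd] at e2
  refine Prod.ext (mfderiv_coe_sphere_fin_injective 1 x.1 ?_)
    (mfderiv_coe_sphere_fin_injective 1 x.2 ?_)
  · exact ((e1 u).trans (congrArg Prod.fst h)).trans (e1 v).symm
  · exact ((e2 u).trans (congrArg Prod.snd h)).trans (e2 v).symm

lemma exists_revolutionMap_eq {p : EuclideanSpace ℝ (Fin 3)} (hp : torusFun p = 0) :
    ∃ x, revolutionMap x = p := by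
  have h0 : p 0 ^ 2 + p 1 ^ 2 + p 2 ^ 2 + 3 ≠ 0 := by positivity
  unfold torusFun at hp
  refine ⟨⟨⟨(torusInv p).1, mem_sphere_fin_two.2 ?_⟩, ⟨(torusInv p).2, mem_sphere_fin_two.2 ?_⟩⟩, ?_⟩
  · simp [torusInv]
    field_simp
    linarith
  · simp [torusInv]
    linarith
  · ext i
    fin_cases i
    · simp [torusInv, revolutionMap]
      field_simp
    · simp [torusInv, revolutionMap]
      field_simp
    · simp [torusInv, revolutionMap]

/-- The antidiagonal sphere and the Clifford torus are smoothly cobordant. -/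
theorem smoothlyCobordant_antidiagonalSphere_cliffordTorus :
    SmoothlyCobordant ((𝓡 2).prod (𝓡 2)) 2 antidiagonalSphere cliffordTorus := by
  have hj (x : S2) : sphereTorusFun.toFun (smallSphereMap x) = 0 := by
    simp [sphereTorusFun, ballFun_smallSphereMap]
  have hj' (x : S1 × S1) : sphereTorusFun.toFun (revolutionMap x) = 0 := by
    simp [sphereTorusFun, torusFun_revolutionMap]
  let j : S2 → sphereTorusFun.Superlevel := fun x => ⟨smallSphereMap x, (hj x).ge⟩
  let j' : S1 × S1 → sphereTorusFun.Superlevel := fun x => ⟨revolutionMap x, (hj' x).ge⟩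
  have hjc : Continuous j :=
    sphereTorusFun.isEmbedding_val.continuous_iff.2 contMDiff_smallSphereMap.continuous
  have hjc' : Continuous j' :=
    sphereTorusFun.isEmbedding_val.continuous_iff.2 contMDiff_revolutionMap.continuous
  have hi : Manifold.IsSmoothEmbedding (𝓡 2) (𝓡∂ 3) ∞ j :=
    ⟨sphereTorusFun.isImmersion_of_injective_mfderiv (by simp) contMDiff_smallSphereMap
      mfderiv_smallSphereMap_injective hj, (hjc.isClosedEmbedding fun x y h =>
      smallSphereMap_injective (congrArg sphereTorusFun.val h)).isEmbedding⟩
  have hi' : Manifold.IsSmoothEmbedding ((𝓡 1).prod (𝓡 1)) (𝓡∂ 3) ∞ j' :=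
    ⟨sphereTorusFun.isImmersion_of_prod_of_injective_mfderiv (by simp) contMDiff_revolutionMap
      mfderiv_revolutionMap_injective hj', (hjc'.isClosedEmbedding fun x y h =>
      revolutionMap_injective (congrArg sphereTorusFun.val h)).isEmbedding⟩
  have hdisj : Disjoint (range j) (range j') := by
    rw [Set.disjoint_left]
    rintro _ ⟨x, rfl⟩ ⟨y, hy⟩
    have h1 : revolutionMap y = smallSphereMap x := congrArg sphereTorusFun.val hy
    have h2 := torusFun_neg_of_ballFun_nonneg (ballFun_smallSphereMap x).ge
    rw [← h1, torusFun_revolutionMap] at h2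
    exact lt_irrefl _ h2
  have hunion : range j ∪ range j' = (𝓡∂ 3).boundary sphereTorusFun.Superlevel := by
    ext y
    refine Iff.trans ?_ (sphereTorusFun.mem_boundary_iff y).symm
    constructor
    · rintro (⟨x, rfl⟩ | ⟨x, rfl⟩)
      · exact hj x
      · exact hj' x
    · intro hy
      rcases mul_eq_zero.1 (neg_eq_zero.1 hy) with h | h
      · refine Or.inl ⟨⟨(2 : ℝ) • sphereTorusFun.val y, mem_sphere_fin_three.2 ?_⟩,
          sphereTorusFun.val_injective ?_⟩
        · unfold ballFun at h
          simp
          linarith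
        · change (1 / 2 : ℝ) • (2 : ℝ) • sphereTorusFun.val y = _
          rw [smul_smul]
          norm_num
      · obtain ⟨x, hx⟩ := exists_revolutionMap_eq h
        exact Or.inr ⟨x, sphereTorusFun.val_injective hx⟩
  exact ⟨antidiagonalPresentation, cliffordPresentation, sphereTorusFun.Superlevel, inferInstance,
    inferInstance, inferInstance, inferInstance, inferInstance, j, j', hi, hi', hdisj, hunion⟩

end SmoothCobordism

end

/-! ### The two assertions together -/

theorem mainTheorem10 :
    (∀ (n : ℕ)
      (E : Type) [NormedAddCommGroup E] [NormedSpace ℝ E] [FiniteDimensional ℝ E]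
      (H : Type) [TopologicalSpace H] (I : ModelWithCorners ℝ E H) [I.Boundaryless]
      (M : Type) [TopologicalSpace M] [ChartedSpace H M] [IsManifold I ∞ M]
      [T2Space M] [SecondCountableTopology M]
      (Ω : TwoForm I M) (L L' : Set M),
      finrank ℝ E = 2 * n → IsSymplectic I Ω →
      IsClosedLagrangian Ω n L → IsClosedLagrangian Ω n L' →
      LagrangianCobordant Ω n L L' → Homologous₂ n L L') ∧
    (∀ c : ℝ, c ≠ 0 →
      IsSymplectic ((𝓡 2).prod (𝓡 2)) (splitForm c) ∧
      IsClosedLagrangian (splitForm c) 2 antidiagonalSphere ∧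
      IsClosedLagrangian (splitForm c) 2 cliffordTorus ∧
      ¬ LagrangianCobordant (splitForm c) 2 antidiagonalSphere cliffordTorus) ∧
    SmoothlyCobordant ((𝓡 2).prod (𝓡 2)) 2 antidiagonalSphere cliffordTorus ∧
    (∃ a, RepresentsClass₂ 2 antidiagonalSphere a) ∧
    (∃ b, RepresentsClass₂ 2 cliffordTorus b) ∧
    (∀ a b, RepresentsClass₂ 2 antidiagonalSphere a → RepresentsClass₂ 2 cliffordTorus b →
      a ≠ b) := by
  refine ⟨?_, fun c hc => ⟨isSymplectic_splitForm hc, isClosedLagrangian_antidiagonalSphere c,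
    isClosedLagrangian_cliffordTorus c, fun h => ?_⟩,
    smoothlyCobordant_antidiagonalSphere_cliffordTorus,
    antidiagonalPresentation.exists_representsClass, cliffordPresentation.exists_representsClass,
    fun a b ha hb => antidiagonal_ne_cliffordTorus ha hb⟩
  · intro n E _ _ _ H _ I _ M _ _ _ _ _ Ω L L' _ _ _ _ h
    exact h.homologous
  · obtain ⟨a, ha, hb⟩ := h.homologous
    exact antidiagonal_ne_cliffordTorus ha hb rfl
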